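/- Let $p(n)$ be the number of partitions of $n$ (with $p(0)=1$), let $f(x)=\sum_{n\ge 0}p(n)x^n$, and for an integer $r\ge 0$ let $p_r(n)$ be the coefficient of $x^n$ in $$f_r(x)=\frac{f(x)\,f(x^{2^r})}{f(x^2)}.$$ Write $(h,k)$ for $\gcd(h,k)$, and for integers $h\ge 0$, $k\ge 1$ put $$\omega(h,k)=\exp\Bigl(\pi i\sum_{m=1}^{k-1}\frac mk\Bigl(\frac{hm}{k}-\Bigl\lfloor\frac{hm}{k}\Bigr\rfloor-\frac12\Bigr)\Bigr).$$ (a) Let $r\in\{0,1,2,3,4\}$ and let $n$ be an integer with $n>(2^r-1)/24$ (equivalently, $n\ge 1$). Then $$ \begin{aligned} p_r(n)={}&\frac{2^{(r+1)/2}\sqrt3}{\pi}\sum_{\substack{k\ge 1\\ (k,2^{\max(r,1)})=1}}\sqrt k\sum_{\substack{0\le h<k\\ (h,k)=1}}e^{-2\pi i nh/k}\,\frac{\omega(h,k)\,\omega(2^rh,k)}{\omega(2h,k)}\;\frac{d}{dn}\left\{\frac{\sinh\left(\frac{\pi\sqrt{(24n-2^r+1)(1+2^{r-1})}}{2^{r/2}\cdot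 6k}\right)}{\sqrt{24n-2^r+1}}\right\}\\ &+\frac{\sqrt3}{\pi}\sum_{j=1+\lfloor r/2\rfloor}^{r}2^{(2-j+r)/2}\sum_{\substack{k\ge 1\\ (k,2^r)=2^j}}\sqrt k\sum_{\substack{0\le h<k\\ (h,k)=1}}e^{-2\pi i nh/k}\,\frac{\omega(h,k)\,\omega(2^{r-j}h,2^{-j}k)}{\omega(h,\frac k2)}\;\frac{d}{dn}\left\{\frac{\sinh\left(\frac{\pi\sqrt{(24n-2^r+1)(-1+2^{2j-r})}}{6k}\right)}{\sqrt{24n-2^r+1}}\right\}, \end{aligned} $$ where $d/dn$ is the derivative with respect to $n$ regarded as a real variable, and all series over $k$ converge absolutely. (b) For every $n\ge 0$, $p_0(n)=\overline p(n)$ is the number of overpartitions of $n$ (partitions of $n$ in which the last occurrence of each part size may or may not be overlined), $p_1(n)=p(n)$, and $p_2(n)=pod(n)$ is the number of partitions of $n$ in which no odd part appears more than once. (c) The cases $r=0,1,2$ of (a) give, for every $n\ge 1$, respectively Zuckerman's formula $$\overline p(n)=\frac1{2\pi}\sum_{\substack{k\ge1\\ 2\nmid k}}\sqrt k\sum_{\substack{0\le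 h<k\\ (h,k)=1}}\frac{\omega(h,k)^2}{\omega(2h,k)}e^{-2\pi i nh/k}\frac{d}{dn}\left(\frac{\sinh\left(\frac{\pi\sqrt n}{k}\right)}{\sqrt n}\right),$$ Rademacher's formula $$p(n)=\frac1{\pi\sqrt2}\sum_{k\ge1}\sqrt k\sum_{\substack{0\le h<k\\ (h,k)=1}}\omega(h,k)e^{-2\pi i nh/k}\frac{d}{dn}\left(\frac{\sinh\left(\frac\pi k\sqrt{\frac23\left(n-\frac1{24}\right)}\right)}{\sqrt{n-\frac1{24}}}\right),$$ and the formula $$pod(n)=\frac2\pi\sum_{k\ge1}\sqrt{k\left(1-(-1)^k+\left\lfloor\tfrac{(k,4)}4\right\rfloor\right)}\sum_{\substack{0\le h<k\\ (h,k)=1}}\frac{\omega(h,k)\,\omega\left(\frac{4h}{(k,4)},\frac k{(k,4)}\right)}{\omega\left(\frac{2h}{(k,2)},\frac k{(k,2)}\right)}e^{-2\pi i nh/k}\frac{d}{dn}\left(\frac{\sinh\left(\frac{\pi\sqrt{(k,4)(8n-1)}}{4k}\right)}{\sqrt{8n-1}}\right),$$ again with absolutely convergent series over $k$. -/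

import Mathlib

noncomputable section

namespace Rademacher

open Finset

/-- The number `p(n)` of partitions of `n`. -/
def numPartitions (n : ℕ) : ℕ := Fintype.card (Nat.Partition n)

/-- Overpartitions of `n`: a partition of `n` together with the set of those part sizes whose last
occurrence is overlined. -/
def overpartitions (n : ℕ) : Finset (Σ _ : Nat.Partition n, Finset ℕ) :=
  Finset.univ.sigma fun l => l.parts.toFinset.powerset

/-- The number of overpartitions of `n`. -/
def numOverpartitions (n : ℕ) : ℕ := (overpartitions n).card

/-- The number `pod(n)` of partitions of `n` in which no odd part appears more than once. -/
def pod (n : ℕ) : ℕ :=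
  (Finset.univ.filter fun l : Nat.Partition n => ∀ i ∈ l.parts, Odd i → l.parts.count i ≤ 1).card

/-- The generating function `f(x) = ∑ p(n) xⁿ` of the partition function. -/
def f : PowerSeries ℂ := PowerSeries.mk fun n => (numPartitions n : ℂ)

/-- `f_r(x) = f(x) f(x^(2^r)) / f(x^2)`; the power series `f(x^2)` has constant term `1`, so that
the inverse is a genuine one. -/
def fr (r : ℕ) : PowerSeries ℂ :=
  f * PowerSeries.expand (2 ^ r) (pow_ne_zero r two_ne_zero) f
    * (PowerSeries.expand 2 two_ne_zero f)⁻¹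

/-- `p_r(n)`, the coefficient of `xⁿ` in `f_r(x)`. -/
def pr (r n : ℕ) : ℂ := PowerSeries.coeff n (fr r)

/-- `ω(h,k) = exp(π i ∑_{m=1}^{k-1} (m/k) (hm/k - ⌊hm/k⌋ - 1/2))`. -/
def omega (h k : ℕ) : ℂ :=
  Complex.exp (Real.pi * Complex.I *
    ((∑ m ∈ Finset.Ico 1 k,
      ((m : ℝ) / k) * ((h * m : ℝ) / k - (⌊(h * m : ℝ) / k⌋ : ℝ) - 1 / 2) : ℝ) : ℂ))

/-- The `h` with `0 ≤ h < k` and `(h,k) = 1`. -/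
def reduced (k : ℕ) : Finset ℕ := (Finset.range k).filter fun h => Nat.gcd h k = 1

/-- `e^{-2π i n h/k}`. -/
def phase (n h k : ℕ) : ℂ := Complex.exp (-2 * Real.pi * Complex.I * n * h / k)

/-- The `k`-th term of the series over odd `k`. -/
def mainTerm (r n k : ℕ) : ℂ :=
  (Real.sqrt k : ℂ)
    * (∑ h ∈ reduced k, phase n h k * (omega h k * omega (2 ^ r * h) k / omega (2 * h) k))
    * ((deriv (fun x : ℝ =>
        Real.sinh (Real.pi * Real.sqrt ((24 * x - 2 ^ r + 1) * (1 + (2 : ℝ) ^ ((r : ℤ) - 1)))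
            / ((2 : ℝ) ^ ((r : ℝ) / 2) * (6 * k)))
          / Real.sqrt (24 * x - 2 ^ r + 1)) (n : ℝ) : ℝ) : ℂ)

/-- The `k`-th term of the series over the `k` with `(k, 2^r) = 2^j`. It is used only for such `k`
and `1 ≤ j ≤ r`, where the divisions `k / 2 ^ j` and `k / 2` are exact. -/
def extraTerm (r j n k : ℕ) : ℂ :=
  (Real.sqrt k : ℂ)
    * (∑ h ∈ reduced k,
        phase n h k * (omega h k * omega (2 ^ (r - j) * h) (k / 2 ^ j) / omega h (k / 2)))
    * ((deriv (fun x : ℝ =>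
        Real.sinh (Real.pi
            * Real.sqrt ((24 * x - 2 ^ r + 1) * (-1 + (2 : ℝ) ^ (2 * (j : ℤ) - (r : ℤ))))
            / (6 * k))
          / Real.sqrt (24 * x - 2 ^ r + 1)) (n : ℝ) : ℝ) : ℂ)

/-- The `k`-th term of the series for the number of overpartitions. -/
def overTerm (n k : ℕ) : ℂ :=
  (Real.sqrt k : ℂ)
    * (∑ h ∈ reduced k, (omega h k ^ 2 / omega (2 * h) k) * phase n h k)
    * ((deriv (fun x : ℝ =>
        Real.sinh (Real.pi * Real.sqrt x / k) / Real.sqrt x) (n : ℝ) : ℝ) : ℂ)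

/-- The `k`-th term of the series for the number of partitions. -/
def partTerm (n k : ℕ) : ℂ :=
  (Real.sqrt k : ℂ)
    * (∑ h ∈ reduced k, omega h k * phase n h k)
    * ((deriv (fun x : ℝ =>
        Real.sinh (Real.pi / k * Real.sqrt (2 / 3 * (x - 1 / 24)))
          / Real.sqrt (x - 1 / 24)) (n : ℝ) : ℝ) : ℂ)

/-- The `k`-th term of the series for `pod`; all divisions of natural numbers are exact, except
`(k,4) / 4`, which is the floor `⌊(k,4)/4⌋`. -/
def podTerm (n k : ℕ) : ℂ :=
  (Real.sqrt (k * (1 - (-1) ^ k + ((Nat.gcd k 4 / 4 : ℕ) : ℝ))) : ℂ)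
    * (∑ h ∈ reduced k,
        (omega h k * omega (4 * h / Nat.gcd k 4) (k / Nat.gcd k 4)
          / omega (2 * h / Nat.gcd k 2) (k / Nat.gcd k 2)) * phase n h k)
    * ((deriv (fun x : ℝ =>
        Real.sinh (Real.pi * Real.sqrt ((Nat.gcd k 4 : ℝ) * (8 * x - 1)) / (4 * k))
          / Real.sqrt (8 * x - 1)) (n : ℝ) : ℝ) : ℂ)

end Rademacher

end

/-!
The coefficients `p_r(n)` are extracted by the circle method. Euler's product `∏ (1 - xⁿ)` has a
functional equation at every fraction `h/k`, with multiplier `ω(h, k)`, obtained by induction along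
the Euclidean algorithm from the inversion formula of the eta function and the reciprocity law of
Dedekind sums. Hence near `h/k` the function `f_r` is a factor of automorphy times a power series in
exponentially small variables; when `r ≤ 4` only the constant term of that series can be large, and
it is large exactly when `1 + (2^r, k)² / 2^r - (2, k)² / 2 > 0`. Integrating over a path of Ford
circle arcs, the contribution of the constant term is completed to an integral over the whole
circle, which evaluates to the derivative of `sinh (c √x) / √x`. The sum of all errors tends to `0`
as the order of the Farey sequence grows.
-/

noncomputable section

namespace Rademacher

section DedekindSum

open Finset

/-- The Dedekind sum `s(h,k) = ∑ ((m/k)) ((hm/k))`, in the form `∑ (m/k) ({hm/k} - 1/2)` in which it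
appears in the exponent of `ω(h,k)`; it agrees with the classical one for `(h,k) = 1`. -/
def dedekindSum (h : ℤ) (k : ℕ) : ℝ :=
  ∑ m ∈ Ico 1 k, ((m : ℝ) / k) * (Int.fract ((h * m : ℝ) / k) - 1 / 2)

theorem omega_eq_exp_dedekindSum (h k : ℕ) :
    omega h k = Complex.exp (Real.pi * Complex.I * (dedekindSum h k : ℝ)) := by
  simp only [omega, dedekindSum, Int.fract, Int.cast_natCast]

theorem dedekindSum_add_mul (h c : ℤ) (k : ℕ) : dedekindSum (h + c * k) k = dedekindSum h k := by
  rcases Nat.eq_zero_or_pos k with rfl | hk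
  · simp
  refine sum_congr rfl fun m _ => ?_
  have hk' : (k : ℝ) ≠ 0 := by positivity
  have : (((h + c * k : ℤ) : ℝ) * m) / k = (h * m : ℝ) / k + ((c * m : ℤ) : ℝ) := by
    push_cast; field_simp
  rw [this, Int.fract_add_intCast]

theorem dedekindSum_neg {h : ℤ} {k : ℕ} (hk : 0 < k) (hc : IsCoprime h k) :
    dedekindSum (-h) k = -dedekindSum h k := by
  rw [dedekindSum, dedekindSum, ← sum_neg_distrib]
  refine sum_congr rfl fun m hm => ?_
  have hk' : (k : ℝ) ≠ 0 := by positivity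
  rw [mem_Ico] at hm
  have hne : Int.fract ((h * m : ℝ) / k) ≠ 0 := by
    intro h0
    rw [Int.fract_eq_iff] at h0
    obtain ⟨-, -, z, hz⟩ := h0
    rw [sub_zero, div_eq_iff hk'] at hz
    have hz' : h * m = z * k := by exact_mod_cast hz
    have hdvd : (k : ℤ) ∣ m := hc.symm.dvd_of_dvd_mul_left ⟨z, by rw [hz', mul_comm]⟩
    exact Nat.not_dvd_of_pos_of_lt hm.1 hm.2 (Int.natCast_dvd_natCast.mp hdvd)
  have : ((-h : ℤ) * m : ℝ) / k = -((h * m : ℝ) / k) := by push_cast; ring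
  rw [this, Int.fract_neg hne]
  ring

theorem injOn_mul_mod_of_coprime {h k : ℕ} (hc : Nat.Coprime h k) :
    Set.InjOn (fun m => h * m % k) (range k) := by
  intro a ha b hb hab
  simp only [coe_range, Set.mem_Iio] at ha hb
  have hmod : a ≡ b [MOD k] := Nat.ModEq.cancel_left_of_coprime hc.symm hab
  rwa [Nat.ModEq, Nat.mod_eq_of_lt ha, Nat.mod_eq_of_lt hb] at hmod

theorem sum_mul_mod_of_coprime {M : Type*} [AddCommMonoid M] {h k : ℕ} (hc : Nat.Coprime h k)
    (g : ℕ → M) : ∑ m ∈ range k, g (h * m % k) = ∑ m ∈ range k, g m := by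
  have himage : (range k).image (fun m => h * m % k) = range k := by
    refine eq_of_subset_of_card_le (fun x hx => ?_)
      (card_image_of_injOn (injOn_mul_mod_of_coprime hc)).ge
    obtain ⟨a, ha, rfl⟩ := mem_image.mp hx
    exact mem_range.mpr (Nat.mod_lt _ (Nat.zero_lt_of_lt (mem_range.mp ha)))
  conv_rhs => rw [← himage, sum_image (injOn_mul_mod_of_coprime hc)]

theorem natCast_mod_eq_sub {R : Type*} [Ring R] (a b : ℕ) :
    ((a % b : ℕ) : R) = a - b * ((a / b : ℕ) : R) := by
  rw [eq_sub_iff_add_eq', ← Nat.cast_mul, ← Nat.cast_add, Nat.div_add_mod]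

section

variable {K : Type*} [Field K] [CharZero K]

theorem sum_range_natCast (k : ℕ) : ∑ m ∈ range k, (m : K) = k * (k - 1) / 2 := by
  induction k with
  | zero => simp
  | succ k ih => rw [sum_range_succ, ih]; push_cast; ring

theorem sum_range_natCast_sq (k : ℕ) :
    ∑ m ∈ range k, (m : K) ^ 2 = k * (k - 1) * (2 * k - 1) / 6 := by
  induction k with
  | zero => simp
  | succ k ih => rw [sum_range_succ, ih]; push_cast; ring

end

theorem sum_Ico_one_two_mul_sub_one {R : Type*} [CommRing R] {q : ℕ} (hq : 0 < q) :
    ∑ l ∈ Ico 1 q, (2 * (l : R) - 1) = ((q : R) - 1) ^ 2 := by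
  induction q, hq using Nat.le_induction with
  | base => simp
  | succ q hq ih => rw [sum_Ico_succ_top hq, ih]; push_cast; ring

theorem filter_Ico_mul_le {h k m : ℕ} (hm : m < k) :
    (Ico 1 h).filter (fun l => k * l ≤ h * m) = Ico 1 (h * m / k + 1) := by
  have hk : 0 < k := Nat.zero_lt_of_lt hm
  ext l
  simp only [mem_filter, mem_Ico, Nat.lt_succ_iff, Nat.le_div_iff_mul_le hk, mul_comm l k]
  refine ⟨fun H => ⟨H.1.1, H.2⟩, fun H => ⟨⟨H.1, ?_⟩, H.2⟩⟩
  by_contra! hl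
  nlinarith [Nat.mul_le_mul_left k hl]

theorem filter_range_mul_le {h k l : ℕ} (hc : Nat.Coprime h k) (hl : l ∈ Ico 1 h) :
    (range k).filter (fun m => k * l ≤ h * m) = Ico (k * l / h + 1) k := by
  rw [mem_Ico] at hl
  ext m
  simp only [mem_filter, mem_range, mem_Ico, Nat.succ_le_iff,
    Nat.div_lt_iff_lt_mul (show 0 < h by omega), mul_comm m h]
  have hne : k * l ≠ h * m := fun e =>
    Nat.not_dvd_of_pos_of_lt hl.1 hl.2 (hc.dvd_of_dvd_mul_left ⟨m, e⟩)
  exact ⟨fun H => ⟨lt_of_le_of_ne H.2 hne, H.1⟩, fun H => ⟨H.2, H.1.le⟩⟩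

theorem sum_Ico_one_eq_sum_range {M : Type*} [AddCommMonoid M] {k : ℕ} (hk : 0 < k) {g : ℕ → M}
    (hg : g 0 = 0) : ∑ m ∈ Ico 1 k, g m = ∑ m ∈ range k, g m := by
  rw [range_eq_Ico, sum_eq_sum_Ico_succ_bot hk, hg, zero_add]

/-- Writing `⌊hm/k⌋²` as the sum of the first `⌊hm/k⌋` odd numbers turns the left side into a sum
over the lattice points below the diagonal of a rectangle, which is then summed by columns. -/
theorem sum_mul_div_sq_eq_sum_Ico {h k : ℕ} (hc : Nat.Coprime h k) :
    ∑ m ∈ range k, ((h * m / k : ℕ) : ℝ) ^ 2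
      = ∑ l ∈ Ico 1 h, (2 * (l : ℝ) - 1) * ((k : ℝ) - 1 - ((k * l / h : ℕ) : ℝ)) := by
  have hsq : ∀ m ∈ range k, ((h * m / k : ℕ) : ℝ) ^ 2
      = ∑ l ∈ Ico 1 h, if k * l ≤ h * m then 2 * (l : ℝ) - 1 else 0 := fun m hm => by
    rw [← sum_filter, filter_Ico_mul_le (mem_range.mp hm),
      sum_Ico_one_two_mul_sub_one (Nat.succ_pos _)]
    push_cast
    ring
  rw [sum_congr rfl hsq, sum_comm]
  refine sum_congr rfl fun l hl => ?_
  rw [← sum_filter, sum_const, nsmul_eq_mul, mul_comm, filter_range_mul_le hc hl, Nat.card_Ico]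
  rw [mem_Ico] at hl
  have hk : 0 < k := Nat.pos_of_ne_zero fun h0 => by
    rw [h0, Nat.coprime_zero_right] at hc
    omega
  have hlt : k * l / h < k := by
    rw [Nat.div_lt_iff_lt_mul (by omega)]
    exact Nat.mul_lt_mul_of_pos_left hl.2 hk
  rw [Nat.cast_sub hlt]
  push_cast
  ring

theorem sum_mul_div {h k : ℕ} (hk : 0 < k) (hc : Nat.Coprime h k) :
    ∑ m ∈ range k, ((h * m / k : ℕ) : ℝ) = (k - 1) * (h - 1) / 2 := by
  have hperm := sum_mul_mod_of_coprime hc (fun x => (x : ℝ))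
  simp only [natCast_mod_eq_sub, sum_sub_distrib, ← mul_sum, Nat.cast_mul, sum_range_natCast]
    at hperm
  have hk' : (k : ℝ) ≠ 0 := by positivity
  refine mul_left_cancel₀ hk' ?_
  linear_combination -hperm

theorem sum_mul_div_sq {h k : ℕ} (hh : 0 < h) (hc : Nat.Coprime h k) :
    ∑ m ∈ range k, ((h * m / k : ℕ) : ℝ) ^ 2 = (k - 1) * (h - 1) ^ 2 + (k - 1) * (h - 1) / 2
      - 2 * ∑ l ∈ range h, (l : ℝ) * ((k * l / h : ℕ) : ℝ) := by
  have hL := sum_mul_div hh hc.symm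
  rw [← sum_Ico_one_eq_sum_range hh (by simp)] at hL ⊢
  have hexpand : ∀ l ∈ Ico 1 h, (2 * (l : ℝ) - 1) * ((k : ℝ) - 1 - ((k * l / h : ℕ) : ℝ))
      = (k - 1) * (2 * l - 1) - 2 * (l * ((k * l / h : ℕ) : ℝ)) + ((k * l / h : ℕ) : ℝ) :=
    fun l _ => by ring
  rw [sum_mul_div_sq_eq_sum_Ico hc, sum_congr rfl hexpand, sum_add_distrib, sum_sub_distrib,
    ← mul_sum, ← mul_sum, sum_Ico_one_two_mul_sub_one hh, hL]
  ring

theorem sum_mul_mul_div {h k : ℕ} (hc : Nat.Coprime h k) :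
    2 * h * k * ∑ m ∈ range k, (m : ℝ) * ((h * m / k : ℕ) : ℝ)
      = (h ^ 2 - 1) * (k * (k - 1) * (2 * k - 1) / 6)
        + k ^ 2 * ∑ m ∈ range k, ((h * m / k : ℕ) : ℝ) ^ 2 := by
  have hperm := sum_mul_mod_of_coprime hc (fun x => (x : ℝ) ^ 2)
  have hexpand : ∀ m ∈ range k, ((h * m % k : ℕ) : ℝ) ^ 2 = h ^ 2 * (m : ℝ) ^ 2
      - 2 * h * k * (m * ((h * m / k : ℕ) : ℝ)) + k ^ 2 * ((h * m / k : ℕ) : ℝ) ^ 2 := by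
    intro m _
    rw [natCast_mod_eq_sub]
    push_cast
    ring
  rw [sum_congr rfl hexpand, sum_add_distrib, sum_sub_distrib, ← mul_sum, ← mul_sum, ← mul_sum,
    sum_range_natCast_sq] at hperm
  linear_combination -hperm

theorem dedekindSum_natCast {h k : ℕ} (hk : 0 < k) :
    dedekindSum h k = h * (k - 1) * (2 * k - 1) / (6 * k)
      - (∑ m ∈ range k, (m : ℝ) * ((h * m / k : ℕ) : ℝ)) / k - (k - 1) / 4 := by
  have hk' : (k : ℝ) ≠ 0 := by positivity
  have hterm : ∀ m ∈ range k, ((m : ℝ) / k) * (Int.fract (((h : ℤ) * m : ℝ) / k) - 1 / 2)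
      = h / k ^ 2 * (m : ℝ) ^ 2 - (m : ℝ) * ((h * m / k : ℕ) : ℝ) / k - m / (2 * k) := by
    intro m _
    have hcast : (((h : ℤ) : ℝ) * m) / k = ((h * m : ℕ) : ℝ) / (k : ℕ) := by push_cast; ring
    rw [hcast, Int.fract_div_natCast_eq_div_natCast_mod, natCast_mod_eq_sub]
    push_cast
    field_simp
  rw [dedekindSum, sum_Ico_one_eq_sum_range hk (by simp), sum_congr rfl hterm, sum_sub_distrib,
    sum_sub_distrib, ← mul_sum, ← sum_div, ← sum_div, sum_range_natCast, sum_range_natCast_sq]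
  field_simp
  ring

theorem dedekindSum_reciprocity {h k : ℕ} (hh : 0 < h) (hk : 0 < k) (hc : Nat.Coprime h k) :
    dedekindSum h k + dedekindSum k h
      = -1 / 4 + ((h : ℝ) / k + k / h + 1 / (h * k)) / 12 := by
  have hk' : (k : ℝ) ≠ 0 := by positivity
  have hh' : (h : ℝ) ≠ 0 := by positivity
  rw [dedekindSum_natCast hk, dedekindSum_natCast hh]
  have hQ := sum_mul_div_sq hh hc
  have hS := eq_div_of_mul_eq (by positivity) ((mul_comm _ _).trans (sum_mul_mul_div hc))
  rw [hQ] at hS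
  rw [hS]
  field_simp
  ring

end DedekindSum

section EtaTransformation

open Complex Real

theorem mul_cpow_of_arg {x y : ℂ} (hx : x ≠ 0) (hy : y ≠ 0) (h1 : -π < x.arg + y.arg)
    (h2 : x.arg + y.arg ≤ π) (s : ℂ) : (x * y) ^ s = x ^ s * y ^ s := by
  rw [cpow_def_of_ne_zero (mul_ne_zero hx hy), cpow_def_of_ne_zero hx, cpow_def_of_ne_zero hy,
    (log_mul_eq_add_log_iff hx hy).2 ⟨h1, h2⟩, add_mul, Complex.exp_add]

theorem mul_cpow_of_re_pos {x y : ℂ} (hx : 0 < x.re) (hy : 0 < y.re) (s : ℂ) :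
    (x * y) ^ s = x ^ s * y ^ s := by
  have h1 := abs_lt.1 (abs_arg_lt_pi_div_two_iff.2 (Or.inl hx))
  have h2 := abs_lt.1 (abs_arg_lt_pi_div_two_iff.2 (Or.inl hy))
  exact mul_cpow_of_arg (ne_zero_of_re_pos hx) (ne_zero_of_re_pos hy) (by linarith [h1.1, h2.1])
    (by linarith [h1.2, h2.2]) s

theorem I_mul_cpow {z : ℂ} (hz : 0 < z.re) (s : ℂ) : (I * z) ^ s = I ^ s * z ^ s := by
  have h1 := abs_lt.1 (abs_arg_lt_pi_div_two_iff.2 (Or.inl hz))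
  have := Real.pi_pos
  exact mul_cpow_of_arg I_ne_zero (ne_zero_of_re_pos hz) (by rw [arg_I]; linarith [h1.1])
    (by rw [arg_I]; linarith [h1.2]) s

theorem neg_I_mul_cpow {z : ℂ} (hz : 0 < z.re) (s : ℂ) : (-I * z) ^ s = (-I) ^ s * z ^ s := by
  have h1 := abs_lt.1 (abs_arg_lt_pi_div_two_iff.2 (Or.inl hz))
  have := Real.pi_pos
  exact mul_cpow_of_arg (neg_ne_zero.2 I_ne_zero) (ne_zero_of_re_pos hz)
    (by rw [arg_neg_I]; linarith [h1.1]) (by rw [arg_neg_I]; linarith [h1.2]) s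

theorem sqrt_neg_I : Complex.sqrt (-I) = cexp (-(π * I / 4)) := by
  rw [Complex.sqrt, cpow_def_of_ne_zero (neg_ne_zero.2 I_ne_zero), log_neg_I]
  congr 1; ring

/-- The Euler function `∏ (1 - xⁿ)`, the analytic counterpart of `1 / f`. -/
def eulerFn (x : ℂ) : ℂ := ∏' n : ℕ, (1 - x ^ (n + 1))

theorem eta_eq_eulerFn (τ : ℂ) :
    ModularForm.eta τ = cexp (π * I * τ / 12) * eulerFn (cexp (2 * π * I * τ)) := by
  rw [ModularForm.eta, eulerFn]
  congr 1
  · rw [Function.Periodic.qParam]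
    congr 1
    push_cast
    ring
  · exact tprod_congr fun n => by rw [ModularForm.eta_q_eq_pow]

theorem eta_add_int (τ : ℂ) (c : ℤ) :
    ModularForm.eta (τ + c) = cexp (π * I * c / 12) * ModularForm.eta τ := by
  rw [eta_eq_eulerFn, eta_eq_eulerFn, ← mul_assoc, ← Complex.exp_add]
  congr 2
  · ring
  · rw [Complex.exp_eq_exp_iff_exists_int]
    exact ⟨c, by ring⟩

theorem eta_I_div {z : ℂ} (hz : 0 < z.re) :
    ModularForm.eta (I / z) = Complex.sqrt z * ModularForm.eta (I * z) := by
  have hz0 := ne_zero_of_re_pos hz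
  have h := ModularForm.eta_comp_eq_csqrt_I_inv (show I * z ∈ UpperHalfPlane.upperHalfPlaneSet by
    simpa [UpperHalfPlane.upperHalfPlaneSet] using hz)
  simp only [Function.comp_apply, Pi.smul_apply, Pi.mul_apply, smul_eq_mul] at h
  have e : -1 / (I * z) = I / z := by
    field_simp; rw [I_sq]
  rw [e] at h
  rw [h]
  simp only [Complex.sqrt]
  rw [I_mul_cpow hz]
  have : I ^ (2⁻¹ : ℂ) ≠ 0 := by rw [cpow_ne_zero_iff]; simp
  field_simp

theorem ofReal_mul_div_add_I_mul_re_pos {a b : ℝ} (ha : 0 < a) (hb : 0 < b) {z : ℂ}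
    (hz : 0 < z.re) : 0 < (a * z / (b + I * z)).re := by
  have hre : (a * z * (starRingEnd ℂ) (b + I * z)).re = a * b * z.re := by
    simp
    ring
  have hne : (b : ℂ) + I * z ≠ 0 := fun h0 => by
    have him := congrArg im h0
    simp only [add_im, ofReal_im, I_mul_im, zero_add, zero_im] at him
    exact hz.ne' him
  rw [div_eq_mul_inv, inv_def, ← mul_assoc, re_mul_ofReal, hre]
  have := normSq_pos.2 hne
  positivity

/-- The transformation of `η` under the substitution taking `h/k` to the cusp `i∞`, at the point
`(h + iz)/k`, with multiplier written through the Dedekind sum. It is stated as a predicate so that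
it can be established by Euclidean descent on `k`. -/
def EtaTransform (h h' : ℤ) (k : ℕ) (z : ℂ) : Prop :=
  ModularForm.eta ((h' + I / z) / k)
    = Complex.sqrt z * cexp (π * I * (dedekindSum h k + (h' - h) / (12 * k)))
      * ModularForm.eta ((h + I * z) / k)

theorem EtaTransform.shift {h h' : ℤ} {k : ℕ} (hk : 0 < k) {z : ℂ} (H : EtaTransform h h' k z)
    (c d : ℤ) : EtaTransform (h + c * k) (h' + d * k) k z := by
  have hk' : (k : ℂ) ≠ 0 := by exact_mod_cast hk.ne'
  rw [EtaTransform] at H ⊢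
  have e1 : (((h' + d * k : ℤ) : ℂ) + I / z) / k = (h' + I / z) / k + d := by
    push_cast; rw [div_add' _ _ _ hk']; ring
  have e2 : (((h + c * k : ℤ) : ℂ) + I * z) / k = (h + I * z) / k + c := by
    push_cast; rw [div_add' _ _ _ hk']; ring
  rw [e1, e2, eta_add_int, eta_add_int, H, dedekindSum_add_mul]
  have hexp : cexp (π * I * ((dedekindSum h k : ℝ)
        + (((h' + d * k : ℤ) : ℂ) - (h + c * k : ℤ)) / (12 * k)))
      = cexp (π * I * d / 12) * cexp (π * I * ((dedekindSum h k : ℝ) + (h' - h) / (12 * k)))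
        * cexp (-(π * I * c / 12)) := by
    rw [← Complex.exp_add, ← Complex.exp_add]
    congr 1
    push_cast
    field_simp
    ring
  have := Complex.exp_ne_zero (π * I * c / 12)
  rw [hexp, Complex.exp_neg]
  field_simp

theorem dedekindSum_neg_add_div {h k : ℕ} {h' c : ℤ} (hh : 0 < h) (hk : 0 < k)
    (hc : h * h' + 1 = k * c) :
    dedekindSum (-k) h + ((c : ℝ) + k) / (12 * h) - 1 / 4
      = dedekindSum h k + ((h' : ℝ) - h) / (12 * k) := by
  have hcop : IsCoprime (h : ℤ) k := ⟨-h', c, by linarith⟩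
  have hrec := dedekindSum_reciprocity hh hk (Nat.isCoprime_iff_coprime.1 hcop)
  have hc' : (c : ℝ) = (h * h' + 1) / k := by
    rw [eq_div_iff (by positivity), mul_comm]
    exact_mod_cast hc.symm
  rw [dedekindSum_neg hh hcop.symm, eq_sub_of_add_eq hrec, hc']
  field_simp
  ring

theorem sqrt_mul_sqrt_eq {h k : ℕ} (hh : 0 < h) (hk : 0 < k) {z : ℂ} (hz : 0 < z.re) :
    Complex.sqrt (k * z / (h + I * z)) * Complex.sqrt ((z - I * h) / k)
      = cexp (-(π * I / 4)) * Complex.sqrt z := by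
  have hk' : (k : ℂ) ≠ 0 := by exact_mod_cast hk.ne'
  have hw : 0 < ((k : ℂ) * z / (h + I * z)).re := by
    exact_mod_cast ofReal_mul_div_add_I_mul_re_pos (Nat.cast_pos.2 hk) (Nat.cast_pos.2 hh) hz
  have hu : 0 < (z - I * h).re := by simpa using hz
  have huk : 0 < ((z - I * h) / k).re := by rw [div_natCast_re]; positivity
  have hu0 := ne_zero_of_re_pos hu
  have hden : (h : ℂ) + I * z = I * (z - I * h) := by linear_combination (h : ℂ) * I_sq
  rw [← sqrt_neg_I]
  simp only [Complex.sqrt]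
  rw [← mul_cpow_of_re_pos hw huk, ← neg_I_mul_cpow hz, hden]
  congr 1
  field_simp
  linear_combination z * I_sq

/-- One step of the Euclidean algorithm: `(h, k)` is replaced by `(-k, h)` through `τ ↦ -1/τ`. The
fourth root of unity produced by `eta_I_div` is the constant `1/4` of the reciprocity law. -/
theorem EtaTransform.step {h k : ℕ} {h' c : ℤ} (hh : 0 < h) (hk : 0 < k)
    (hc : h * h' + 1 = k * c) {z : ℂ} (hz : 0 < z.re)
    (H : EtaTransform (-k) c h (k * z / (h + I * z))) : EtaTransform h h' k z := by
  have hz0 := ne_zero_of_re_pos hz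
  have hk' : (k : ℂ) ≠ 0 := by exact_mod_cast hk.ne'
  have hh' : (h : ℂ) ≠ 0 := by exact_mod_cast hh.ne'
  have hu : 0 < (z - I * h).re := by simpa using hz
  have hu0 := ne_zero_of_re_pos hu
  have huk : 0 < ((z - I * h) / k).re := by rw [div_natCast_re]; positivity
  have hden : (h : ℂ) + I * z = I * (z - I * h) := by linear_combination (h : ℂ) * I_sq
  have hc' : (c : ℂ) = (h * h' + 1) / k := by
    rw [eq_div_iff hk', mul_comm]
    exact_mod_cast hc.symm
  have hsource : ((c : ℂ) + I / (k * z / (h + I * z))) / h = (h' + I / z) / k := by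
    rw [div_div_eq_mul_div, hc']
    field_simp
    linear_combination z * I_sq
  have htarget : (((-k : ℤ) : ℂ) + I * (k * z / (h + I * z))) / h = I / ((z - I * h) / k) := by
    rw [hden]
    push_cast
    field_simp
    ring
  have hreturn : I * ((z - I * h) / k) = ((h : ℤ) + I * z) / k := by
    rw [Int.cast_natCast, hden, mul_div_assoc]
  have hexp : cexp (π * I * ((dedekindSum (-k) h : ℝ) + ((c : ℂ) - (-k : ℤ)) / (12 * h)))
      * cexp (-(π * I / 4))
      = cexp (π * I * ((dedekindSum h k : ℝ) + ((h' : ℂ) - (h : ℤ)) / (12 * k))) := by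
    have hsum := congrArg (fun x : ℝ => π * I * (x : ℂ)) (dedekindSum_neg_add_div hh hk hc)
    rw [← Complex.exp_add]
    congr 1
    push_cast at hsum ⊢
    linear_combination hsum
  rw [EtaTransform] at H ⊢
  rw [hsource, htarget, eta_I_div huk, hreturn] at H
  rw [H, ← hexp]
  linear_combination (cexp (π * I * ((dedekindSum (-k) h : ℝ) + ((c : ℂ) - (-k : ℤ)) / (12 * h)))
    * ModularForm.eta (((h : ℤ) + I * z) / k)) * sqrt_mul_sqrt_eq hh hk hz

theorem etaTransform {k : ℕ} (hk : 0 < k) {h h' : ℤ} (hd : (k : ℤ) ∣ h * h' + 1) {z : ℂ}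
    (hz : 0 < z.re) : EtaTransform h h' k z := by
  induction k using Nat.strong_induction_on generalizing h h' z with
  | _ k ih =>
    rcases eq_or_ne k 1 with rfl | hk1
    · have h0 : EtaTransform 0 0 1 z := by
        rw [EtaTransform]
        simp [dedekindSum, eta_I_div hz]
      simpa using h0.shift one_pos h h'
    obtain ⟨c, hc⟩ := hd
    have hkpos : (0 : ℤ) < k := by exact_mod_cast hk
    obtain ⟨m, hm⟩ := Int.eq_ofNat_of_zero_le (Int.emod_nonneg h hkpos.ne')
    have hmk : m < k := by
      have := Int.emod_lt_of_pos h hkpos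
      omega
    have hdm := Int.emod_add_mul_ediv h k
    have hc' : (m : ℤ) * h' + 1 = k * (c - h / k * h') := by
      rw [← hm]
      linear_combination hc + h' * hdm
    have hm0 : 0 < m := Nat.pos_of_ne_zero fun h0 => by
      subst h0
      have := Int.le_of_dvd one_pos ⟨_, by simpa using hc'⟩
      omega
    have hw : 0 < ((k : ℂ) * z / (m + I * z)).re := by
      exact_mod_cast ofReal_mul_div_add_I_mul_re_pos (Nat.cast_pos.2 hk) (Nat.cast_pos.2 hm0) hz
    have hstep := (ih m hmk hm0 (h := -k) (h' := c - h / k * h') ⟨-h', by linarith⟩ hw).step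
      hm0 hk hc' hz
    have hshift := hstep.shift hk (h / k) 0
    rw [zero_mul, add_zero, ← hm] at hshift
    rwa [show h % k + h / k * k = h by linarith] at hshift

theorem eulerFn_transform {k : ℕ} (hk : 0 < k) {h : ℕ} {h' : ℤ} (hd : (k : ℤ) ∣ h * h' + 1) {z : ℂ}
    (hz : 0 < z.re) :
    eulerFn (cexp (2 * π * I * ((h' + I / z) / k)))
      = omega h k * Complex.sqrt z * cexp (π / (12 * k) * (1 / z - z))
        * eulerFn (cexp (2 * π * I * ((h + I * z) / k))) := by
  have H := etaTransform hk hd hz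
  have hz0 := ne_zero_of_re_pos hz
  have hk' : (k : ℂ) ≠ 0 := by exact_mod_cast hk.ne'
  rw [EtaTransform, eta_eq_eulerFn, eta_eq_eulerFn] at H
  have hne := Complex.exp_ne_zero (π * I * ((h' + I / z) / k) / 12)
  rw [omega_eq_exp_dedekindSum]
  refine mul_left_cancel₀ hne (H.trans ?_)
  have hexp : cexp (π * I * ((dedekindSum h k : ℝ) + ((h' : ℂ) - (h : ℤ)) / (12 * k)))
      * cexp (π * I * (((h : ℤ) + I * z) / k) / 12)
      = cexp (π * I * ((h' + I / z) / k) / 12)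
        * (cexp (π * I * (dedekindSum h k : ℝ)) * cexp (π / (12 * k) * (1 / z - z))) := by
    rw [← Complex.exp_add, ← Complex.exp_add, ← Complex.exp_add]
    congr 1
    push_cast
    field_simp
    ring_nf
    rw [I_sq]
    ring
  push_cast at hexp ⊢
  linear_combination (Complex.sqrt z * eulerFn (cexp (2 * π * I * ((h + I * z) / k)))) * hexp

end EtaTransformation

section IsSumOnDisc

open Complex Filter Topology

/-- `g` is the sum of the power series `a` in the open unit disc; this transports identities between
formal power series to analytic functions and back. -/
def IsSumOnDisc (a : PowerSeries ℂ) (g : ℂ → ℂ) : Prop :=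
  ∀ x : ℂ, ‖x‖ < 1 → HasSum (fun n => PowerSeries.coeff n a * x ^ n) (g x)

namespace IsSumOnDisc

variable {a b : PowerSeries ℂ} {g g₁ : ℂ → ℂ}

theorem mul (ha : IsSumOnDisc a g) (hb : IsSumOnDisc b g₁) :
    IsSumOnDisc (a * b) (fun x => g x * g₁ x) := by
  intro x hx
  have hsa := (ha x hx).summable.norm
  have hsb := (hb x hx).summable.norm
  have hsum := summable_norm_sum_mul_antidiagonal_of_summable_norm hsa hsb
  have htsum := tsum_mul_tsum_eq_tsum_sum_antidiagonal_of_summable_norm hsa hsb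
  have hcoeff (n : ℕ) : ∑ p ∈ Finset.HasAntidiagonal.antidiagonal n, PowerSeries.coeff p.1 a
      * x ^ p.1 * (PowerSeries.coeff p.2 b * x ^ p.2) = PowerSeries.coeff n (a * b) * x ^ n := by
    rw [PowerSeries.coeff_mul, Finset.sum_mul]
    refine Finset.sum_congr rfl fun p hp => ?_
    obtain rfl := Finset.HasAntidiagonal.mem_antidiagonal.1 hp
    ring
  rw [(ha x hx).tsum_eq, (hb x hx).tsum_eq] at htsum
  simp only [hcoeff] at hsum htsum
  simpa only [htsum] using hsum.of_norm.hasSum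

theorem expand (ha : IsSumOnDisc a g) {p : ℕ} (hp : p ≠ 0) :
    IsSumOnDisc (PowerSeries.expand p hp a) (fun x => g (x ^ p)) := by
  intro x hx
  have h := ha (x ^ p) (by rw [norm_pow]; exact pow_lt_one₀ (norm_nonneg _) hx hp)
  have hinj : Function.Injective (fun n : ℕ => p * n) := fun m n =>
    Nat.eq_of_mul_eq_mul_left (Nat.pos_of_ne_zero hp)
  rw [← hinj.hasSum_iff]
  · exact h.congr_fun fun n => by simp [PowerSeries.coeff_expand_mul, pow_mul]
  · intro n hn
    rw [PowerSeries.coeff_expand_of_not_dvd, zero_mul]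
    rintro ⟨m, rfl⟩
    exact hn ⟨m, rfl⟩

theorem hasFPowerSeriesOnBall (ha : IsSumOnDisc a g) :
    HasFPowerSeriesOnBall g
      (FormalMultilinearSeries.ofScalars ℂ (fun n => PowerSeries.coeff n a)) 0 1 where
  r_le := by
    refine ENNReal.le_of_forall_nnreal_lt fun r hr => ?_
    refine FormalMultilinearSeries.le_radius_of_summable _ ?_
    have hr' : (r : ℝ) < 1 := by exact_mod_cast hr
    refine (ha (r : ℂ) (by simpa using hr')).summable.norm.congr fun n => ?_
    simp
  r_pos := one_pos
  hasSum := by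
    intro y hy
    have hy' : ‖y‖ < 1 := by simpa [← ofReal_norm] using hy
    simpa [FormalMultilinearSeries.ofScalars_apply_eq, mul_comm] using ha y hy'

theorem unique (ha : IsSumOnDisc a g) (hb : IsSumOnDisc b g) : a = b := by
  have hseries := ha.hasFPowerSeriesOnBall.hasFPowerSeriesAt.eq_formalMultilinearSeries
    hb.hasFPowerSeriesOnBall.hasFPowerSeriesAt
  ext n
  exact congrFun (FormalMultilinearSeries.ofScalars_series_injective (𝕜 := ℂ) ℂ hseries) n

theorem congr (ha : IsSumOnDisc a g) (h : ∀ x, ‖x‖ < 1 → g x = g₁ x) : IsSumOnDisc a g₁ :=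
  fun x hx => h x hx ▸ ha x hx

theorem differentiableOn (ha : IsSumOnDisc a g) : DifferentiableOn ℂ g (Metric.ball 0 1) := by
  have := ha.hasFPowerSeriesOnBall.differentiableOn
  rwa [← ENNReal.ofReal_one, Metric.eball_ofReal] at this

theorem X_pow (m : ℕ) : IsSumOnDisc (PowerSeries.X ^ m) (fun x => x ^ m) := by
  intro x _
  have h := hasSum_single
    (f := fun n => PowerSeries.coeff n (PowerSeries.X ^ m : PowerSeries ℂ) * x ^ n)
    m (fun n hn => by simp [PowerSeries.coeff_X_pow, hn])
  rwa [PowerSeries.coeff_X_pow_self, one_mul] at h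

theorem one : IsSumOnDisc 1 (fun _ => 1) := by simpa using X_pow 0

theorem sub (ha : IsSumOnDisc a g) (hb : IsSumOnDisc b g₁) :
    IsSumOnDisc (a - b) (fun x => g x - g₁ x) := fun x hx => by
  simpa [sub_mul] using (ha x hx).sub (hb x hx)

theorem prod {ι : Type*} {s : Finset ι} {A : ι → PowerSeries ℂ} {G : ι → ℂ → ℂ}
    (h : ∀ i ∈ s, IsSumOnDisc (A i) (G i)) :
    IsSumOnDisc (∏ i ∈ s, A i) (fun x => ∏ i ∈ s, G i x) := by
  induction s using Finset.cons_induction with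
  | empty => simpa using one
  | cons i s hi ih =>
    simp only [Finset.prod_cons]
    exact (h i (Finset.mem_cons_self i s)).mul
      (ih fun j hj => h j (Finset.mem_cons_of_mem hj))

end IsSumOnDisc

theorem isSumOnDisc_taylor {g : ℂ → ℂ} (hg : DifferentiableOn ℂ g (Metric.ball 0 1)) :
    IsSumOnDisc (PowerSeries.mk fun n => (n.factorial : ℂ)⁻¹ * iteratedDeriv n g 0) g := by
  intro x hx
  refine (hasSum_taylorSeries_on_ball hg (z := x) (by simpa using hx)).congr_fun fun n => ?_
  simp only [PowerSeries.coeff_mk, sub_zero, smul_eq_mul]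
  ring

theorem IsSumOnDisc.coeff_eq {a : PowerSeries ℂ} {g : ℂ → ℂ} (ha : IsSumOnDisc a g) (n : ℕ) :
    PowerSeries.coeff n a = (n.factorial : ℂ)⁻¹ * iteratedDeriv n g 0 := by
  rw [ha.unique (isSumOnDisc_taylor ha.differentiableOn), PowerSeries.coeff_mk]

theorem differentiableOn_iteratedDeriv {F : ℂ → ℂ} {U : Set ℂ} (hU : IsOpen U)
    (hF : DifferentiableOn ℂ F U) (n : ℕ) : DifferentiableOn ℂ (iteratedDeriv n F) U := by
  induction n with
  | zero => simpa using hF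
  | succ n ih => rw [iteratedDeriv_succ]; exact ih.deriv hU

theorem tendstoLocallyUniformlyOn_iteratedDeriv {ι : Type*} {φ : Filter ι} {F : ι → ℂ → ℂ}
    {g : ℂ → ℂ} {U : Set ℂ} (hU : IsOpen U) (hF : ∀ᶠ i in φ, DifferentiableOn ℂ (F i) U)
    (h : TendstoLocallyUniformlyOn F g φ U) (n : ℕ) :
    TendstoLocallyUniformlyOn (fun i => iteratedDeriv n (F i)) (iteratedDeriv n g) φ U := by
  induction n with
  | zero => simpa using h
  | succ n ih =>
    simp only [iteratedDeriv_succ]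
    exact ih.deriv (hF.mono fun i hi => differentiableOn_iteratedDeriv hU hi n) hU

/-- By Weierstrass' theorem the Taylor coefficients of the infinite product are the limits of those
of the finite products, which are eventually the coefficients of Euler's pentagonal series. -/
theorem isSumOnDisc_eulerFn : IsSumOnDisc (PowerSeries.pentagonalSeries ℂ) eulerFn := by
  have hpartial : ∀ s : Finset ℕ, IsSumOnDisc (∏ n ∈ s, (1 - PowerSeries.X ^ (n + 1)))
      (fun x => ∏ n ∈ s, (1 - x ^ (n + 1))) :=
    fun s => .prod fun n _ => IsSumOnDisc.one.sub (.X_pow (n + 1))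
  have hunif := ModularForm.multipliableLocallyUniformlyOn_one_sub_pow.hasProdLocallyUniformlyOn
  rw [hasProdLocallyUniformlyOn_iff_tendstoLocallyUniformlyOn] at hunif
  have hdiff : DifferentiableOn ℂ eulerFn (Metric.ball 0 1) :=
    ModularForm.differentiableOn_tprod_one_sub_pow
  convert isSumOnDisc_taylor hdiff using 1
  ext n
  rw [PowerSeries.coeff_mk]
  have hderiv := tendstoLocallyUniformlyOn_iteratedDeriv Metric.isOpen_ball
    (.of_forall fun s => (hpartial s).differentiableOn) hunif n
  refine tendsto_nhds_unique (tendsto_const_nhds.congr' ?_)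
    ((hderiv.tendsto_at (Metric.mem_ball_self one_pos)).const_mul ((n.factorial : ℂ)⁻¹))
  filter_upwards [PowerSeries.coeff_prod_one_sub_X_pow_eventually_eq ℂ n] with s hs
  rw [← hs, (hpartial s).coeff_eq n]

theorem eulerFn_ne_zero {x : ℂ} (hx : ‖x‖ < 1) : eulerFn x ≠ 0 := by
  have hs : Summable fun n : ℕ => ‖-x ^ (n + 1)‖ := by
    simpa [summable_nat_add_iff] using summable_geometric_of_lt_one (norm_nonneg x) hx
  have hfactor : ∀ n : ℕ, 1 + -x ^ (n + 1) ≠ 0 := fun n h0 => by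
    have hpow : ‖x‖ ^ (n + 1) = 1 := by
      rw [← norm_pow, show x ^ (n + 1) = 1 by linear_combination -h0, norm_one]
    exact (pow_lt_one₀ (norm_nonneg _) hx n.succ_ne_zero).ne hpow
  simpa [eulerFn, sub_eq_add_neg] using tprod_one_add_ne_zero_of_summable hfactor hs

end IsSumOnDisc

section GeneratingFunctions

open PowerSeries PowerSeries.WithPiTopology

theorem hasProd_expand {ι R : Type*} [CommRing R] [TopologicalSpace R] {F : ι → R⟦X⟧} {a : R⟦X⟧}
    (h : HasProd F a) {p : ℕ} (hp : p ≠ 0) :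
    HasProd (fun i => expand p hp (F i)) (expand p hp a) := by
  rw [HasProd, tendsto_iff_coeff_tendsto] at h ⊢
  intro d
  simp only [← map_prod, coeff_expand]
  split_ifs with hd
  · exact h _
  · exact tendsto_const_nhds

theorem hasProd_one_sub_X_pow_mul {p : ℕ} (hp : p ≠ 0) :
    HasProd (fun i : ℕ => (1 - X ^ (p * (i + 1)) : ℂ⟦X⟧)) (expand p hp (pentagonalSeries ℂ)) := by
  simpa only [map_sub, map_one, map_pow, expand_X, ← pow_mul] using
    hasProd_expand (hasProd_one_sub_X_pow ℂ) hp

theorem tsum_X_pow_mul_one_sub {i : ℕ} (hi : i ≠ 0) :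
    (∑' j : ℕ, (X : ℂ⟦X⟧) ^ (i * (j + 1))) * (1 - X ^ i) = X ^ i := by
  have hconst : constantCoeff ((X : ℂ⟦X⟧) ^ i) = 0 := by simp [hi]
  have hfactor : ∑' j : ℕ, (X : ℂ⟦X⟧) ^ (i * (j + 1)) = X ^ i * ∑' j : ℕ, (X ^ i) ^ j := by
    rw [← (summable_pow_of_constantCoeff_eq_zero hconst).tsum_mul_left]
    exact tsum_congr fun j => by rw [← pow_mul, ← pow_add, mul_add_one, add_comm]
  rw [hfactor, mul_assoc, tsum_pow_mul_one_sub_of_constantCoeff_eq_zero hconst, mul_one]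

theorem hasProd_genFun_one_sub (w : ℕ → ℕ → ℂ) :
    HasProd (fun i : ℕ => (1 + ∑' j : ℕ, w (i + 1) (j + 1) • (X : ℂ⟦X⟧) ^ ((i + 1) * (j + 1)))
      * (1 - X ^ (i + 1))) (Nat.Partition.genFun w * pentagonalSeries ℂ) :=
  (Nat.Partition.hasProd_genFun w).mul (hasProd_one_sub_X_pow ℂ)

theorem one_add_tsum_const_smul_mul_one_sub (c : ℂ) (i : ℕ) :
    (1 + ∑' j : ℕ, c • (X : ℂ⟦X⟧) ^ ((i + 1) * (j + 1))) * (1 - X ^ (i + 1))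
      = 1 + (c - 1) • X ^ (i + 1) := by
  have hsum := Nat.Partition.summable_genFun_term (fun _ _ => (1 : ℂ)) i
  simp only [one_smul] at hsum
  have hpull : ∑' j : ℕ, c • (X : ℂ⟦X⟧) ^ ((i + 1) * (j + 1))
      = C c * ∑' j : ℕ, (X : ℂ⟦X⟧) ^ ((i + 1) * (j + 1)) := by
    rw [← hsum.tsum_mul_left]
    exact tsum_congr fun j => smul_eq_C_mul _ _
  rw [hpull, add_mul, mul_assoc, tsum_X_pow_mul_one_sub i.add_one_ne_zero, smul_eq_C_mul, map_sub,
    map_one]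
  ring

theorem f_eq_genFun : f = Nat.Partition.genFun (fun _ _ => (1 : ℂ)) := by
  ext n
  simp [f, numPartitions, Finsupp.prod]

theorem f_mul_pentagonalSeries : f * pentagonalSeries ℂ = 1 := by
  have h := hasProd_genFun_one_sub (fun _ _ => 1)
  simp only [one_add_tsum_const_smul_mul_one_sub, sub_self, zero_smul, add_zero] at h
  rw [f_eq_genFun]
  exact h.unique hasProd_one

theorem expand_f_mul_expand_pentagonalSeries {p : ℕ} (hp : p ≠ 0) :
    expand p hp f * expand p hp (pentagonalSeries ℂ) = 1 := by
  rw [← map_mul, f_mul_pentagonalSeries, map_one]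

theorem fr_eq (r : ℕ) : fr r = f * expand (2 ^ r) (pow_ne_zero r two_ne_zero) f
    * expand 2 two_ne_zero (pentagonalSeries ℂ) := by
  have hinv := expand_f_mul_expand_pentagonalSeries two_ne_zero
  have hconst : constantCoeff (expand 2 two_ne_zero f) ≠ 0 := fun h0 => by
    simpa [h0] using congrArg constantCoeff hinv
  rw [fr, (PowerSeries.inv_eq_iff_mul_eq_one hconst).2 (by rw [mul_comm, hinv])]

theorem numOverpartitions_eq (n : ℕ) :
    (numOverpartitions n : ℂ) = coeff n (Nat.Partition.genFun (fun _ _ => (2 : ℂ))) := by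
  rw [Nat.Partition.coeff_genFun, numOverpartitions, overpartitions, Finset.card_sigma]
  push_cast
  refine Finset.sum_congr rfl fun l _ => ?_
  simp [Finset.card_powerset, Finsupp.prod]

/-- Each part size contributes `(1 + x^i) / (1 - x^i)`, and `(1 + x^i)(1 - x^i) = 1 - x^(2i)`. -/
theorem genFun_two_mul_pentagonalSeries_sq :
    Nat.Partition.genFun (fun _ _ => (2 : ℂ)) * pentagonalSeries ℂ * pentagonalSeries ℂ
      = expand 2 two_ne_zero (pentagonalSeries ℂ) := by
  refine ((hasProd_genFun_one_sub fun _ _ => 2).mul (hasProd_one_sub_X_pow ℂ)).unique ?_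
  convert hasProd_one_sub_X_pow_mul two_ne_zero using 2 with i
  rw [one_add_tsum_const_smul_mul_one_sub, show (2 : ℂ) - 1 = 1 by norm_num, one_smul]
  ring

theorem pr_zero (n : ℕ) : pr 0 n = numOverpartitions n := by
  rw [numOverpartitions_eq, pr, fr_eq, ← genFun_two_mul_pentagonalSeries_sq]
  simp only [pow_zero, expand_one_apply]
  congr 1
  linear_combination (Nat.Partition.genFun (fun _ _ => (2 : ℂ))) *
    (f * pentagonalSeries ℂ + 1) * f_mul_pentagonalSeries

theorem pr_one (n : ℕ) : pr 1 n = numPartitions n := by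
  rw [pr, fr_eq, mul_assoc]
  simp only [pow_one, expand_f_mul_expand_pentagonalSeries, mul_one]
  rw [f, coeff_mk]

/-- The indicator that a part of size `i` may occur `c` times in a partition without repeated odd
parts, as a weight for `Nat.Partition.genFun`. -/
def podWeight (i c : ℕ) : ℂ :=
  open Classical in if Odd i → c ≤ 1 then 1 else 0

theorem pod_eq (n : ℕ) : (pod n : ℂ) = coeff n (Nat.Partition.genFun podWeight) := by
  classical
  rw [Nat.Partition.coeff_genFun, pod, Finset.card_filter]
  push_cast
  refine Finset.sum_congr rfl fun l _ => ?_
  simp only [Finsupp.prod, podWeight]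
  rw [Finset.prod_boole]
  simp

theorem one_add_tsum_podWeight_mul_one_sub (i : ℕ) :
    (1 + ∑' j : ℕ, podWeight (i + 1) (j + 1) • (X : ℂ⟦X⟧) ^ ((i + 1) * (j + 1)))
      * (1 - X ^ (i + 1)) = if Odd (i + 1) then 1 - X ^ (2 * (i + 1)) else 1 := by
  split_ifs with hi
  · rw [tsum_eq_single 0 fun j hj => by simp [podWeight, hi, hj]]
    simp only [podWeight, zero_add, le_refl, implies_true, if_true, one_smul, mul_one]
    ring
  · simp only [podWeight, hi, false_imp_iff, if_true, one_add_tsum_const_smul_mul_one_sub,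
      sub_self, zero_smul, add_zero]

theorem hasProd_ite_odd_one_sub_X_pow :
    HasProd (fun i : ℕ => if Odd (i + 1) then (1 : ℂ⟦X⟧) else 1 - X ^ (2 * (i + 1)))
      (expand (2 ^ 2) (pow_ne_zero 2 two_ne_zero) (pentagonalSeries ℂ)) := by
  have hinj : Function.Injective (fun m : ℕ => 2 * m + 1) := fun a b h => by simpa using h
  rw [← hinj.hasProd_iff]
  · convert hasProd_one_sub_X_pow_mul (pow_ne_zero 2 two_ne_zero) using 2 with m
    rw [Function.comp_apply, if_neg (by grind)]
    ring
  · rintro i hi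
    refine if_pos ?_
    by_contra hodd
    obtain ⟨m, hm⟩ := Nat.not_odd_iff_even.1 hodd
    exact hi ⟨m - 1, by grind⟩

theorem genFun_podWeight_mul_pentagonalSeries :
    Nat.Partition.genFun podWeight * pentagonalSeries ℂ
        * expand (2 ^ 2) (pow_ne_zero 2 two_ne_zero) (pentagonalSeries ℂ)
      = expand 2 two_ne_zero (pentagonalSeries ℂ) := by
  refine ((hasProd_genFun_one_sub podWeight).mul hasProd_ite_odd_one_sub_X_pow).unique ?_
  convert hasProd_one_sub_X_pow_mul two_ne_zero using 2 with i
  rw [one_add_tsum_podWeight_mul_one_sub]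
  split_ifs <;> simp only [mul_one, one_mul]

theorem pr_two (n : ℕ) : pr 2 n = pod n := by
  rw [pod_eq, pr, fr_eq, ← genFun_podWeight_mul_pentagonalSeries]
  congr 1
  linear_combination (Nat.Partition.genFun podWeight * f * pentagonalSeries ℂ)
      * expand_f_mul_expand_pentagonalSeries (pow_ne_zero 2 two_ne_zero)
    + Nat.Partition.genFun podWeight * f_mul_pentagonalSeries

theorem isSumOnDisc_f : IsSumOnDisc f (fun x => (eulerFn x)⁻¹) := by
  have hdiff : DifferentiableOn ℂ (fun x => (eulerFn x)⁻¹) (Metric.ball 0 1) :=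
    isSumOnDisc_eulerFn.differentiableOn.inv fun x hx => eulerFn_ne_zero (by simpa using hx)
  have htaylor := isSumOnDisc_taylor hdiff
  set b := PowerSeries.mk fun n => (n.factorial : ℂ)⁻¹
    * iteratedDeriv n (fun x => (eulerFn x)⁻¹) 0
  have hinv : b * pentagonalSeries ℂ = 1 :=
    ((htaylor.mul isSumOnDisc_eulerFn).congr
      fun x hx => inv_mul_cancel₀ (eulerFn_ne_zero hx)).unique IsSumOnDisc.one
  have hf : f = b := by linear_combination (-f) * hinv + b * f_mul_pentagonalSeries
  rwa [hf]

/-- The sum of the power series `fr r` in the unit disc, as a quotient of Euler products. -/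
def frFn (r : ℕ) (x : ℂ) : ℂ := eulerFn (x ^ 2) / (eulerFn x * eulerFn (x ^ 2 ^ r))

theorem isSumOnDisc_fr (r : ℕ) : IsSumOnDisc (fr r) (frFn r) := by
  rw [fr_eq]
  refine ((isSumOnDisc_f.mul (isSumOnDisc_f.expand _)).mul
    (isSumOnDisc_eulerFn.expand _)).congr fun x _ => ?_
  rw [frFn, div_eq_mul_inv, mul_inv, mul_comm]

end GeneratingFunctions

section TransformationAtFractions

open Complex Real

theorem norm_omega (h k : ℕ) : ‖omega h k‖ = 1 := by
  rw [omega_eq_exp_dedekindSum, Complex.norm_exp]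
  simp

theorem omega_ne_zero (h k : ℕ) : omega h k ≠ 0 := by
  rw [← norm_ne_zero_iff, norm_omega]
  exact one_ne_zero

theorem sqrt_ofReal_mul {c : ℝ} (hc : 0 < c) {z : ℂ} (hz : 0 < z.re) :
    Complex.sqrt (c * z) = (√c : ℝ) * Complex.sqrt z := by
  have hsqrt : Complex.sqrt (c : ℂ) = (√c : ℝ) := by
    rw [Complex.sqrt, Real.sqrt_eq_rpow, ofReal_cpow hc.le]
    norm_num
  rw [← hsqrt, Complex.sqrt, Complex.sqrt, Complex.sqrt, mul_cpow_of_re_pos (by simpa using hc) hz]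

theorem sqrt_ne_zero_of_re_pos {z : ℂ} (hz : 0 < z.re) : Complex.sqrt z ≠ 0 := by
  rw [Complex.sqrt, cpow_ne_zero_iff]
  exact Or.inl (ne_zero_of_re_pos hz)

theorem norm_sqrt_complex (w : ℂ) : ‖Complex.sqrt w‖ = √‖w‖ := by
  have hsq : Complex.sqrt w ^ 2 = w := by
    rw [Complex.sqrt, ← Complex.cpow_nat_mul]
    norm_num
  rw [eq_comm, Real.sqrt_eq_iff_mul_self_eq (norm_nonneg _) (norm_nonneg _), ← sq, ← norm_pow, hsq]

theorem inv_re_pos {z : ℂ} (hz : 0 < z.re) : 0 < (z⁻¹).re := by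
  rw [inv_re]
  exact div_pos hz (normSq_pos.2 (ne_zero_of_re_pos hz))

theorem exists_eulerFn_eq_of_coprime {m h k : ℕ} (hm : 0 < m) (hk : 0 < k)
    (hc : Nat.Coprime (m * h) k) {z : ℂ} (hz : 0 < z.re) :
    ∃ x : ℂ, ‖x‖ = rexp (-(2 * π * ((z⁻¹).re / (m * k)))) ∧
      eulerFn x = omega (m * h) k * ((√m : ℝ) * Complex.sqrt z)
        * cexp (π / 12 * (z⁻¹ / (m * k) - m * z / k))
        * eulerFn (cexp (2 * π * I * ((h + I * z) / k)) ^ m) := by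
  obtain ⟨u, v, huv⟩ := Nat.isCoprime_iff_coprime.2 hc
  have hdvd : (k : ℤ) ∣ ((m * h : ℕ) : ℤ) * (-u) + 1 := ⟨v, by push_cast at huv ⊢; linarith⟩
  have hmz : 0 < ((m : ℂ) * z).re := by
    rw [← ofReal_natCast, re_ofReal_mul]
    positivity
  have hz0 := ne_zero_of_re_pos hz
  have hmC : (m : ℂ) ≠ 0 := Nat.cast_ne_zero.2 hm.ne'
  have hkC : (k : ℂ) ≠ 0 := Nat.cast_ne_zero.2 hk.ne'
  refine ⟨_, ?_, (eulerFn_transform hk hdvd hmz).trans ?_⟩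
  · have hsplit : 2 * π * I * (((-u : ℤ) + I / (m * z)) / k)
        = ((-(2 * π / (m * k)) : ℝ) : ℂ) * z⁻¹ + ((-(2 * π * u / k) : ℝ) : ℂ) * I := by
      push_cast
      field_simp
      ring_nf
      rw [I_sq]
      ring
    rw [Complex.norm_exp, hsplit, add_re, re_ofReal_mul, re_ofReal_mul, I_re]
    congr 1
    ring
  · have hsqrt : Complex.sqrt (m * z) = (√m : ℝ) * Complex.sqrt z := by
      rw [← sqrt_ofReal_mul (by positivity) hz, ofReal_natCast]
    have hpow : (m : ℂ) * (2 * π * I * ((h + I * z) / k))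
        = 2 * π * I * (((m * h : ℕ) + I * (m * z)) / k) := by
      push_cast
      ring
    have hexp : (π : ℂ) / 12 * (z⁻¹ / (m * k) - m * z / k)
        = π / (12 * k) * (1 / (m * z) - m * z) := by
      field_simp
    rw [hsqrt, ← Complex.exp_nat_mul, hpow, hexp]

/-- The rate of decay of the transformed variable of `∏ (1 - x ^ (m n))` near a fraction with
denominator `k`: at `x = exp (2πi (h/k + iw))` it has modulus
`exp (-2π * decayRate m k * Re (1/w) / k²)`. -/
def decayRate (m k : ℕ) : ℝ := (Nat.gcd m k : ℝ) ^ 2 / m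

/-- The factor of automorphy of `∏ (1 - x ^ (m n))` at the point `x = exp (2πi (h/k + iw))`. -/
def eulerFactor (m h k : ℕ) (w : ℂ) : ℂ :=
  omega (m / Nat.gcd m k * h) (k / Nat.gcd m k)
    * ((√(m / Nat.gcd m k) : ℝ) * ((√k : ℝ) * Complex.sqrt w))
    * cexp (π / 12 * (decayRate m k / k ^ 2 * w⁻¹ - m * w))

theorem eulerFactor_ne_zero {m k : ℕ} (hm : 0 < m) (hk : 0 < k) (h : ℕ) {w : ℂ} (hw : 0 < w.re) :
    eulerFactor m h k w ≠ 0 := by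
  have hg : (0 : ℝ) < Nat.gcd m k := by exact_mod_cast Nat.gcd_pos_of_pos_left k hm
  have hscale := Real.sqrt_pos.2 (div_pos (Nat.cast_pos.2 hm) hg)
  have hsqrtk := Real.sqrt_pos.2 (Nat.cast_pos.2 hk : (0 : ℝ) < k)
  exact mul_ne_zero (mul_ne_zero (omega_ne_zero _ _) (mul_ne_zero (ofReal_ne_zero.2 hscale.ne')
    (mul_ne_zero (ofReal_ne_zero.2 hsqrtk.ne') (sqrt_ne_zero_of_re_pos hw))))
    (Complex.exp_ne_zero _)

theorem decayRate_mul_right {m k : ℕ} (hc : Nat.Coprime m k) (g : ℕ) :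
    decayRate (m * g) (k * g) = g / m := by
  rcases Nat.eq_zero_or_pos g with rfl | hg
  · simp [decayRate]
  have hg' : (g : ℝ) ≠ 0 := Nat.cast_ne_zero.2 hg.ne'
  rw [decayRate, Nat.gcd_mul_right, hc.gcd_eq_one, one_mul, Nat.cast_mul, sq,
    mul_div_mul_right _ _ hg']

theorem eulerFactor_mul_right {m k g : ℕ} (hm : 0 < m) (hk : 0 < k) (hg : 0 < g)
    (hc : Nat.Coprime m k) (h : ℕ) {w : ℂ} (hw : 0 < w.re) :
    eulerFactor (m * g) h (k * g) w
      = omega (m * h) k * ((√m : ℝ) * Complex.sqrt ((k * g : ℕ) * w))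
        * cexp (π / 12 * (((k * g : ℕ) * w)⁻¹ / (m * k) - m * ((k * g : ℕ) * w) / k)) := by
  have hsqrt : Complex.sqrt ((k * g : ℕ) * w) = (√(k * g : ℕ) : ℝ) * Complex.sqrt w := by
    rw [← sqrt_ofReal_mul (by positivity) hw, ofReal_natCast]
  have hw0 := ne_zero_of_re_pos hw
  have hmC : (m : ℂ) ≠ 0 := Nat.cast_ne_zero.2 hm.ne'
  have hkC : (k : ℂ) ≠ 0 := Nat.cast_ne_zero.2 hk.ne'
  have hgC : (g : ℂ) ≠ 0 := Nat.cast_ne_zero.2 hg.ne'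
  have hgR : (g : ℝ) ≠ 0 := Nat.cast_ne_zero.2 hg.ne'
  have hexp : ((k * g : ℕ) * w)⁻¹ / (m * k) - m * ((k * g : ℕ) * w) / k
      = ((g / m : ℝ) : ℂ) / (k * g : ℕ) ^ 2 * w⁻¹ - (m * g : ℕ) * w := by
    push_cast
    field_simp
  have hscale : ((m * g : ℕ) : ℝ) / g = m := by
    rw [Nat.cast_mul, mul_div_cancel_right₀ _ hgR]
  rw [eulerFactor, decayRate_mul_right hc, Nat.gcd_mul_right, hc.gcd_eq_one, one_mul, hscale,
    Nat.mul_div_cancel _ hg, Nat.mul_div_cancel _ hg, hsqrt, hexp]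

theorem exists_eulerFn_eq_eulerFactor_mul {m h k : ℕ} (hm : 0 < m) (hk : 0 < k)
    (hc : Nat.Coprime h k) {w : ℂ} (hw : 0 < w.re) :
    ∃ x : ℂ, ‖x‖ = rexp (-(2 * π * decayRate m k * ((w⁻¹).re / k ^ 2))) ∧
      eulerFn x = eulerFactor m h k w * eulerFn (cexp (2 * π * I * (h / k + I * w)) ^ m) := by
  have hg : 0 < Nat.gcd m k := Nat.gcd_pos_of_pos_left k hm
  obtain ⟨m', k', hcop, hm', hk'⟩ := Nat.exists_coprime m k
  generalize Nat.gcd m k = g at hg hm' hk'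
  subst hm' hk'
  have hm0 : 0 < m' := Nat.pos_of_mul_pos_right hm
  have hk0 : 0 < k' := Nat.pos_of_mul_pos_right hk
  have hcop' : Nat.Coprime (m' * h) k' :=
    hcop.mul_left (hc.coprime_dvd_right (Nat.dvd_mul_right k' g))
  have hkw : 0 < (((k' * g : ℕ) : ℂ) * w).re := by
    rw [← ofReal_natCast, re_ofReal_mul]
    positivity
  obtain ⟨x, hnorm, hx⟩ := exists_eulerFn_eq_of_coprime hm0 hk0 hcop' hkw
  refine ⟨x, hnorm.trans ?_, hx.trans ?_⟩
  · have hinv : ((((k' * g : ℕ) : ℂ) * w)⁻¹).re = (w⁻¹).re / (k' * g : ℕ) := by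
      rw [mul_inv, ← ofReal_natCast, ← ofReal_inv, re_ofReal_mul, inv_mul_eq_div]
    rw [hinv, decayRate_mul_right hcop]
    congr 1
    push_cast
    field_simp
  · have hkC : (k' : ℂ) ≠ 0 := Nat.cast_ne_zero.2 hk0.ne'
    have hgC : (g : ℂ) ≠ 0 := Nat.cast_ne_zero.2 hg.ne'
    have hpoint : cexp (2 * π * I * ((h + I * ((k' * g : ℕ) * w)) / k')) ^ m'
        = cexp (2 * π * I * (h / (k' * g : ℕ) + I * w)) ^ (m' * g) := by
      rw [← Complex.exp_nat_mul, ← Complex.exp_nat_mul]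
      congr 1
      push_cast
      field_simp
    rw [hpoint, eulerFactor_mul_right hm0 hk0 hg hcop h hw]

/-- The exponent of the singularity of `f_r` at a fraction `h/k`: at `h/k + iw` the function grows
like `exp (π * polarCoeff r k / (12 k² w))`. -/
def polarCoeff (r k : ℕ) : ℝ := 1 + decayRate (2 ^ r) k - decayRate 2 k

/-- The absolute value of the constant in the leading term of `f_r` at the fractions with
denominator `k`, apart from the factor `√k`. -/
def scaleFactor (r k : ℕ) : ℝ := √(2 ^ r / Nat.gcd (2 ^ r) k) / √(2 / Nat.gcd 2 k)

/-- The root of unity occurring in the leading term of `f_r` at `h/k`. -/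
def multiplier (r h k : ℕ) : ℂ :=
  omega h k * omega (2 ^ r / Nat.gcd (2 ^ r) k * h) (k / Nat.gcd (2 ^ r) k)
    / omega (2 / Nat.gcd 2 k * h) (k / Nat.gcd 2 k)

/-- The factor of automorphy of `f_r` at the point `exp (2πi (h/k + iw))`. -/
def principalFactor (r h k : ℕ) (w : ℂ) : ℂ :=
  multiplier r h k * scaleFactor r k * √k * Complex.sqrt w
    * cexp (π * polarCoeff r k / 12 / k ^ 2 * w⁻¹ - π * (2 ^ r - 1) / 12 * w)

theorem norm_multiplier (r h k : ℕ) : ‖multiplier r h k‖ = 1 := by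
  simp [multiplier, norm_omega]

theorem scaleFactor_nonneg (r k : ℕ) : 0 ≤ scaleFactor r k := by
  rw [scaleFactor]
  positivity

theorem decayRate_one_left (k : ℕ) : decayRate 1 k = 1 := by simp [decayRate]

theorem inv_le_decayRate {m : ℕ} (hm : 0 < m) (k : ℕ) : (m : ℝ)⁻¹ ≤ decayRate m k := by
  have hg : (1 : ℝ) ≤ Nat.gcd m k := by exact_mod_cast Nat.gcd_pos_of_pos_left k hm
  rw [decayRate, inv_eq_one_div]
  gcongr
  exact one_le_pow₀ hg

theorem decayRate_le (m k : ℕ) : decayRate m k ≤ m := by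
  rcases Nat.eq_zero_or_pos m with rfl | hm
  · simp [decayRate]
  have hg : (Nat.gcd m k : ℝ) ≤ m := by exact_mod_cast Nat.gcd_le_left k hm
  rw [decayRate, div_le_iff₀ (by positivity), ← sq]
  gcongr

theorem two_pow_le_sixteen {r : ℕ} (hr : r ≤ 4) : (2 : ℝ) ^ r ≤ 16 :=
  (pow_le_pow_right₀ one_le_two hr).trans_eq (by norm_num)

theorem scaleFactor_le {r : ℕ} (hr : r ≤ 4) (k : ℕ) : scaleFactor r k ≤ 4 := by
  have hgr : (1 : ℝ) ≤ Nat.gcd (2 ^ r) k := by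
    exact_mod_cast Nat.gcd_pos_of_pos_left k (by positivity)
  have hg : (Nat.gcd 2 k : ℝ) ≤ 2 := by exact_mod_cast Nat.gcd_le_left k two_pos
  have hg0 : (0 : ℝ) < Nat.gcd 2 k := by exact_mod_cast Nat.gcd_pos_of_pos_left k two_pos
  have hnum : √(2 ^ r / Nat.gcd (2 ^ r) k) ≤ 4 := by
    rw [Real.sqrt_le_left (by norm_num)]
    exact (div_le_self (by positivity) hgr).trans ((two_pow_le_sixteen hr).trans (by norm_num))
  have hden : 1 ≤ √(2 / (Nat.gcd 2 k : ℝ)) := by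
    rwa [Real.one_le_sqrt, one_le_div hg0]
  exact (div_le_self (Real.sqrt_nonneg _) hden).trans hnum

theorem one_div_sixteen_le_decayRate_two_pow {r : ℕ} (hr : r ≤ 4) (k : ℕ) :
    1 / 16 ≤ decayRate (2 ^ r) k := by
  refine le_trans ?_ (inv_le_decayRate (by positivity) k)
  rw [one_div]
  push_cast
  gcongr
  exact two_pow_le_sixteen hr

theorem one_half_le_decayRate_two (k : ℕ) : 1 / 2 ≤ decayRate 2 k := by
  simpa using inv_le_decayRate two_pos k

theorem decayRate_two_pow_le_sixteen {r : ℕ} (hr : r ≤ 4) (k : ℕ) : decayRate (2 ^ r) k ≤ 16 :=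
  (decayRate_le _ k).trans (by exact_mod_cast two_pow_le_sixteen hr)

theorem polarCoeff_le {r : ℕ} (hr : r ≤ 4) (k : ℕ) : polarCoeff r k ≤ 24 := by
  rw [polarCoeff]
  linarith [decayRate_two_pow_le_sixteen hr k, one_half_le_decayRate_two k]

theorem polarCoeff_le_decayRate_two_pow {r : ℕ} (hr : r ≤ 4) (k : ℕ) :
    polarCoeff r k ≤ 24 * decayRate (2 ^ r) k := by
  rw [polarCoeff]
  linarith [one_div_sixteen_le_decayRate_two_pow hr k, one_half_le_decayRate_two k]

theorem polarCoeff_le_decayRate_two {r : ℕ} (hr : r ≤ 4) (k : ℕ) :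
    polarCoeff r k ≤ 24 * decayRate 2 k := by
  have hs := decayRate_two_pow_le_sixteen hr k
  rw [polarCoeff]
  rcases Nat.even_or_odd k with he | ho
  · have htwo : decayRate 2 k = 2 := by
      rw [decayRate, Nat.gcd_eq_left he.two_dvd]
      norm_num
    linarith
  · have hone : decayRate (2 ^ r) k ≤ 1 := by
      rw [decayRate, (Nat.coprime_two_left.2 ho).pow_left r]
      push_cast
      rw [one_pow]
      exact div_le_one_of_le₀ (one_le_pow₀ one_le_two) (by positivity)
    linarith [one_half_le_decayRate_two k]

theorem eulerFactor_mul_div_eq_principalFactor (r h : ℕ) {k : ℕ} (hk : 0 < k) {w : ℂ}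
    (hw : 0 < w.re) :
    eulerFactor 1 h k w * eulerFactor (2 ^ r) h k w / eulerFactor 2 h k w
      = principalFactor r h k w := by
  have hexp : cexp (π * polarCoeff r k / 12 / k ^ 2 * w⁻¹ - π * (2 ^ r - 1) / 12 * w)
      = cexp (π / 12 * (decayRate 1 k / k ^ 2 * w⁻¹ - (1 : ℕ) * w))
        * cexp (π / 12 * (decayRate (2 ^ r) k / k ^ 2 * w⁻¹ - (2 ^ r : ℕ) * w))
        / cexp (π / 12 * (decayRate 2 k / k ^ 2 * w⁻¹ - (2 : ℕ) * w)) := by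
    rw [← Complex.exp_add, ← Complex.exp_sub, polarCoeff, decayRate_one_left]
    congr 1
    push_cast
    ring
  have hsqrt := sqrt_ne_zero_of_re_pos hw
  have hsqrtk : ((√k : ℝ) : ℂ) ≠ 0 := ofReal_ne_zero.2 (Real.sqrt_pos.2 (by positivity)).ne'
  simp only [eulerFactor, principalFactor, hexp, multiplier, scaleFactor, Nat.gcd_one_left,
    Nat.div_one, one_mul, Nat.cast_one, div_one, Real.sqrt_one, ofReal_one, Nat.cast_pow,
    Nat.cast_ofNat, ofReal_div]
  generalize omega (2 / Nat.gcd 2 k * h) (k / Nat.gcd 2 k) = ω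
  generalize ((√(2 / (Nat.gcd 2 k : ℝ)) : ℝ) : ℂ) = s
  generalize cexp (π / 12 * (decayRate 2 k / k ^ 2 * w⁻¹ - 2 * w)) = E
  field_simp

theorem frFn_transform (r : ℕ) {k h : ℕ} (hk : 0 < k) (hc : Nat.Coprime h k) {w : ℂ}
    (hw : 0 < w.re) :
    ∃ x₁ x₂ x₃ : ℂ,
      ‖x₁‖ = rexp (-(2 * π * decayRate 1 k * ((w⁻¹).re / k ^ 2))) ∧
      ‖x₂‖ = rexp (-(2 * π * decayRate 2 k * ((w⁻¹).re / k ^ 2))) ∧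
      ‖x₃‖ = rexp (-(2 * π * decayRate (2 ^ r) k * ((w⁻¹).re / k ^ 2))) ∧
      frFn r (cexp (2 * π * I * (h / k + I * w)))
        = principalFactor r h k w * (eulerFn x₂ * ((eulerFn x₁)⁻¹ * (eulerFn x₃)⁻¹)) := by
  have h2r : 0 < 2 ^ r := by positivity
  obtain ⟨x₁, hnorm₁, hx₁⟩ := exists_eulerFn_eq_eulerFactor_mul one_pos hk hc hw
  obtain ⟨x₂, hnorm₂, hx₂⟩ := exists_eulerFn_eq_eulerFactor_mul two_pos hk hc hw
  obtain ⟨x₃, hnorm₃, hx₃⟩ := exists_eulerFn_eq_eulerFactor_mul h2r hk hc hw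
  refine ⟨x₁, x₂, x₃, hnorm₁, hnorm₂, hnorm₃, ?_⟩
  have hfactor₁ := eulerFactor_ne_zero one_pos hk h hw
  have hfactor₂ := eulerFactor_ne_zero two_pos hk h hw
  have hfactor₃ := eulerFactor_ne_zero h2r hk h hw
  rw [frFn, hx₁, hx₂, hx₃, pow_one, ← eulerFactor_mul_div_eq_principalFactor r h hk hw]
  field_simp

end TransformationAtFractions

section LeadingTerm

open Complex Real

theorem exists_norm_sub_le_of_differentiableOn_disc {g : ℂ → ℂ}
    (hg : DifferentiableOn ℂ g (Metric.ball 0 1)) {ρ : ℝ} (hρ0 : 0 ≤ ρ) (hρ : ρ < 1) :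
    ∃ K, 0 ≤ K ∧ ∀ x, ‖x‖ ≤ ρ → ‖g x - g 0‖ ≤ K * ‖x‖ := by
  have hsub : Metric.closedBall (0 : ℂ) ρ ⊆ Metric.ball 0 1 := Metric.closedBall_subset_ball hρ
  obtain ⟨K, hK⟩ := (isCompact_closedBall (0 : ℂ) ρ).exists_bound_of_continuousOn
    ((hg.deriv Metric.isOpen_ball).continuousOn.mono hsub)
  have hmem : (0 : ℂ) ∈ Metric.closedBall (0 : ℂ) ρ := Metric.mem_closedBall_self hρ0
  refine ⟨K, (norm_nonneg _).trans (hK 0 hmem), fun x hx => ?_⟩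
  simpa using (convex_closedBall (0 : ℂ) ρ).norm_image_sub_le_of_norm_deriv_le
    (fun y hy => hg.differentiableAt (Metric.isOpen_ball.mem_nhds (hsub hy))) hK hmem
    (mem_closedBall_zero_iff.2 hx)

theorem exists_norm_eulerFn_sub_one_le {ρ : ℝ} (hρ0 : 0 ≤ ρ) (hρ : ρ < 1) :
    ∃ K, 0 ≤ K ∧ ∀ x, ‖x‖ ≤ ρ → ‖eulerFn x - 1‖ ≤ K * ‖x‖ ∧ ‖(eulerFn x)⁻¹ - 1‖ ≤ K * ‖x‖ := by
  obtain ⟨K₁, hK₁, hbound⟩ := exists_norm_sub_le_of_differentiableOn_disc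
    isSumOnDisc_eulerFn.differentiableOn hρ0 hρ
  obtain ⟨K₂, -, hbound_inv⟩ := exists_norm_sub_le_of_differentiableOn_disc
    isSumOnDisc_f.differentiableOn hρ0 hρ
  have hzero : eulerFn 0 = 1 := by simp [eulerFn]
  simp only [hzero, inv_one] at hbound hbound_inv
  refine ⟨max K₁ K₂, le_max_of_le_left hK₁, fun x hx => ⟨(hbound x hx).trans ?_,
    (hbound_inv x hx).trans ?_⟩⟩ <;> gcongr
  exacts [le_max_left _ _, le_max_right _ _]

theorem norm_mul_sub_one_le {R : Type*} [SeminormedRing R] {a b : R} {δ ε : ℝ}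
    (ha : ‖a - 1‖ ≤ δ) (hb : ‖b - 1‖ ≤ ε) : ‖a * b - 1‖ ≤ (1 + δ) * (1 + ε) - 1 := by
  have hδ : 0 ≤ δ := (norm_nonneg _).trans ha
  calc ‖a * b - 1‖ = ‖(a - 1) * (b - 1) + (a - 1) + (b - 1)‖ := by congr 1; noncomm_ring
    _ ≤ δ * ε + δ + ε := norm_add_le_of_le (norm_add_le_of_le ((norm_mul_le _ _).trans
        (mul_le_mul ha hb (norm_nonneg _) hδ)) ha) hb
    _ = (1 + δ) * (1 + ε) - 1 := by ring

theorem one_add_mul_pow_sub_one_le {K ε : ℝ} (hK : 0 ≤ K) (hε0 : 0 ≤ ε) (hε1 : ε ≤ 1) (n : ℕ) :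
    (1 + K * ε) ^ n - 1 ≤ (1 + K) ^ n * ε := by
  induction n with
  | zero => simpa using hε0
  | succ n ih =>
    have hKε : 1 + K * ε ≤ 1 + K := by nlinarith
    have hpow := mul_le_mul_of_nonneg_right (pow_le_pow_left₀ (by positivity) hKε n)
      (mul_nonneg hK hε0)
    rw [pow_succ, pow_succ]
    linarith

theorem exists_norm_eulerFn_quotient_sub_one_le {ρ : ℝ} (hρ0 : 0 ≤ ρ) (hρ : ρ < 1) :
    ∃ K, 0 ≤ K ∧ ∀ (δ : ℝ) (x₁ x₂ x₃ : ℂ), δ ≤ ρ → ‖x₁‖ ≤ δ → ‖x₂‖ ≤ δ → ‖x₃‖ ≤ δ →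
      ‖eulerFn x₂ * ((eulerFn x₁)⁻¹ * (eulerFn x₃)⁻¹) - 1‖ ≤ K * δ := by
  obtain ⟨K, hK, hbound⟩ := exists_norm_eulerFn_sub_one_le hρ0 hρ
  refine ⟨(1 + K) ^ 3, by positivity, fun δ x₁ x₂ x₃ hδ h₁ h₂ h₃ => ?_⟩
  have hle : ∀ {x : ℂ}, ‖x‖ ≤ δ → K * ‖x‖ ≤ K * δ := fun hx => mul_le_mul_of_nonneg_left hx hK
  have hprod := norm_mul_sub_one_le ((hbound x₂ (h₂.trans hδ)).1.trans (hle h₂))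
    (norm_mul_sub_one_le ((hbound x₁ (h₁.trans hδ)).2.trans (hle h₁))
      ((hbound x₃ (h₃.trans hδ)).2.trans (hle h₃)))
  refine (hprod.trans_eq (by ring)).trans
    (one_add_mul_pow_sub_one_le hK ((norm_nonneg _).trans h₁) (hδ.trans hρ.le) 3)

theorem norm_principalFactor_le {r : ℕ} (hr : r ≤ 4) (h k : ℕ) {w : ℂ} (hw : 0 < w.re) :
    ‖principalFactor r h k w‖
      ≤ 4 * (√k * √‖w‖) * rexp (π * polarCoeff r k * ((w⁻¹).re / k ^ 2) / 12) := by
  have hexponent : (π : ℂ) * polarCoeff r k / 12 / k ^ 2 * w⁻¹ - π * (2 ^ r - 1) / 12 * w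
      = ((π * polarCoeff r k / 12 / k ^ 2 : ℝ) : ℂ) * w⁻¹
        - ((π * (2 ^ r - 1) / 12 : ℝ) : ℂ) * w := by
    push_cast
    ring
  have hre : 0 ≤ π * ((2 : ℝ) ^ r - 1) / 12 * w.re := by
    have : 0 ≤ (2 : ℝ) ^ r - 1 := sub_nonneg.2 (one_le_pow₀ one_le_two)
    positivity
  rw [principalFactor, hexponent, norm_mul, norm_mul, norm_mul, norm_mul, norm_multiplier, one_mul,
    Complex.norm_exp, norm_sqrt_complex, Complex.norm_real, Complex.norm_real,
    Real.norm_of_nonneg (scaleFactor_nonneg r k), Real.norm_of_nonneg (Real.sqrt_nonneg _), sub_re,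
    re_ofReal_mul, re_ofReal_mul, mul_assoc (scaleFactor r k)]
  gcongr
  · exact scaleFactor_le hr k
  · calc _ ≤ π * polarCoeff r k / 12 / k ^ 2 * (w⁻¹).re := sub_le_self _ hre
      _ = _ := by ring

open Classical in
/-- The part of `f_r` at `exp (2πi (h/k + iw))` that is unbounded as `w → 0` inside a Ford circle;
it vanishes at the fractions where `f_r` stays bounded. -/
def leadingTerm (r h k : ℕ) (w : ℂ) : ℂ :=
  if 0 < polarCoeff r k then principalFactor r h k w else 0

theorem exp_neg_decay_le {a c y : ℝ} (hc : 1 / 16 ≤ c) (hac : a ≤ 24 * c) (hy : 1 ≤ y) :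
    rexp (-(2 * π * c * y)) ≤ min (rexp (-(2 * π / 16))) (rexp (-(π * a * y / 12))) := by
  have hcy : 1 / 16 ≤ c * y := by nlinarith
  have hay : a * y ≤ 24 * c * y := mul_le_mul_of_nonneg_right hac (by linarith)
  refine le_min (Real.exp_le_exp.2 ?_) (Real.exp_le_exp.2 ?_) <;> nlinarith [Real.pi_pos]

/-- The growth `exp (π a y / 12)` of the principal factor is compensated by the decay of the
transformed variables, since `polarCoeff r k ≤ 24 * decayRate m k` for `m = 1, 2, 2 ^ r`. -/
theorem exists_frFn_approx {r : ℕ} (hr : r ≤ 4) :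
    ∃ K, 0 ≤ K ∧ ∀ (k h : ℕ) (w : ℂ), 0 < k → Nat.Coprime h k → 0 < w.re → (k : ℝ) ^ 2 ≤ (w⁻¹).re →
      ‖frFn r (cexp (2 * π * I * (h / k + I * w))) - leadingTerm r h k w‖ ≤ K * (√k * √‖w‖) := by
  have hρ : rexp (-(2 * π / 16)) < 1 := Real.exp_lt_one_iff.2 (by linarith [Real.pi_pos])
  obtain ⟨K, hK, hquot⟩ := exists_norm_eulerFn_quotient_sub_one_le (Real.exp_pos _).le hρ
  refine ⟨4 * (1 + K), by positivity, fun k h w hk hc hw hwk => ?_⟩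
  obtain ⟨x₁, x₂, x₃, hx₁, hx₂, hx₃, htransform⟩ := frFn_transform r hk hc hw
  have hP := norm_principalFactor_le hr h k hw
  rw [htransform, leadingTerm]
  set P := principalFactor r h k w
  set a := polarCoeff r k
  set y := (w⁻¹).re / (k : ℝ) ^ 2 with hy
  set E := eulerFn x₂ * ((eulerFn x₁)⁻¹ * (eulerFn x₃)⁻¹)
  have hy1 : 1 ≤ y := by rwa [hy, one_le_div (by positivity)]
  have hE := hquot (min (rexp (-(2 * π / 16))) (rexp (-(π * a * y / 12)))) x₁ x₂ x₃
    (min_le_left _ _)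
    (hx₁.trans_le (exp_neg_decay_le (by norm_num [decayRate_one_left])
      (by simpa [decayRate_one_left] using polarCoeff_le hr k) hy1))
    (hx₂.trans_le (exp_neg_decay_le ((by norm_num : (1 : ℝ) / 16 ≤ 1 / 2).trans
      (one_half_le_decayRate_two k)) (polarCoeff_le_decayRate_two hr k) hy1))
    (hx₃.trans_le (exp_neg_decay_le (one_div_sixteen_le_decayRate_two_pow hr k)
      (polarCoeff_le_decayRate_two_pow hr k) hy1))
  split_ifs with hpos
  · have hE' : ‖E - 1‖ ≤ K * rexp (-(π * a * y / 12)) :=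
      hE.trans (by gcongr; exact min_le_right _ _)
    calc ‖P * E - P‖ = ‖P‖ * ‖E - 1‖ := by rw [← norm_mul, mul_sub_one]
      _ ≤ 4 * (√k * √‖w‖) * rexp (π * a * y / 12) * (K * rexp (-(π * a * y / 12))) := by gcongr
      _ = 4 * K * (√k * √‖w‖) * (rexp (π * a * y / 12) * rexp (-(π * a * y / 12))) := by ring
      _ = 4 * K * (√k * √‖w‖) := by rw [← Real.exp_add, add_neg_cancel, Real.exp_zero, mul_one]
      _ ≤ 4 * (1 + K) * (√k * √‖w‖) := by gcongr; linarith
  · have hEK : ‖E - 1‖ ≤ K := hE.trans (mul_le_of_le_one_right hK ((min_le_left _ _).trans hρ.le))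
    have hE' : ‖E‖ ≤ 1 + K := by linarith [norm_le_norm_add_norm_sub' E 1, norm_one (α := ℂ)]
    have hexp : rexp (π * a * y / 12) ≤ 1 := by
      have hay : a * y ≤ 0 := mul_nonpos_of_nonpos_of_nonneg (not_lt.1 hpos) (by linarith)
      exact Real.exp_le_one_iff.2 (by nlinarith [Real.pi_pos])
    calc ‖P * E - 0‖ = ‖P‖ * ‖E‖ := by rw [sub_zero, norm_mul]
      _ ≤ 4 * (√k * √‖w‖) * 1 * (1 + K) := by gcongr; exact hP.trans (by gcongr)
      _ = 4 * (1 + K) * (√k * √‖w‖) := by ring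

end LeadingTerm

section Farey

open Complex Finset

theorem exists_mul_sub_dvd {h k N : ℕ} (hk : 0 < k) (hkN : k ≤ N) (hc : Nat.Coprime h k) (c : ℤ) :
    ∃ x : ℕ, N < x + k ∧ x ≤ N ∧ (k : ℤ) ∣ h * x - c := by
  obtain ⟨u, v, huv⟩ := Nat.isCoprime_iff_coprime.2 hc
  have hkZ : (0 : ℤ) < k := by exact_mod_cast hk
  set e := (N - u * c) % k
  have he_nonneg : 0 ≤ e := Int.emod_nonneg _ hkZ.ne'
  have he_lt : e < k := Int.emod_lt_of_pos _ hkZ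
  have hdiv : e + k * ((N - u * c) / k) = N - u * c := Int.emod_add_mul_ediv _ _
  obtain ⟨x, hx⟩ := Int.eq_ofNat_of_zero_le (show 0 ≤ (N : ℤ) - e by lia)
  refine ⟨x, by omega, by omega, ⟨h * ((N - u * c) / k) - v * c, ?_⟩⟩
  rw [← hx]
  linear_combination c * huv - h * hdiv

theorem eq_of_dvd_mul_sub {h k N x y : ℕ} (hc : Nat.Coprime h k) {c : ℤ}
    (hNx : N < x + k) (hxN : x ≤ N) (hx : (k : ℤ) ∣ h * x - c)
    (hNy : N < y + k) (hyN : y ≤ N) (hy : (k : ℤ) ∣ h * y - c) : x = y := by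
  have hmul : (k : ℤ) ∣ h * (x - y) := by
    rw [show (h : ℤ) * (x - y) = h * x - c - (h * y - c) by ring]
    exact dvd_sub hx hy
  have hdvd : (k : ℤ) ∣ (x : ℤ) - y :=
    (Nat.isCoprime_iff_coprime.2 hc.symm).dvd_of_dvd_mul_left hmul
  have := Int.eq_zero_of_abs_lt_dvd hdvd (by rw [abs_lt]; constructor <;> omega)
  omega

open Classical in
/-- The solution `x` of `h x ≡ c (mod k)` in the interval `(N - k, N]`. For `c = -1` resp. `c = 1`
it is the denominator of the right resp. left neighbour of `h/k` in the Farey sequence of order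
`N`. It is `0` if there is no solution, which does not happen for coprime `h` and `k ≤ N`. -/
def fareyNeighbour (N h k : ℕ) (c : ℤ) : ℕ :=
  if H : ∃ x : ℕ, N < x + k ∧ x ≤ N ∧ (k : ℤ) ∣ h * x - c then H.choose else 0

theorem fareyNeighbour_spec {h k N : ℕ} (hk : 0 < k) (hkN : k ≤ N) (hc : Nat.Coprime h k) (c : ℤ) :
    N < fareyNeighbour N h k c + k ∧ fareyNeighbour N h k c ≤ N ∧
      (k : ℤ) ∣ h * fareyNeighbour N h k c - c := by
  have H := exists_mul_sub_dvd hk hkN hc c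
  rw [fareyNeighbour, dif_pos H]
  exact H.choose_spec

theorem fareyNeighbour_eq {h k N x : ℕ} (hk : 0 < k) (hkN : k ≤ N) (hc : Nat.Coprime h k) {c : ℤ}
    (hNx : N < x + k) (hxN : x ≤ N) (hx : (k : ℤ) ∣ h * x - c) : fareyNeighbour N h k c = x := by
  obtain ⟨hlt, hle, hdvd⟩ := fareyNeighbour_spec hk hkN hc c
  exact eq_of_dvd_mul_sub hc hlt hle hdvd hNx hxN hx

/-- The reduced fractions `h/k` in `[0,1)` with `k ≤ N`, as pairs `(k,h)`: the Farey sequence of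
order `N`, modulo `1`. -/
def fareyFractions (N : ℕ) : Finset (Σ _ : ℕ, ℕ) := (Icc 1 N).sigma reduced

theorem mem_fareyFractions {N : ℕ} {p : Σ _ : ℕ, ℕ} :
    p ∈ fareyFractions N ↔ (1 ≤ p.1 ∧ p.1 ≤ N) ∧ p.2 < p.1 ∧ Nat.Coprime p.2 p.1 := by
  simp [fareyFractions, reduced, Nat.Coprime]

/-- The right neighbour of a Farey fraction, modulo `1`: the successor of `(N-1)/N` is `0/1`. -/
def fareyNext (N : ℕ) (p : Σ _ : ℕ, ℕ) : Σ _ : ℕ, ℕ :=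
  let x := fareyNeighbour N p.2 p.1 (-1)
  ⟨x, ((p.2 * x + 1) / p.1) % x⟩

section

variable {N : ℕ} {p : Σ _ : ℕ, ℕ}

theorem exists_fareyNext_snd_eq_mod (hp : p ∈ fareyFractions N) :
    ∃ y : ℕ, p.2 * (fareyNext N p).1 + 1 = p.1 * y ∧
      (fareyNext N p).2 = y % (fareyNext N p).1 := by
  obtain ⟨⟨hk, hkN⟩, -, hc⟩ := mem_fareyFractions.1 hp
  have hdvd : (p.1 : ℤ) ∣ ((p.2 * (fareyNext N p).1 + 1 : ℕ) : ℤ) := by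
    simpa [fareyNext] using (fareyNeighbour_spec hk hkN hc (-1)).2.2
  obtain ⟨y, hy⟩ := Int.natCast_dvd_natCast.1 hdvd
  refine ⟨y, hy, ?_⟩
  change (p.2 * (fareyNext N p).1 + 1) / p.1 % (fareyNext N p).1 = _
  rw [hy, Nat.mul_div_cancel_left _ hk]

theorem fareyNext_fst_pos (hp : p ∈ fareyFractions N) : 0 < (fareyNext N p).1 := by
  obtain ⟨⟨hk, hkN⟩, -, hc⟩ := mem_fareyFractions.1 hp
  obtain ⟨y, hy, -⟩ := exists_fareyNext_snd_eq_mod hp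
  have hsum : N < (fareyNext N p).1 + p.1 := (fareyNeighbour_spec hk hkN hc (-1)).1
  refine Nat.pos_of_ne_zero fun hzero => ?_
  rw [hzero, mul_zero, zero_add] at hy
  have := Nat.dvd_one.1 ⟨y, hy⟩
  omega

theorem fareyNext_mem (hp : p ∈ fareyFractions N) : fareyNext N p ∈ fareyFractions N := by
  obtain ⟨⟨hk, hkN⟩, -, hc⟩ := mem_fareyFractions.1 hp
  obtain ⟨y, hy, hmod⟩ := exists_fareyNext_snd_eq_mod hp
  have hcop : Nat.Coprime y (fareyNext N p).1 := by
    refine Nat.isCoprime_iff_coprime.1 ⟨p.1, -p.2, ?_⟩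
    have hyZ : (p.2 : ℤ) * (fareyNext N p).1 + 1 = p.1 * y := by exact_mod_cast hy
    linear_combination -hyZ
  refine mem_fareyFractions.2 ⟨⟨fareyNext_fst_pos hp, (fareyNeighbour_spec hk hkN hc (-1)).2.1⟩,
    hmod ▸ Nat.mod_lt _ (fareyNext_fst_pos hp), ?_⟩
  rw [hmod, Nat.Coprime, ← Nat.gcd_rec]
  exact hcop.symm

theorem fareyNeighbour_fareyNext (hp : p ∈ fareyFractions N) :
    fareyNeighbour N (fareyNext N p).2 (fareyNext N p).1 1 = p.1 := by
  obtain ⟨⟨hk, hkN⟩, -, hc⟩ := mem_fareyFractions.1 hp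
  obtain ⟨⟨hx, hxN⟩, -, hcx⟩ := mem_fareyFractions.1 (fareyNext_mem hp)
  obtain ⟨y, hy, hmod⟩ := exists_fareyNext_snd_eq_mod hp
  have hsum : N < (fareyNext N p).1 + p.1 := (fareyNeighbour_spec hk hkN hc (-1)).1
  refine fareyNeighbour_eq hx hxN hcx (by omega) hkN
    ⟨p.2 - p.1 * (y / (fareyNext N p).1 : ℕ), ?_⟩
  have hyZ : (p.2 : ℤ) * (fareyNext N p).1 + 1 = p.1 * y := by exact_mod_cast hy
  have hdiv : (y : ℤ) = (fareyNext N p).2 + (fareyNext N p).1 * (y / (fareyNext N p).1 : ℕ) := by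
    rw [hmod]
    exact_mod_cast (Nat.mod_add_div y _).symm
  linear_combination -hyZ - p.1 * hdiv

theorem fareyNext_snd_mul (hp : p ∈ fareyFractions N) (hne : (fareyNext N p).1 ≠ 1) :
    (fareyNext N p).2 * p.1 = p.2 * (fareyNext N p).1 + 1 := by
  obtain ⟨-, hlt, -⟩ := mem_fareyFractions.1 hp
  obtain ⟨y, hy, hmod⟩ := exists_fareyNext_snd_eq_mod hp
  have hx := fareyNext_fst_pos hp
  have hyx : y < (fareyNext N p).1 := by
    by_contra! hge
    have := Nat.mul_le_mul_left p.1 hge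
    have := Nat.mul_le_mul_right (fareyNext N p).1 (show p.2 + 1 ≤ p.1 from hlt)
    rw [add_mul, one_mul] at this
    omega
  rw [hmod, Nat.mod_eq_of_lt hyx, mul_comm, hy]

theorem fareyNext_fst_eq_one_iff (hp : p ∈ fareyFractions N) :
    (fareyNext N p).1 = 1 ↔ p = ⟨N, N - 1⟩ := by
  obtain ⟨⟨hk, hkN⟩, hlt, hc⟩ := mem_fareyFractions.1 hp
  constructor
  · intro hone
    obtain ⟨y, hy, -⟩ := exists_fareyNext_snd_eq_mod hp
    have hsum : N < (fareyNext N p).1 + p.1 := (fareyNeighbour_spec hk hkN hc (-1)).1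
    have hdvd : p.1 ∣ p.2 + 1 := ⟨y, by rw [← hy, hone, mul_one]⟩
    have := Nat.le_of_dvd p.2.succ_pos hdvd
    exact Sigma.ext (by simp only; omega) (heq_of_eq (by simp only; omega))
  · rintro rfl
    refine fareyNeighbour_eq hk hkN hc (by simp only; omega) hk ⟨1, ?_⟩
    push_cast [Nat.cast_sub (show 1 ≤ N from hk)]
    ring

end

theorem last_mem_fareyFractions {N : ℕ} (hN : 1 ≤ N) :
    (⟨N, N - 1⟩ : Σ _ : ℕ, ℕ) ∈ fareyFractions N := by
  refine mem_fareyFractions.2 ⟨⟨hN, le_rfl⟩, Nat.sub_one_lt_of_lt hN, ?_⟩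
  exact (Nat.coprime_self_sub_left hN).2 (Nat.coprime_one_left N)

theorem fareyNext_injOn (N : ℕ) : Set.InjOn (fareyNext N) (fareyFractions N) := by
  intro p hp q hq hpq
  have hk : p.1 = q.1 := by
    rw [← fareyNeighbour_fareyNext hp, ← fareyNeighbour_fareyNext hq, hpq]
  obtain ⟨-, hplt, -⟩ := mem_fareyFractions.1 hp
  obtain ⟨-, hqlt, -⟩ := mem_fareyFractions.1 hq
  obtain ⟨y, hy, -⟩ := exists_fareyNext_snd_eq_mod hp
  obtain ⟨z, hz, -⟩ := exists_fareyNext_snd_eq_mod hq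
  rw [← hpq, ← hk] at hz
  have hyZ : (p.2 : ℤ) * (fareyNext N p).1 + 1 = p.1 * y := by exact_mod_cast hy
  have hzZ : (q.2 : ℤ) * (fareyNext N p).1 + 1 = p.1 * z := by exact_mod_cast hz
  have hcop : IsCoprime (p.1 : ℤ) (fareyNext N p).1 := ⟨y, -p.2, by linear_combination -hyZ⟩
  have hmul : (p.1 : ℤ) ∣ (fareyNext N p).1 * ((p.2 : ℤ) - q.2) :=
    ⟨y - z, by linear_combination hyZ - hzZ⟩
  have := Int.eq_zero_of_abs_lt_dvd (hcop.dvd_of_dvd_mul_left hmul)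
    (by rw [abs_lt]; constructor <;> omega)
  exact Sigma.ext hk (heq_of_eq (by omega))

theorem sum_comp_fareyNext {M : Type*} [AddCommMonoid M] (N : ℕ) (L : (Σ _ : ℕ, ℕ) → M) :
    ∑ p ∈ fareyFractions N, L (fareyNext N p) = ∑ p ∈ fareyFractions N, L p :=
  sum_nbij (fareyNext N) (fun _ hp => fareyNext_mem hp) (fareyNext_injOn N)
    (surjOn_of_injOn_of_card_le _ (fun _ hp => fareyNext_mem hp) (fareyNext_injOn N) le_rfl)
    (fun _ _ => rfl)

/-- The point at which the Ford circle of `h/k` meets that of a neighbouring fraction with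
denominator `|x|`, to the right for `x > 0` and to the left for `x < 0`. -/
def fordPoint (h k : ℕ) (x : ℤ) : ℂ :=
  h / k + I * ((k : ℂ) ^ 2 + I * (k * x))⁻¹

theorem fordPoint_im_pos {h k : ℕ} (hk : 0 < k) (x : ℤ) : 0 < (fordPoint h k x).im := by
  have hfrac : ((h : ℂ) / k).im = 0 := by
    rw [← ofReal_natCast, ← ofReal_natCast k, ← ofReal_div, ofReal_im]
  have hre : ((k : ℂ) ^ 2 + I * (k * x)).re = (k : ℝ) ^ 2 := by
    simp [← ofReal_natCast, ← ofReal_pow]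
  rw [fordPoint, add_im, hfrac, zero_add, I_mul_im]
  exact inv_re_pos (by rw [hre]; positivity)

theorem fordPoint_eq {h k h' k' : ℕ} (hk : 0 < k) (hk' : 0 < k') (H : h' * k = h * k' + 1) :
    fordPoint h k k' = fordPoint h' k' (-k) := by
  have hkC : (k : ℂ) ≠ 0 := by exact_mod_cast hk.ne'
  have hk'C : (k' : ℂ) ≠ 0 := by exact_mod_cast hk'.ne'
  obtain ⟨z, hz⟩ : ∃ z : ℂ, z = k' - I * k := ⟨_, rfl⟩
  have hz0 : z ≠ 0 := ne_zero_of_re_pos (by simpa [hz] using hk')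
  have hright : (k : ℂ) ^ 2 + I * (k * k') = k * (I * z) := by
    linear_combination (k : ℂ) ^ 2 * I_sq - k * I * hz
  have hleft : (k' : ℂ) ^ 2 + I * (k' * -k) = k' * z := by linear_combination -k' * hz
  have hfrac : (h' : ℂ) / k' = h / k + 1 / (k * k') := by
    have : (h' : ℂ) * k = h * k' + 1 := by exact_mod_cast H
    field_simp
    linear_combination this
  rw [fordPoint, fordPoint, hfrac]
  push_cast
  rw [hright, hleft]
  field_simp
  linear_combination -hz

theorem fordPoint_add_one {h k : ℕ} (x : ℤ) (hk : 0 < k) :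
    fordPoint (h + k) k x = fordPoint h k x + 1 := by
  have hkC : (k : ℂ) ≠ 0 := by exact_mod_cast hk.ne'
  simp only [fordPoint, Nat.cast_add, add_div, div_self hkC]
  ring

section

variable {Φ : ℂ → ℂ} {c : ℂ} {N : ℕ}

theorem apply_fordPoint_eq_fareyNext (hΦ : ∀ τ : ℂ, 0 < τ.im → Φ (τ + 1) = Φ τ + c)
    {p : Σ _ : ℕ, ℕ} (hp : p ∈ fareyFractions N) :
    Φ (fordPoint p.2 p.1 (fareyNeighbour N p.2 p.1 (-1)))
      = Φ (fordPoint (fareyNext N p).2 (fareyNext N p).1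
          (-(fareyNeighbour N (fareyNext N p).2 (fareyNext N p).1 1 : ℤ)))
        + if p = ⟨N, N - 1⟩ then c else 0 := by
  have hk : 0 < p.1 := (mem_fareyFractions.1 hp).1.1
  have hx := fareyNext_fst_pos hp
  rw [show fareyNeighbour N p.2 p.1 (-1) = (fareyNext N p).1 from rfl, fareyNeighbour_fareyNext hp]
  simp only [← fareyNext_fst_eq_one_iff hp]
  split_ifs with hone
  · obtain rfl := (fareyNext_fst_eq_one_iff hp).1 hone
    have hzero : (fareyNext N ⟨N, N - 1⟩).2 = 0 :=
      Nat.lt_one_iff.1 ((mem_fareyFractions.1 (fareyNext_mem hp)).2.1.trans_eq hone)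
    rw [hone, hzero, ← hΦ _ (fordPoint_im_pos one_pos _), ← fordPoint_add_one _ one_pos]
    rw [fordPoint_eq (h' := 0 + 1) (k' := 1) hk one_pos]
    have : 0 < N := hk
    simp only
    omega
  · rw [add_zero, fordPoint_eq hk hx (fareyNext_snd_mul hp hone)]

theorem sum_fordPoint_sub (hΦ : ∀ τ : ℂ, 0 < τ.im → Φ (τ + 1) = Φ τ + c) (hN : 1 ≤ N) :
    ∑ k ∈ Icc 1 N, ∑ h ∈ reduced k, (Φ (fordPoint h k (fareyNeighbour N h k (-1)))
      - Φ (fordPoint h k (-(fareyNeighbour N h k 1 : ℤ)))) = c := by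
  rw [← sum_sigma (Icc 1 N) reduced (fun p => Φ (fordPoint p.2 p.1 (fareyNeighbour N p.2 p.1 (-1)))
      - Φ (fordPoint p.2 p.1 (-(fareyNeighbour N p.2 p.1 1 : ℤ))))]
  change ∑ p ∈ fareyFractions N, _ = c
  rw [sum_sub_distrib, sum_congr rfl fun p hp => apply_fordPoint_eq_fareyNext hΦ hp,
    sum_add_distrib, sum_comp_fareyNext N fun p =>
      Φ (fordPoint p.2 p.1 (-(fareyNeighbour N p.2 p.1 1 : ℤ))),
    sum_ite_eq', if_pos (last_mem_fareyFractions hN), add_sub_cancel_left]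

end

end Farey

section Primitive

open Complex Real

variable {a : PowerSeries ℂ} {g : ℂ → ℂ}

theorem IsSumOnDisc.shift (ha : IsSumOnDisc a g) (N : ℕ) :
    IsSumOnDisc (PowerSeries.mk fun j => PowerSeries.coeff (j + N) a)
      (fun x => ∑' j, PowerSeries.coeff (j + N) a * x ^ j) := by
  intro x hx
  simp only [PowerSeries.coeff_mk]
  refine Summable.hasSum ?_
  rcases eq_or_ne x 0 with rfl | hx0
  · refine summable_of_ne_finset_zero (s := {0}) fun j hj => ?_
    rw [zero_pow (by simpa using hj), mul_zero]
  · refine (((summable_nat_add_iff N).2 (ha x hx).summable).mul_right (x ^ N)⁻¹).congr fun j => ?_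
    rw [pow_add]
    field_simp

theorem IsSumOnDisc.apply_eq_sum_add_tsum (ha : IsSumOnDisc a g) {x : ℂ} (hx : ‖x‖ < 1) (N : ℕ) :
    g x = ∑ m ∈ Finset.range N, PowerSeries.coeff m a * x ^ m
      + x ^ N * ∑' j, PowerSeries.coeff (j + N) a * x ^ j := by
  rw [← (ha x hx).tsum_eq, ← (ha x hx).summable.sum_add_tsum_nat_add N, ← tsum_mul_left]
  congr 1
  exact tsum_congr fun j => by rw [pow_add]; ring

theorem norm_cexp_two_pi_I_mul_lt_one {τ : ℂ} (hτ : 0 < τ.im) : ‖cexp (2 * π * I * τ)‖ < 1 := by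
  have hre : (2 * π * I * τ).re = -(2 * π * τ.im) := by simp
  rw [Complex.norm_exp, Real.exp_lt_one_iff, hre, neg_neg_iff_pos]
  exact mul_pos Real.two_pi_pos hτ

theorem cexp_two_pi_I_mul_int_mul_add_one (c : ℤ) (τ : ℂ) :
    cexp (2 * π * I * c * (τ + 1)) = cexp (2 * π * I * c * τ) :=
  Complex.exp_eq_exp_iff_exists_int.2 ⟨c, by ring⟩

theorem cexp_pow_mul_cexp_neg (m n : ℕ) (τ : ℂ) :
    cexp (2 * π * I * τ) ^ m * cexp (-(2 * π * I * n * τ))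
      = cexp (2 * π * I * ((m : ℂ) - n) * τ) := by
  rw [← Complex.exp_nat_mul, ← Complex.exp_add]
  ring_nf

theorem IsSumOnDisc.apply_cexp_mul_cexp (ha : IsSumOnDisc a g) (n : ℕ) {τ : ℂ} (hτ : 0 < τ.im) :
    g (cexp (2 * π * I * τ)) * cexp (-(2 * π * I * n * τ))
      = ∑ m ∈ Finset.range n, PowerSeries.coeff m a * cexp (2 * π * I * ((m : ℂ) - n) * τ)
        + PowerSeries.coeff n a
        + (∑' j, PowerSeries.coeff (j + (n + 1)) a * cexp (2 * π * I * τ) ^ j)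
          * cexp (2 * π * I * τ) := by
  have hpow (m : ℕ) := cexp_pow_mul_cexp_neg m n τ
  have hsucc : cexp (2 * π * I * τ) ^ (n + 1) * cexp (-(2 * π * I * n * τ))
      = cexp (2 * π * I * τ) := by
    rw [hpow, Nat.cast_add, Nat.cast_one, add_sub_cancel_left, mul_one]
  rw [ha.apply_eq_sum_add_tsum (norm_cexp_two_pi_I_mul_lt_one hτ) (n + 1), Finset.sum_range_succ,
    add_mul, add_mul, Finset.sum_mul]
  simp only [mul_assoc (PowerSeries.coeff _ a), hpow, sub_self, mul_zero, zero_mul,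
    Complex.exp_zero, mul_one]
  linear_combination (∑' j, PowerSeries.coeff (j + (n + 1)) a * cexp (2 * π * I * τ) ^ j) * hsucc

theorem hasDerivAt_cexp_const_mul_div {c : ℂ} (hc : c ≠ 0) (z : ℂ) :
    HasDerivAt (fun z => cexp (c * z) / c) (cexp (c * z)) z := by
  simpa [hc] using ((hasDerivAt_id z).const_mul c).cexp.div_const c

/-- The terms of `g(e^{2πiτ}) e^{-2πinτ}` with index `≠ n` have periodic primitives, so that the
increment over a period of a primitive is the `n`-th coefficient. -/
theorem IsSumOnDisc.exists_primitive (ha : IsSumOnDisc a g) (n : ℕ) :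
    ∃ Φ : ℂ → ℂ,
      (∀ τ : ℂ, 0 < τ.im →
        HasDerivAt Φ (g (cexp (2 * π * I * τ)) * cexp (-(2 * π * I * n * τ))) τ) ∧
      ∀ τ : ℂ, Φ (τ + 1) = Φ τ + PowerSeries.coeff n a := by
  obtain ⟨G, hG⟩ := (ha.shift (n + 1)).differentiableOn.isExactOn_ball
  have hpi : (2 * π * I : ℂ) ≠ 0 := Complex.two_pi_I_ne_zero
  refine ⟨fun τ => ∑ m ∈ Finset.range n, PowerSeries.coeff m a
      * (cexp (2 * π * I * ((m : ℂ) - n) * τ) / (2 * π * I * ((m : ℂ) - n)))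
      + PowerSeries.coeff n a * τ + G (cexp (2 * π * I * τ)) / (2 * π * I), ?_, ?_⟩
  · intro τ hτ
    have hpolar : HasDerivAt (fun τ => ∑ m ∈ Finset.range n, PowerSeries.coeff m a
        * (cexp (2 * π * I * ((m : ℂ) - n) * τ) / (2 * π * I * ((m : ℂ) - n))))
        (∑ m ∈ Finset.range n, PowerSeries.coeff m a * cexp (2 * π * I * ((m : ℂ) - n) * τ)) τ := by
      refine HasDerivAt.fun_sum fun m hm => (hasDerivAt_cexp_const_mul_div ?_ τ).const_mul _
      exact mul_ne_zero hpi (sub_ne_zero.2 (Nat.cast_injective.ne (Finset.mem_range.1 hm).ne))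
    have hconst : HasDerivAt (fun τ => PowerSeries.coeff n a * τ) (PowerSeries.coeff n a) τ := by
      simpa using (hasDerivAt_id τ).const_mul (PowerSeries.coeff n a)
    have hq := hG _ (mem_ball_zero_iff.2 (norm_cexp_two_pi_I_mul_lt_one hτ))
    have htail := (hq.comp τ ((hasDerivAt_id τ).const_mul (2 * π * I)).cexp).div_const (2 * π * I)
    rw [ha.apply_cexp_mul_cexp n hτ]
    refine (hpolar.add hconst).add (htail.congr_deriv ?_)
    simp only [id, mul_one]
    field_simp
  · intro τ
    have hper (m : ℕ) := cexp_two_pi_I_mul_int_mul_add_one (m - n) τ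
    have hper_one := cexp_two_pi_I_mul_int_mul_add_one 1 τ
    push_cast at hper hper_one
    rw [mul_one] at hper_one
    simp only [hper, hper_one]
    ring

end Primitive

section Kernel

open Complex Real MeasureTheory Set

/-- The integrand `u^{-5/2} exp(a u + b/u)` of the circle method, after inversion of the variable.
The half-integral power is encoded as `√(u⁻¹) u⁻²`. -/
def kernelFn (a b : ℝ) (u : ℂ) : ℂ :=
  Complex.sqrt u⁻¹ * (u⁻¹) ^ 2 * cexp (a * u + b * u⁻¹)

/-- The integral of `u^{-5/2} exp(a u + b/u)` along the line `Re u = c`, with respect to the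
imaginary part of `u`: the contribution of a whole Ford circle. -/
def kernelIntegral (c a b : ℝ) : ℂ := ∫ t : ℝ, kernelFn a b (c + I * t)

theorem add_I_mul_re (c t : ℝ) : ((c : ℂ) + I * t).re = c := by simp

theorem add_I_mul_ne_zero {c : ℝ} (hc : 0 < c) (t : ℝ) : (c : ℂ) + I * t ≠ 0 :=
  ne_zero_of_re_pos (by rwa [add_I_mul_re])

theorem half_add_abs_le_norm_add_I_mul {c : ℝ} (hc : 0 < c) (t : ℝ) :
    (c + |t|) / 2 ≤ ‖(c : ℂ) + I * t‖ := by
  have hre := Complex.abs_re_le_norm ((c : ℂ) + I * t)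
  have him := Complex.abs_im_le_norm ((c : ℂ) + I * t)
  rw [add_I_mul_re, abs_of_pos hc] at hre
  rw [show ((c : ℂ) + I * t).im = t by simp] at him
  linarith

theorem continuous_inv_add_I_mul {c : ℝ} (hc : 0 < c) :
    Continuous fun t : ℝ => ((c : ℂ) + I * t)⁻¹ :=
  Continuous.inv₀ (by fun_prop) (add_I_mul_ne_zero hc)

theorem continuous_kernelFn {c : ℝ} (hc : 0 < c) (a b : ℝ) :
    Continuous fun t : ℝ => kernelFn a b (c + I * t) := by
  have hinv := continuous_inv_add_I_mul hc
  have hsqrt : Continuous fun t : ℝ => Complex.sqrt ((c : ℂ) + I * t)⁻¹ :=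
    continuous_iff_continuousAt.2 fun t => ContinuousAt.comp
      (f := fun t : ℝ => ((c : ℂ) + I * t)⁻¹) (g := Complex.sqrt)
      (continuousAt_sqrt (Or.inl (inv_re_pos (by rwa [add_I_mul_re])).le)) hinv.continuousAt
  unfold kernelFn
  fun_prop

theorem inv_re_le_inv {u : ℂ} (hu : 0 < u.re) : (u⁻¹).re ≤ 1 / u.re := by
  rw [inv_re, div_le_div_iff₀ (normSq_pos.2 (ne_zero_of_re_pos hu)) hu, normSq_apply]
  nlinarith [mul_self_nonneg u.im]

theorem norm_kernelFn {a b : ℝ} {u : ℂ} (hu : u ≠ 0) :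
    ‖kernelFn a b u‖ = ‖u‖ ^ (-(5 / 2) : ℝ) * rexp (a * u.re + b * (u⁻¹).re) := by
  have hpos : 0 < ‖u‖ := norm_pos_iff.2 hu
  rw [kernelFn, norm_mul, norm_mul, norm_sqrt_complex, norm_pow, norm_inv, Complex.norm_exp,
    add_re, re_ofReal_mul, re_ofReal_mul, Real.sqrt_inv, Real.sqrt_eq_rpow,
    ← Real.rpow_neg hpos.le, inv_pow, ← Real.rpow_natCast, ← Real.rpow_neg hpos.le,
    ← Real.rpow_add hpos]
  norm_num

theorem norm_kernelFn_le {c : ℝ} (hc : 0 < c) {a b : ℝ} (hb : 0 ≤ b) (t : ℝ) :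
    ‖kernelFn a b (c + I * t)‖ ≤ 8 * rexp (a * c + b / c) * (c + |t|) ^ (-(5 / 2) : ℝ) := by
  have hct : 0 < c + |t| := by positivity
  have hre := add_I_mul_re c t
  have hinv := inv_re_le_inv (u := (c : ℂ) + I * t) (by rwa [hre])
  rw [hre] at hinv
  have hexp : rexp (a * c + b * (((c : ℂ) + I * t)⁻¹).re) ≤ rexp (a * c + b / c) := by
    rw [Real.exp_le_exp, ← mul_one_div]
    gcongr
  have htwo : (2 : ℝ) ^ (5 / 2 : ℝ) ≤ 8 :=
    (Real.rpow_le_rpow_of_exponent_le one_le_two (by norm_num : (5 / 2 : ℝ) ≤ 3)).trans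
      (by norm_num)
  have hpow : ‖(c : ℂ) + I * t‖ ^ (-(5 / 2) : ℝ) ≤ 8 * (c + |t|) ^ (-(5 / 2) : ℝ) :=
    calc ‖(c : ℂ) + I * t‖ ^ (-(5 / 2) : ℝ) ≤ ((c + |t|) / 2) ^ (-(5 / 2) : ℝ) :=
          Real.rpow_le_rpow_of_nonpos (by positivity) (half_add_abs_le_norm_add_I_mul hc t)
            (by norm_num)
      _ = 2 ^ (5 / 2 : ℝ) * (c + |t|) ^ (-(5 / 2) : ℝ) := by
          rw [Real.div_rpow hct.le zero_le_two, Real.rpow_neg zero_le_two, div_inv_eq_mul, mul_comm]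
      _ ≤ 8 * (c + |t|) ^ (-(5 / 2) : ℝ) := by gcongr
  rw [norm_kernelFn (add_I_mul_ne_zero hc t), hre, mul_right_comm]
  gcongr

end Kernel

section TailIntegral

open MeasureTheory Set

variable {E : Type*} [NormedAddCommGroup E] {F : ℝ → E} {c D s : ℝ}

theorem integrable_add_abs_rpow (hc : 0 < c) (hs : s < -1) :
    Integrable fun t : ℝ => (c + |t|) ^ s := by
  have hone : Integrable fun t : ℝ => (1 + ‖t‖) ^ (-(-s)) :=
    integrable_one_add_norm (by rw [Module.finrank_self, Nat.cast_one]; linarith)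
  refine (hone.const_mul (min c 1 ^ s)).mono'
    (Measurable.aestronglyMeasurable (by fun_prop)) (Filter.Eventually.of_forall fun t => ?_)
  have hmin : 0 < min c 1 := lt_min hc one_pos
  have hle : min c 1 * (1 + |t|) ≤ c + |t| := by
    nlinarith [min_le_left c 1, min_le_right c 1, abs_nonneg t]
  rw [Real.norm_of_nonneg (by positivity), neg_neg, Real.norm_eq_abs,
    ← Real.mul_rpow hmin.le (by positivity)]
  exact Real.rpow_le_rpow_of_nonpos (by positivity) hle (by linarith)

theorem integrable_of_norm_le_add_abs_rpow (hc : 0 < c) (hs : s < -1) (hcont : Continuous F)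
    (hF : ∀ t, ‖F t‖ ≤ D * (c + |t|) ^ s) : Integrable F :=
  ((integrable_add_abs_rpow hc hs).const_mul D).mono' hcont.aestronglyMeasurable
    (Filter.Eventually.of_forall hF)

theorem integral_Ioi_add_rpow {T : ℝ} (hs : s < -1) (h : 0 < c + T) :
    ∫ t in Ioi T, (c + t) ^ s = -(c + T) ^ (s + 1) / (s + 1) := by
  have hshift := (measurePreserving_add_left volume c).setIntegral_preimage_emb
    (measurableEmbedding_addLeft c) (fun t : ℝ => t ^ s) (Ioi (c + T))
  rw [preimage_const_add_Ioi, add_sub_cancel_left] at hshift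
  rw [hshift, integral_Ioi_rpow_of_lt hs h]

theorem norm_integral_Ioi_le [NormedSpace ℝ E] {T : ℝ} (hc : 0 < c) (hs : s < -1) (hT : 0 ≤ T)
    (hF : ∀ t, ‖F t‖ ≤ D * (c + |t|) ^ s) :
    ‖∫ t in Ioi T, F t‖ ≤ D * (-(c + T) ^ (s + 1) / (s + 1)) := by
  have habs : ∫ t in Ioi T, (c + |t|) ^ s = ∫ t in Ioi T, (c + t) ^ s :=
    setIntegral_congr_fun measurableSet_Ioi fun t ht => by
      simp only [abs_of_pos (hT.trans_lt ht)]
  rw [← integral_Ioi_add_rpow hs (by linarith), ← habs, ← integral_const_mul]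
  exact norm_integral_le_of_norm_le ((integrable_add_abs_rpow hc hs).const_mul D).integrableOn
    (Filter.Eventually.of_forall hF)

theorem norm_integral_sub_intervalIntegral_le [NormedSpace ℝ E] {t₁ t₂ : ℝ} (hc : 0 < c)
    (hs : s < -1) (hcont : Continuous F) (hF : ∀ t, ‖F t‖ ≤ D * (c + |t|) ^ s) (ht₁ : 0 ≤ t₁)
    (ht₂ : 0 ≤ t₂) :
    ‖(∫ t, F t) - ∫ t in (-t₁)..t₂, F t‖
      ≤ D * (-(c + t₁) ^ (s + 1) / (s + 1)) + D * (-(c + t₂) ^ (s + 1) / (s + 1)) := by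
  have hint := integrable_of_norm_le_add_abs_rpow hc hs hcont hF
  have hsplit : (∫ t, F t) - ∫ t in (-t₁)..t₂, F t
      = (∫ t in Ioi t₁, F (-t)) + ∫ t in Ioi t₂, F t := by
    rw [← intervalIntegral.integral_Iic_add_Ioi (b := t₂) hint.integrableOn hint.integrableOn,
      ← intervalIntegral.integral_Iic_sub_Iic hint.integrableOn hint.integrableOn,
      integral_comp_neg_Ioi]
    abel
  rw [hsplit]
  exact norm_add_le_of_le
    (norm_integral_Ioi_le (F := fun t => F (-t)) hc hs ht₁ fun t => by simpa using hF (-t))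
    (norm_integral_Ioi_le hc hs ht₂ hF)

end TailIntegral

section Horodisc

open Complex Real

/-- The image under inversion of the half plane `Re u ≥ c`: a closed disc tangent to the imaginary
axis at `0`, with that point removed. In the coordinate `w` given by `τ = h/k + iw`, the Ford disc
at `h/k` is `horodisc (k ^ 2)`. -/
def horodisc (c : ℝ) : Set ℂ := {w | 0 < w.re ∧ c ≤ (w⁻¹).re}

variable {c : ℝ}

theorem mem_horodisc_iff {w : ℂ} : w ∈ horodisc c ↔ 0 < w.re ∧ c * normSq w ≤ w.re :=
  and_congr_right fun hw => by
    rw [inv_re, le_div_iff₀ (normSq_pos.2 (ne_zero_of_re_pos hw))]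

theorem mem_closedBall_ofReal_iff {ρ : ℝ} (hρ : 0 ≤ ρ) (w : ℂ) :
    w ∈ Metric.closedBall (ρ : ℂ) ρ ↔ normSq w ≤ 2 * ρ * w.re := by
  rw [Metric.mem_closedBall, dist_eq_norm, ← sq_le_sq₀ (norm_nonneg _) hρ, ← normSq_eq_norm_sq,
    normSq_sub, normSq_ofReal, conj_ofReal, re_mul_ofReal]
  constructor <;> intro h <;> linarith

theorem mem_ball_one_one_iff (w : ℂ) : w ∈ Metric.ball (1 : ℂ) 1 ↔ normSq w < 2 * w.re := by
  rw [Metric.mem_ball, dist_eq_norm, ← sq_lt_sq₀ (norm_nonneg _) zero_le_one, ← normSq_eq_norm_sq,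
    normSq_sub, map_one, map_one, mul_one]
  constructor <;> intro h <;> linarith

theorem convex_horodisc (hc : 0 < c) : Convex ℝ (horodisc c) := by
  have hdisc : horodisc c
      = {w | 0 < w.re} ∩ Metric.closedBall ((1 / (2 * c) : ℝ) : ℂ) (1 / (2 * c)) := by
    ext w
    rw [mem_horodisc_iff, Set.mem_inter_iff, mem_closedBall_ofReal_iff (by positivity),
      mul_one_div, div_mul_eq_mul_div, le_div_iff₀ (by positivity)]
    refine and_congr_right fun _ => ?_
    constructor <;> intro h <;> linarith
  rw [hdisc]
  exact (convex_halfSpace_re_gt 0).inter (convex_closedBall _ _)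

theorem horodisc_subset_ball (hc : 1 ≤ c) : horodisc c ⊆ Metric.ball (1 : ℂ) 1 := by
  intro w hw
  obtain ⟨hre, hle⟩ := mem_horodisc_iff.1 hw
  have hmul := le_mul_of_one_le_left (normSq_nonneg w) hc
  rw [mem_ball_one_one_iff]
  linarith

theorem inv_add_I_mul_mem_horodisc (hc : 0 < c) (t : ℝ) : ((c : ℂ) + I * t)⁻¹ ∈ horodisc c :=
  ⟨inv_re_pos (by rwa [add_I_mul_re]), by rw [inv_inv, add_I_mul_re]⟩

theorem norm_inv_add_I_mul_le (hc : 0 < c) {t T : ℝ} (hT : 0 < T) (h : T ≤ c + |t|) :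
    ‖((c : ℂ) + I * t)⁻¹‖ ≤ 2 / T := by
  rw [norm_inv, ← inv_div]
  exact inv_anti₀ (half_pos hT)
    ((div_le_div_of_nonneg_right h zero_le_two).trans (half_add_abs_le_norm_add_I_mul hc t))

end Horodisc

section FordArc

open Complex Real

/-- The function `√w exp(a/w + bw)`, which is `u^2` times the kernel at `u = 1/w`. -/
def segmentFn (a b : ℝ) (w : ℂ) : ℂ := Complex.sqrt w * cexp (a * w⁻¹ + b * w)

theorem kernelFn_eq_segmentFn (a b : ℝ) (u : ℂ) :
    kernelFn a b u = segmentFn a b u⁻¹ * (u⁻¹) ^ 2 := by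
  rw [kernelFn, segmentFn, inv_inv]
  ring

theorem exists_primitive_segmentFn (a b : ℝ) :
    ∃ M : ℂ → ℂ, ∀ w ∈ Metric.ball (1 : ℂ) 1, HasDerivAt M (segmentFn a b w) w := by
  refine DifferentiableOn.isExactOn_ball fun w hw => DifferentiableAt.differentiableWithinAt ?_
  have hre : 0 < w.re := by linarith [(mem_ball_one_one_iff w).1 hw, normSq_nonneg w]
  have hinv : DifferentiableAt ℂ (fun w : ℂ => w⁻¹) w :=
    differentiableAt_inv (ne_zero_of_re_pos hre)
  exact (differentiableAt_sqrt (Or.inl hre)).mul (by fun_prop)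

variable {a b c : ℝ} {M : ℂ → ℂ}

theorem hasDerivAt_comp_inv_add_I_mul (hc : 1 ≤ c)
    (hM : ∀ w ∈ Metric.ball (1 : ℂ) 1, HasDerivAt M (segmentFn a b w) w) (t : ℝ) :
    HasDerivAt (fun t : ℝ => I * M ((c : ℂ) + I * t)⁻¹) (kernelFn a b (c + I * t)) t := by
  have hc0 : 0 < c := zero_lt_one.trans_le hc
  have hline : HasDerivAt (fun t : ℝ => (c : ℂ) + I * t) I t := by
    simpa using ((Complex.ofRealCLM.hasDerivAt (x := t)).const_mul I).const_add (c : ℂ)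
  have hball := horodisc_subset_ball hc (inv_add_I_mul_mem_horodisc hc0 t)
  have hinv := hline.fun_inv (add_I_mul_ne_zero hc0 t)
  refine (((hM _ hball).comp t hinv).const_mul I).congr_deriv ?_
  rw [kernelFn_eq_segmentFn, div_eq_mul_inv, inv_pow]
  linear_combination (-segmentFn a b ((c : ℂ) + I * t)⁻¹ * (((c : ℂ) + I * t) ^ 2)⁻¹) * I_sq

theorem intervalIntegral_kernelFn (hc : 1 ≤ c)
    (hM : ∀ w ∈ Metric.ball (1 : ℂ) 1, HasDerivAt M (segmentFn a b w) w) (t₁ t₂ : ℝ) :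
    ∫ t in t₁..t₂, kernelFn a b (c + I * t)
      = I * (M ((c : ℂ) + I * t₂)⁻¹ - M ((c : ℂ) + I * t₁)⁻¹) := by
  rw [intervalIntegral.integral_eq_sub_of_hasDerivAt
    (fun t _ => hasDerivAt_comp_inv_add_I_mul hc hM t)
    ((continuous_kernelFn (zero_lt_one.trans_le hc) a b).intervalIntegrable _ _), mul_sub]

theorem norm_kernelIntegral_sub_intervalIntegral_le (hc : 0 < c) (hb : 0 ≤ b) {t₁ t₂ T : ℝ}
    (hT : 0 < T) (ht₁ : 0 ≤ t₁) (hTt₁ : T ≤ c + t₁) (ht₂ : 0 ≤ t₂) (hTt₂ : T ≤ c + t₂) :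
    ‖kernelIntegral c a b - ∫ t in (-t₁)..t₂, kernelFn a b (c + I * t)‖
      ≤ 11 * rexp (a * c + b / c) * T ^ (-(3 / 2) : ℝ) := by
  have htail := norm_integral_sub_intervalIntegral_le hc (by norm_num : (-(5 / 2) : ℝ) < -1)
    (continuous_kernelFn hc a b) (norm_kernelFn_le hc hb) ht₁ ht₂
  rw [show (-(5 / 2) + 1 : ℝ) = -(3 / 2) by norm_num] at htail
  have hpow {t : ℝ} (h : T ≤ c + t) : (c + t) ^ (-(3 / 2) : ℝ) ≤ T ^ (-(3 / 2) : ℝ) :=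
    Real.rpow_le_rpow_of_nonpos hT h (by norm_num)
  have hexp := Real.exp_pos (a * c + b / c)
  rw [kernelIntegral]
  nlinarith [mul_le_mul_of_nonneg_left (hpow hTt₁) hexp.le,
    mul_le_mul_of_nonneg_left (hpow hTt₂) hexp.le,
    mul_pos hexp (Real.rpow_pos_of_pos hT (-(3 / 2)))]

theorem mul_sqrt_eq_rpow {x : ℝ} (hx : 0 ≤ x) : x * √x = x ^ (3 / 2 : ℝ) := by
  rw [Real.sqrt_eq_rpow, ← Real.rpow_one_add' hx (by norm_num)]
  norm_num

theorem two_div_mul_sqrt_le {T : ℝ} (hT : 0 < T) : 2 / T * √(2 / T) ≤ 4 * T ^ (-(3 / 2) : ℝ) := by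
  have htwo : (2 : ℝ) ^ (3 / 2 : ℝ) ≤ 4 :=
    (Real.rpow_le_rpow_of_exponent_le one_le_two (by norm_num : (3 / 2 : ℝ) ≤ 2)).trans
      (by norm_num)
  rw [mul_sqrt_eq_rpow (by positivity), Real.div_rpow zero_le_two hT.le, div_eq_mul_inv,
    ← Real.rpow_neg hT.le]
  gcongr

variable {Φ B : ℂ → ℂ} {A : ℂ} {x D T t₁ t₂ : ℝ}

theorem norm_sub_sub_primitive_le (hΦ : ∀ τ : ℂ, 0 < τ.im → HasDerivAt Φ (B τ) τ)
    (hM : ∀ w ∈ Metric.ball (1 : ℂ) 1, HasDerivAt M (segmentFn a b w) w) (hc : 1 ≤ c) (hD : 0 ≤ D)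
    (hB : ∀ w ∈ horodisc c, ‖B (x + I * w) - A * segmentFn a b w‖ ≤ D * √‖w‖) {w₁ w₂ : ℂ} {δ : ℝ}
    (hw₁ : w₁ ∈ horodisc c) (hδ₁ : ‖w₁‖ ≤ δ) (hw₂ : w₂ ∈ horodisc c) (hδ₂ : ‖w₂‖ ≤ δ) :
    ‖Φ (x + I * w₂) - Φ (x + I * w₁) - A * (I * (M w₂ - M w₁))‖ ≤ 2 * D * (δ * √δ) := by
  have hderiv (w : ℂ) (hw : w ∈ horodisc c) :
      HasDerivAt (fun w => Φ (x + I * w) - A * I * M w)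
        (I * (B (x + I * w) - A * segmentFn a b w)) w := by
    have him : 0 < ((x : ℂ) + I * w).im := by simpa using hw.1
    have hline : HasDerivAt (fun w : ℂ => (x : ℂ) + I * w) I w := by
      simpa using ((hasDerivAt_id w).const_mul I).const_add (x : ℂ)
    refine (((hΦ _ him).comp w hline).sub
      ((hM w (horodisc_subset_ball hc hw)).const_mul (A * I))).congr_deriv ?_
    ring
  have hconv := (convex_horodisc (zero_lt_one.trans_le hc)).inter (convex_closedBall (0 : ℂ) δ)
  have hmean := hconv.norm_image_sub_le_of_norm_hasDerivWithin_le
    (fun w hw => (hderiv w hw.1).hasDerivWithinAt) (C := D * √δ) (fun w hw => by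
      rw [norm_mul, norm_I, one_mul]
      have hwδ := mem_closedBall_zero_iff.1 hw.2
      exact (hB w hw.1).trans (by gcongr))
    ⟨hw₁, mem_closedBall_zero_iff.2 hδ₁⟩ ⟨hw₂, mem_closedBall_zero_iff.2 hδ₂⟩
  have hdist : ‖w₂ - w₁‖ ≤ 2 * δ := (norm_sub_le_of_le hδ₂ hδ₁).trans_eq (two_mul δ).symm
  calc ‖Φ (x + I * w₂) - Φ (x + I * w₁) - A * (I * (M w₂ - M w₁))‖
      = ‖Φ (x + I * w₂) - A * I * M w₂ - (Φ (x + I * w₁) - A * I * M w₁)‖ := by ring_nf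
    _ ≤ D * √δ * (2 * δ) := hmean.trans (by gcongr)
    _ = 2 * D * (δ * √δ) := by ring

/-- The integral over an arc of the horodisc is compared with the integral over the chord, where the
main term dominates; there the main term can be integrated over the whole circle instead. -/
theorem norm_arc_sub_kernelIntegral_le (hΦ : ∀ τ : ℂ, 0 < τ.im → HasDerivAt Φ (B τ) τ)
    (hc : 1 ≤ c) (hb : 0 ≤ b) (hA : ‖A‖ ≤ D)
    (hB : ∀ w ∈ horodisc c, ‖B (x + I * w) - A * segmentFn a b w‖ ≤ D * √‖w‖) (hT : 0 < T)
    (ht₁ : 0 ≤ t₁) (hTt₁ : T ≤ c + t₁) (ht₂ : 0 ≤ t₂) (hTt₂ : T ≤ c + t₂) :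
    ‖Φ (x + I * ((c : ℂ) + I * t₂)⁻¹) - Φ (x + I * ((c : ℂ) + I * (-t₁ : ℝ))⁻¹)
        - A * kernelIntegral c a b‖
      ≤ D * (8 + 11 * rexp (a * c + b / c)) * T ^ (-(3 / 2) : ℝ) := by
  have hc0 : 0 < c := zero_lt_one.trans_le hc
  have hD : 0 ≤ D := (norm_nonneg A).trans hA
  obtain ⟨M, hM⟩ := exists_primitive_segmentFn a b
  have hchord := norm_sub_sub_primitive_le hΦ hM hc hD hB
    (inv_add_I_mul_mem_horodisc hc0 (-t₁))
    (norm_inv_add_I_mul_le hc0 hT (by rwa [abs_neg, abs_of_nonneg ht₁]))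
    (inv_add_I_mul_mem_horodisc hc0 t₂)
    (norm_inv_add_I_mul_le hc0 hT (by rwa [abs_of_nonneg ht₂]))
  rw [← intervalIntegral_kernelFn hc hM] at hchord
  have htail : ‖A * (kernelIntegral c a b - ∫ t in (-t₁)..t₂, kernelFn a b (c + I * t))‖
      ≤ D * (11 * rexp (a * c + b / c) * T ^ (-(3 / 2) : ℝ)) :=
    norm_mul_le_of_le hA (norm_kernelIntegral_sub_intervalIntegral_le hc0 hb hT ht₁ hTt₁ ht₂ hTt₂)
  have hδ := mul_le_mul_of_nonneg_left (two_div_mul_sqrt_le hT) (mul_nonneg zero_le_two hD)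
  refine ((norm_sub_le_of_le hchord htail).trans' (le_of_eq (congrArg norm ?_))).trans ?_
  · ring
  · linarith

end FordArc

section CircleMethod

open Complex Real Filter Topology

/-- The input of the circle method for a function `B` on the upper half plane: in the Ford disc at
each reduced fraction `h/k`, with the coordinate `w` given by `τ = h/k + iw`, the function `B` is
`A h k √w exp(α k / (k² w) + βw)` up to `K √k √|w|`, with uniform control of `A` and `α`. -/
structure IsFordApprox (B : ℂ → ℂ) (A : ℕ → ℕ → ℂ) (α : ℕ → ℝ) (β K : ℝ) : Prop where
  nonneg : 0 ≤ β
  exponent_le : ∀ k, α k ≤ K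
  norm_le : ∀ h k, ‖A h k‖ ≤ K * √k
  error_le : ∀ h k : ℕ, 0 < k → Nat.Coprime h k → ∀ w ∈ horodisc (k ^ 2),
    ‖B (h / k + I * w) - A h k * segmentFn (α k / k ^ 2) β w‖ ≤ K * (√k * √‖w‖)

theorem card_reduced_le (k : ℕ) : (reduced k).card ≤ k :=
  (Finset.card_filter_le _ _).trans_eq (Finset.card_range k)

theorem norm_sum_reduced_le {f : ℕ → ℂ} {C : ℝ} {k : ℕ} (hC : 0 ≤ C)
    (hf : ∀ h ∈ reduced k, ‖f h‖ ≤ C) : ‖∑ h ∈ reduced k, f h‖ ≤ k * C := by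
  refine (norm_sum_le_of_le _ hf).trans ?_
  rw [Finset.sum_const, nsmul_eq_mul]
  gcongr
  exact card_reduced_le k

variable {B Φ : ℂ → ℂ} {A : ℕ → ℕ → ℂ} {α : ℕ → ℝ} {β K : ℝ}

theorem IsFordApprox.const_nonneg (hB : IsFordApprox B A α β K) : 0 ≤ K := by
  simpa using (norm_nonneg _).trans (hB.norm_le 0 1)

theorem IsFordApprox.exp_le (hB : IsFordApprox B A α β K) {k : ℕ} (hk : 0 < k) :
    rexp (α k / k ^ 2 * k ^ 2 + β / k ^ 2) ≤ rexp (K + β) := by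
  have hone : (1 : ℝ) ≤ k := by exact_mod_cast hk
  rw [Real.exp_le_exp, div_mul_cancel₀ _ (by positivity)]
  exact add_le_add (hB.exponent_le k) (div_le_self hB.nonneg (one_le_pow₀ hone))

theorem IsFordApprox.norm_fordPoint_sub_le (hB : IsFordApprox B A α β K)
    (hΦ : ∀ τ : ℂ, 0 < τ.im → HasDerivAt Φ (B τ) τ) {h k N k₁ k₂ : ℕ} (hk : 0 < k)
    (hc : Nat.Coprime h k) (hN : 1 ≤ N) (hk₁ : N < k₁ + k) (hk₂ : N < k₂ + k) :
    ‖Φ (fordPoint h k k₂) - Φ (fordPoint h k (-k₁))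
        - A h k * kernelIntegral (k ^ 2) (α k / k ^ 2) β‖
      ≤ K * √k * (8 + 11 * rexp (K + β)) * ((k : ℝ) * N) ^ (-(3 / 2) : ℝ) := by
  have hone : (1 : ℝ) ≤ k := by exact_mod_cast hk
  have hNpos : (0 : ℝ) < N := by exact_mod_cast hN
  have hK := hB.const_nonneg
  have hheight {j : ℕ} (hj : N < j + k) : (k : ℝ) * N ≤ (k : ℝ) ^ 2 + k * j := by
    have hcast : (N : ℝ) ≤ j + k := by exact_mod_cast hj.le
    nlinarith
  have harc := norm_arc_sub_kernelIntegral_le hΦ (one_le_pow₀ hone) hB.nonneg (hB.norm_le h k)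
    (x := (h : ℝ) / k) (a := α k / k ^ 2) (fun w hw => by
      rw [mul_assoc K, ofReal_div, ofReal_natCast, ofReal_natCast]
      exact hB.error_le h k hk hc w hw)
    (mul_pos (zero_lt_one.trans_le hone) hNpos) (by positivity) (hheight hk₁) (by positivity)
    (hheight hk₂)
  have hpoint (j : ℤ) : fordPoint h k j
      = ((h / k : ℝ) : ℂ) + I * (((k ^ 2 : ℝ) : ℂ) + I * (k * j : ℝ))⁻¹ := by
    rw [fordPoint]
    push_cast
    rfl
  rw [hpoint, hpoint]
  push_cast at harc ⊢
  rw [mul_neg]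
  have hexp := hB.exp_le hk
  exact harc.trans (by gcongr)

theorem IsFordApprox.norm_sum_fordPoint_sub_le (hB : IsFordApprox B A α β K)
    (hΦ : ∀ τ : ℂ, 0 < τ.im → HasDerivAt Φ (B τ) τ) {k N : ℕ} (hk : 0 < k) (hkN : k ≤ N) :
    ‖(∑ h ∈ reduced k, A h k) * kernelIntegral (k ^ 2) (α k / k ^ 2) β
        - ∑ h ∈ reduced k, (Φ (fordPoint h k (fareyNeighbour N h k (-1)))
          - Φ (fordPoint h k (-(fareyNeighbour N h k 1 : ℤ))))‖
      ≤ K * (8 + 11 * rexp (K + β)) * (N : ℝ) ^ (-(3 / 2) : ℝ) := by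
  have hkpos : (0 : ℝ) < k := by exact_mod_cast hk
  have hK := hB.const_nonneg
  rw [Finset.sum_mul, ← Finset.sum_sub_distrib]
  refine (norm_sum_reduced_le (by positivity) fun h hh => ?_).trans_eq
    (b := k * (K * √k * (8 + 11 * rexp (K + β)) * ((k : ℝ) * N) ^ (-(3 / 2) : ℝ))) ?_
  · have hc : Nat.Coprime h k := (Finset.mem_filter.1 hh).2
    rw [norm_sub_rev]
    exact hB.norm_fordPoint_sub_le hΦ hk hc (hk.trans_le hkN)
      (fareyNeighbour_spec hk hkN hc 1).1 (fareyNeighbour_spec hk hkN hc (-1)).1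
  · have hcancel : (k : ℝ) * √k * (k : ℝ) ^ (-(3 / 2) : ℝ) = 1 := by
      rw [mul_sqrt_eq_rpow hkpos.le, ← Real.rpow_add hkpos, add_neg_cancel, Real.rpow_zero]
    rw [Real.mul_rpow hkpos.le N.cast_nonneg]
    linear_combination K * (8 + 11 * rexp (K + β)) * (N : ℝ) ^ (-(3 / 2) : ℝ) * hcancel

theorem IsFordApprox.norm_sum_kernelIntegral_sub_le (hB : IsFordApprox B A α β K) {c : ℂ}
    (hΦ : ∀ τ : ℂ, 0 < τ.im → HasDerivAt Φ (B τ) τ)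
    (hper : ∀ τ : ℂ, 0 < τ.im → Φ (τ + 1) = Φ τ + c) {N : ℕ} (hN : 1 ≤ N) :
    ‖(∑ k ∈ Finset.Icc 1 N, (∑ h ∈ reduced k, A h k) * kernelIntegral (k ^ 2) (α k / k ^ 2) β) - c‖
      ≤ K * (8 + 11 * rexp (K + β)) * (N : ℝ) ^ (-(1 / 2) : ℝ) := by
  have hNpos : (0 : ℝ) < N := by exact_mod_cast hN
  rw [← sum_fordPoint_sub hper hN, ← Finset.sum_sub_distrib]
  refine (norm_sum_le_of_le _ fun k hk => hB.norm_sum_fordPoint_sub_le hΦ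
    (Finset.mem_Icc.1 hk).1 (Finset.mem_Icc.1 hk).2).trans_eq ?_
  rw [Finset.sum_const, nsmul_eq_mul, Nat.card_Icc, Nat.add_sub_cancel,
    show (-(1 / 2) : ℝ) = 1 + -(3 / 2) by norm_num, Real.rpow_add hNpos, Real.rpow_one]
  ring

theorem tendsto_sum_kernelIntegral {a : PowerSeries ℂ} {g : ℂ → ℂ} (ha : IsSumOnDisc a g) {n : ℕ}
    (hB : IsFordApprox (fun τ => g (cexp (2 * π * I * τ)) * cexp (-(2 * π * I * n * τ))) A α β K) :
    Tendsto (fun N : ℕ => ∑ k ∈ Finset.Icc 1 N,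
        (∑ h ∈ reduced k, A h k) * kernelIntegral (k ^ 2) (α k / k ^ 2) β)
      atTop (𝓝 (PowerSeries.coeff n a)) := by
  obtain ⟨Φ, hΦ, hper⟩ := ha.exists_primitive n
  have hlim : Tendsto (fun N : ℕ => K * (8 + 11 * rexp (K + β)) * (N : ℝ) ^ (-(1 / 2) : ℝ))
      atTop (𝓝 0) := by
    simpa using ((tendsto_rpow_neg_atTop one_half_pos).comp
      tendsto_natCast_atTop_atTop).const_mul (K * (8 + 11 * rexp (K + β)))
  rw [tendsto_iff_norm_sub_tendsto_zero]
  refine squeeze_zero' (Eventually.of_forall fun N => norm_nonneg _) ?_ hlim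
  filter_upwards [eventually_ge_atTop 1] with N hN
  exact hB.norm_sum_kernelIntegral_sub_le hΦ (fun τ _ => hper τ) hN

end CircleMethod

section Laplace

open Complex Real MeasureTheory Set Filter Topology FourierTransform

variable {p c : ℝ}

theorem integrableOn_rpow_mul_cexp (hp : -1 < p) {u : ℂ} (hu : 0 < u.re) :
    IntegrableOn (fun x : ℝ => ((x ^ p : ℝ) : ℂ) * cexp (-(u * x))) (Ioi 0) := by
  refine Integrable.mono' (integrableOn_rpow_mul_exp_neg_mul_rpow hp one_pos hu)
    (Measurable.aestronglyMeasurable (by fun_prop))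
    ((ae_restrict_iff' measurableSet_Ioi).2 (Eventually.of_forall fun x (hx : 0 < x) => ?_))
  rw [norm_mul, Complex.norm_real, Real.norm_of_nonneg (by positivity), Complex.norm_exp,
    Real.rpow_one, neg_re, re_mul_ofReal, neg_mul]

theorem differentiableOn_laplace_rpow (hp : -1 < p) :
    DifferentiableOn ℂ (fun u : ℂ => ∫ x in Ioi (0 : ℝ), ((x ^ p : ℝ) : ℂ) * cexp (-(u * x)))
      {u | 0 < u.re} := by
  intro u (hu : 0 < u.re)
  refine DifferentiableAt.differentiableWithinAt (HasDerivAt.differentiableAt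
    (hasDerivAt_integral_of_dominated_loc_of_deriv_le (μ := volume.restrict (Ioi 0))
      (s := {z : ℂ | u.re / 2 < z.re})
      (F := fun z x => ((x ^ p : ℝ) : ℂ) * cexp (-(z * x)))
      (F' := fun z x => ((x ^ p : ℝ) : ℂ) * (cexp (-(z * x)) * (-x)))
      (bound := fun x => x ^ (p + 1) * rexp (-(u.re / 2) * x ^ (1 : ℝ)))
      ((isOpen_lt continuous_const continuous_re).mem_nhds (half_lt_self hu))
      (Eventually.of_forall fun z => Measurable.aestronglyMeasurable (by fun_prop))
      (integrableOn_rpow_mul_cexp hp hu) (Measurable.aestronglyMeasurable (by fun_prop))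
      ?_ (integrableOn_rpow_mul_exp_neg_mul_rpow (by linarith) one_pos (half_pos hu)) ?_).2)
  · refine (ae_restrict_iff' measurableSet_Ioi).2
      (Eventually.of_forall fun x (hx : 0 < x) z (hz : u.re / 2 < z.re) => ?_)
    have hexp : rexp (-(z * x)).re ≤ rexp (-(u.re / 2) * x) := by
      rw [Real.exp_le_exp, neg_re, re_mul_ofReal, neg_mul, neg_le_neg_iff]
      gcongr
    rw [norm_mul, norm_mul, norm_neg, Complex.norm_real, Complex.norm_real,
      Real.norm_of_nonneg (by positivity), Real.norm_of_nonneg hx.le, Complex.norm_exp,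
      Real.rpow_one, Real.rpow_add hx, Real.rpow_one, mul_assoc, mul_comm x]
    gcongr
  · refine Eventually.of_forall fun x z _ => HasDerivAt.const_mul _ ?_
    simpa using ((hasDerivAt_id z).mul_const (x : ℂ)).neg.cexp

theorem integral_rpow_mul_cexp_ofReal (hp : -1 < p) {r : ℝ} (hr : 0 < r) :
    ∫ x in Ioi (0 : ℝ), ((x ^ p : ℝ) : ℂ) * cexp (-((r : ℂ) * x))
      = ((r : ℂ)⁻¹) ^ ((p : ℂ) + 1) * Real.Gamma (p + 1) := by
  have hre : 0 < ((p : ℂ) + 1).re := by simpa using by linarith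
  rw [← one_div, ← Complex.Gamma_ofReal, ofReal_add, ofReal_one,
    ← Complex.integral_cpow_mul_exp_neg_mul_Ioi hre hr]
  refine setIntegral_congr_fun measurableSet_Ioi fun x (hx : 0 < x) => ?_
  rw [add_sub_cancel_right, ofReal_cpow hx.le]

theorem frequently_ofReal_nhdsNE_one {P : ℂ → Prop} (hP : ∀ r : ℝ, 0 < r → P r) :
    ∃ᶠ z in 𝓝[≠] (1 : ℂ), P z := by
  have hcoe : Tendsto (fun r : ℝ => (r : ℂ)) (𝓝[≠] 1) (𝓝[≠] 1) := by
    simpa using continuous_ofReal.continuousAt.continuousWithinAt.tendsto_nhdsWithin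
      (f := fun r : ℝ => (r : ℂ)) (s := {1}ᶜ) (t := {1}ᶜ) (x := 1) fun r hr => by simpa using hr
  refine hcoe.frequently (Eventually.frequently ?_)
  filter_upwards [nhdsWithin_le_nhds (lt_mem_nhds one_pos)] with r hr using hP r hr

theorem integral_rpow_mul_cexp (hp : -1 < p) {u : ℂ} (hu : 0 < u.re) :
    ∫ x in Ioi (0 : ℝ), ((x ^ p : ℝ) : ℂ) * cexp (-(u * x))
      = (u⁻¹) ^ ((p : ℂ) + 1) * Real.Gamma (p + 1) := by
  have hopen : IsOpen {u : ℂ | 0 < u.re} := isOpen_lt continuous_const continuous_re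
  have hconn : IsPreconnected {u : ℂ | 0 < u.re} := (convex_halfSpace_re_gt 0).isPreconnected
  have hdiff : DifferentiableOn ℂ (fun u : ℂ => (u⁻¹) ^ ((p : ℂ) + 1) * Real.Gamma (p + 1))
      {u | 0 < u.re} := fun z hz =>
    (((differentiableAt_inv (ne_zero_of_re_pos hz)).cpow_const
      (Or.inl (inv_re_pos hz))).mul_const _).differentiableWithinAt
  exact ((differentiableOn_laplace_rpow hp).analyticOnNhd hopen)
    |>.eqOn_of_preconnected_of_frequently_eq (hdiff.analyticOnNhd hopen) hconn
      (z₀ := 1) (by simp)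
      (frequently_ofReal_nhdsNE_one fun r hr => integral_rpow_mul_cexp_ofReal hp hr) hu

/-- The density `x^p e^{-cx}` on `x > 0`, whose Laplace transform is a power of `u⁻¹`; it is
extended by `0` so that its Fourier transform is that Laplace transform on `Re u = c`. -/
def gammaDensity (c p : ℝ) : ℝ → ℂ :=
  (Ioi (0 : ℝ)).indicator fun x : ℝ => ((x ^ p : ℝ) : ℂ) * cexp (-((c : ℂ) * x))

theorem gammaDensity_of_pos {x : ℝ} (hx : 0 < x) :
    gammaDensity c p x = ((x ^ p : ℝ) : ℂ) * cexp (-((c : ℂ) * x)) :=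
  indicator_of_mem (mem_Ioi.2 hx) _

theorem integrable_gammaDensity (hc : 0 < c) (hp : -1 < p) : Integrable (gammaDensity c p) :=
  (integrable_indicator_iff measurableSet_Ioi).2 (integrableOn_rpow_mul_cexp hp (by simpa))

theorem continuousAt_gammaDensity {x : ℝ} (hx : 0 < x) : ContinuousAt (gammaDensity c p) x := by
  have hpow : ContinuousAt (fun x : ℝ => ((x ^ p : ℝ) : ℂ)) x :=
    continuous_ofReal.continuousAt.comp (Real.continuousAt_rpow_const x p (Or.inl hx.ne'))
  have hcont : ContinuousAt (fun x : ℝ => ((x ^ p : ℝ) : ℂ) * cexp (-((c : ℂ) * x))) x :=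
    hpow.mul (by fun_prop)
  exact hcont.congr (eventually_of_mem (lt_mem_nhds hx) fun y hy => (gammaDensity_of_pos hy).symm)

theorem fourier_gammaDensity (hc : 0 < c) (hp : -1 < p) (ξ : ℝ) :
    𝓕 (gammaDensity c p) ξ
      = (((c : ℂ) + I * (2 * π * ξ : ℝ))⁻¹) ^ ((p : ℂ) + 1) * Real.Gamma (p + 1) := by
  rw [Real.fourier_real_eq_integral_exp_smul,
    ← integral_rpow_mul_cexp hp (by rwa [add_I_mul_re]), ← integral_indicator measurableSet_Ioi]
  congr 1 with x
  by_cases hx : x ∈ Ioi (0 : ℝ)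
  · rw [gammaDensity_of_pos hx, indicator_of_mem hx, smul_eq_mul, mul_left_comm, ← Complex.exp_add]
    congr 2
    push_cast
    ring
  · rw [gammaDensity, indicator_of_notMem hx, indicator_of_notMem hx, smul_zero]

theorem norm_inv_cpow_add_one (u : ℂ) :
    ‖(u⁻¹) ^ ((p : ℂ) + 1)‖ = ‖u‖ ^ (-(p + 1)) := by
  rw [← ofReal_one, ← ofReal_add, norm_cpow_real, norm_inv, Real.inv_rpow (norm_nonneg u),
    Real.rpow_neg (norm_nonneg u)]

theorem integrable_inv_cpow (hc : 0 < c) (hp : 0 < p) :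
    Integrable fun t : ℝ => (((c : ℂ) + I * t)⁻¹) ^ ((p : ℂ) + 1) := by
  have hcont : Continuous fun t : ℝ => (((c : ℂ) + I * t)⁻¹) ^ ((p : ℂ) + 1) :=
    (continuous_inv_add_I_mul hc).cpow continuous_const fun t =>
      Or.inl (inv_re_pos (by rwa [add_I_mul_re]))
  refine integrable_of_norm_le_add_abs_rpow (D := (2⁻¹ : ℝ) ^ (-(p + 1))) hc
    (by linarith : -(p + 1) < -1) hcont fun t => ?_
  rw [norm_inv_cpow_add_one, ← Real.mul_rpow (by norm_num) (by positivity),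
    ← div_eq_inv_mul]
  exact Real.rpow_le_rpow_of_nonpos (by positivity) (half_add_abs_le_norm_add_I_mul hc t)
    (by linarith)

theorem integral_cexp_smul_comp_two_pi_mul (a : ℝ) (G : ℝ → ℂ) :
    ∫ ξ : ℝ, cexp ((2 * π * inner ℝ ξ a : ℝ) * I) • G (2 * π * ξ)
      = (2 * π : ℝ)⁻¹ * ∫ t : ℝ, cexp (I * a * t) * G t := by
  rw [← real_smul, ← abs_of_pos (inv_pos.2 Real.two_pi_pos),
    ← Measure.integral_comp_mul_left (fun t : ℝ => cexp (I * a * t) * G t) (2 * π)]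
  congr 1 with ξ
  have harg : ((2 * π * inner ℝ ξ a : ℝ) : ℂ) * I = I * a * (2 * π * ξ : ℝ) := by
    rw [Real.inner_apply]
    push_cast
    ring
  rw [harg, smul_eq_mul]

/-- Fourier inversion for `gammaDensity`. -/
theorem integral_cexp_mul_inv_cpow {a : ℝ} (hc : 0 < c) (hp : 0 < p) (ha : 0 < a) :
    ∫ t : ℝ, cexp (a * (c + I * t)) * (((c : ℂ) + I * t)⁻¹) ^ ((p : ℂ) + 1)
      = ((2 * π * a ^ p / Real.Gamma (p + 1) : ℝ) : ℂ) := by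
  set G : ℝ → ℂ := fun t => (((c : ℂ) + I * t)⁻¹) ^ ((p : ℂ) + 1)
  have hΓ : (Real.Gamma (p + 1) : ℂ) ≠ 0 := by
    exact_mod_cast (Real.Gamma_pos_of_pos (by linarith)).ne'
  have hpi : 0 < 2 * π := Real.two_pi_pos
  have hp' : -1 < p := by linarith
  have hF : 𝓕 (gammaDensity c p) = fun ξ => G (2 * π * ξ) * Real.Gamma (p + 1) :=
    funext fun ξ => fourier_gammaDensity hc hp' ξ
  have hFint : Integrable (𝓕 (gammaDensity c p)) := by
    rw [hF]
    exact ((integrable_inv_cpow hc hp).comp_mul_left' hpi.ne').mul_const _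
  have hinv := (integrable_gammaDensity hc hp').fourierInv_fourier_eq hFint
    (continuousAt_gammaDensity ha)
  rw [Real.fourierInv_eq', hF, integral_cexp_smul_comp_two_pi_mul a
    fun t => G t * Real.Gamma (p + 1), gammaDensity_of_pos ha] at hinv
  simp only [← mul_assoc, integral_mul_const] at hinv
  have hfactor (t : ℝ) : cexp (a * (c + I * t)) = cexp (a * c) * cexp (I * a * t) := by
    rw [← Complex.exp_add]
    ring_nf
  simp only [hfactor, mul_assoc (cexp (a * c))]
  rw [integral_const_mul]
  have hpi' : (π : ℂ) ≠ 0 := ofReal_ne_zero.2 Real.pi_ne_zero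
  have hexp : cexp (a * c) * cexp (-(a * c)) = 1 := by
    rw [← Complex.exp_add, add_neg_cancel, Complex.exp_zero]
  push_cast at hinv ⊢
  change _ * ∫ t : ℝ, cexp (I * a * t) * G t = _
  rw [eq_div_iff hΓ]
  field_simp at hinv
  linear_combination cexp (a * c) * hinv + 2 * π * (a ^ p : ℝ) * hexp

end Laplace

section Bessel

open Complex Real MeasureTheory Filter
open scoped Nat

variable {a b c : ℝ}

theorem inv_cpow_add_five_halves {u : ℂ} (hu : u ≠ 0) (m : ℕ) :
    (u⁻¹) ^ ((((m : ℝ) + 3 / 2 : ℝ) : ℂ) + 1) = Complex.sqrt u⁻¹ * (u⁻¹) ^ (m + 2) := by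
  rw [Complex.sqrt, ← Complex.cpow_natCast, ← Complex.cpow_add _ _ (inv_ne_zero hu)]
  congr 1
  push_cast
  ring

theorem integral_kernelFn_mul_inv_pow (hc : 0 < c) (ha : 0 < a) (m : ℕ) :
    ∫ t : ℝ, kernelFn a 0 (c + I * t) * ((c + I * t : ℂ)⁻¹) ^ m
      = ((2 * π * a ^ ((m : ℝ) + 3 / 2) / Real.Gamma (m + 5 / 2) : ℝ) : ℂ) := by
  have hp : 0 < (m : ℝ) + 3 / 2 := by positivity
  rw [show (m : ℝ) + 5 / 2 = m + 3 / 2 + 1 by ring, ← integral_cexp_mul_inv_cpow hc hp ha]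
  congr 1 with t
  rw [inv_cpow_add_five_halves (add_I_mul_ne_zero hc t), kernelFn, ofReal_zero, zero_mul, add_zero]
  ring

theorem norm_inv_add_I_mul_pow_le (hc : 0 < c) (t : ℝ) (m : ℕ) :
    ‖((c + I * t : ℂ)⁻¹) ^ m‖ ≤ (c⁻¹) ^ m := by
  have hre := Complex.re_le_norm ((c : ℂ) + I * t)
  rw [add_I_mul_re] at hre
  rw [norm_pow, norm_inv]
  gcongr

theorem hasSum_kernelFn (a b : ℝ) (u : ℂ) :
    HasSum (fun m : ℕ => ((b ^ m / m ! : ℝ) : ℂ) * (kernelFn a 0 u * (u⁻¹) ^ m))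
      (kernelFn a b u) := by
  have hexp := (NormedSpace.expSeries_div_hasSum_exp ((b : ℂ) * u⁻¹)).mul_left (kernelFn a 0 u)
  have hsplit : kernelFn a b u = kernelFn a 0 u * cexp ((b : ℂ) * u⁻¹) := by
    rw [kernelFn, kernelFn, Complex.exp_add, ofReal_zero, zero_mul, add_zero, mul_assoc _ (cexp _)]
  rw [hsplit, Complex.exp_eq_exp_ℂ]
  refine hexp.congr_fun fun m => ?_
  push_cast
  ring

theorem hasSum_kernelIntegral (hc : 0 < c) (ha : 0 < a) (hb : 0 ≤ b) :
    HasSum (fun m : ℕ => ((b ^ m / m ! * (2 * π * a ^ ((m : ℝ) + 3 / 2)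
      / Real.Gamma (m + 5 / 2)) : ℝ) : ℂ)) (kernelIntegral c a b) := by
  have hint : Integrable fun t : ℝ => kernelFn a 0 (c + I * t) :=
    integrable_of_norm_le_add_abs_rpow hc (by norm_num : (-(5 / 2) : ℝ) < -1)
      (continuous_kernelFn hc a 0) (norm_kernelFn_le hc le_rfl)
  set F : ℕ → ℝ → ℂ := fun m t =>
    ((b ^ m / m ! : ℝ) : ℂ) * (kernelFn a 0 (c + I * t) * ((c + I * t : ℂ)⁻¹) ^ m) with hF
  have hle (m : ℕ) (t : ℝ) : ‖F m t‖ ≤ (b / c) ^ m / m ! * ‖kernelFn a 0 (c + I * t)‖ := by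
    rw [hF, norm_mul, norm_mul, Complex.norm_real, Real.norm_of_nonneg (by positivity)]
    calc b ^ m / m ! * (‖kernelFn a 0 (c + I * t)‖ * ‖((c + I * t : ℂ)⁻¹) ^ m‖)
        ≤ b ^ m / m ! * (‖kernelFn a 0 (c + I * t)‖ * (c⁻¹) ^ m) := by
          gcongr
          exact norm_inv_add_I_mul_pow_le hc t m
      _ = (b / c) ^ m / m ! * ‖kernelFn a 0 (c + I * t)‖ := by
          rw [div_eq_mul_inv b c, mul_pow]
          ring
  have hFint (m : ℕ) : Integrable (F m) := by
    have hcont := continuous_kernelFn hc a 0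
    have hinv := continuous_inv_add_I_mul hc
    exact (hint.norm.const_mul ((b / c) ^ m / m !)).mono'
      (Continuous.aestronglyMeasurable (by fun_prop)) (Eventually.of_forall (hle m))
  have hsum : Summable fun m => ∫ t, ‖F m t‖ := by
    refine Summable.of_nonneg_of_le (fun m => integral_nonneg fun t => norm_nonneg _)
      (fun m => ?_) ((Real.summable_pow_div_factorial (b / c)).mul_right
        (∫ t : ℝ, ‖kernelFn a 0 (c + I * t)‖))
    rw [← integral_const_mul]
    exact integral_mono (hFint m).norm (hint.norm.const_mul _) (hle m)
  have hseries := hasSum_integral_of_summable_integral_norm hFint hsum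
  simp only [hF, (hasSum_kernelFn a b _).tsum_eq, integral_const_mul,
    integral_kernelFn_mul_inv_pow hc ha, ← ofReal_mul] at hseries
  exact hseries

theorem Gamma_add_five_halves (m : ℕ) :
    Real.Gamma (m + 5 / 2) = √π * (2 * m + 3)! / (2 ^ (2 * m + 3) * (m + 1)!) := by
  have hdup := Real.Gamma_mul_Gamma_add_half ((m + 1 : ℕ) + 1)
  rw [Real.Gamma_nat_eq_factorial, show (2 * ((m + 1 : ℕ) + 1) : ℝ) = (2 * m + 3 : ℕ) + 1 by
    push_cast; ring, Real.Gamma_nat_eq_factorial, sub_add_cancel_right, Real.rpow_neg zero_le_two,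
    Real.rpow_natCast, show (((m + 1 : ℕ) + 1 : ℝ) + 1 / 2) = m + 5 / 2 by push_cast; ring] at hdup
  generalize Real.Gamma (m + 5 / 2) = g at hdup ⊢
  field_simp at hdup ⊢
  linear_combination hdup

theorem hasSum_mul_cosh_sub_sinh (y : ℝ) :
    HasSum (fun m : ℕ => (m + 1) * y ^ (2 * m + 3) / (2 * m + 3)!)
      ((y * Real.cosh y - Real.sinh y) / 2) := by
  have hdiff := (((Real.hasSum_cosh y).mul_left y).sub (Real.hasSum_sinh y)).div_const 2
  rw [← hasSum_nat_add_iff' 1] at hdiff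
  simp only [Finset.sum_range_one, mul_zero, pow_zero, Nat.factorial_zero, Nat.cast_one, div_one,
    mul_one, zero_add, pow_one, Nat.factorial_one, sub_self, zero_div, sub_zero] at hdiff
  refine hdiff.congr_fun fun m => ?_
  have hfac : (2 * m + 3)! = (2 * m + 3) * (2 * (m + 1))! := rfl
  have hfac' : (2 * (m + 1) + 1)! = (2 * m + 3) * (2 * (m + 1))! := rfl
  rw [hfac, hfac']
  push_cast
  field_simp
  ring

theorem hasDerivAt_sinh_sqrt_div_sqrt (γ : ℝ) {X : ℝ} (hX : 0 < X) :
    HasDerivAt (fun X => Real.sinh (γ * √X) / √X)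
      ((γ * √X * Real.cosh (γ * √X) - Real.sinh (γ * √X)) / 2 / (X * √X)) X := by
  have hsqrt := Real.hasDerivAt_sqrt hX.ne'
  have hne : √X ≠ 0 := (Real.sqrt_pos.2 hX).ne'
  refine ((hsqrt.const_mul γ).sinh.div hsqrt hne).congr_deriv ?_
  have hsq : √X ^ 2 = X := Real.sq_sqrt hX.le
  rw [← hsq, Real.sqrt_sq (Real.sqrt_nonneg _)]
  field_simp

theorem bessel_term_eq {γ X : ℝ} (ha : 0 < a) (hγ : 0 < γ) (hX : 0 < X)
    (h : γ ^ 2 * X = 4 * a * b) (m : ℕ) :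
    b ^ m / m ! * (2 * π * a ^ ((m : ℝ) + 3 / 2) / Real.Gamma (m + 5 / 2))
      = 16 * √π * a ^ (3 / 2 : ℝ) / γ ^ 3
        * ((m + 1) * (γ * √X) ^ (2 * m + 3) / (2 * m + 3)! / (X * √X)) := by
  have hpi : √π ^ 2 = π := Real.sq_sqrt Real.pi_pos.le
  have hsq : √X ^ 2 = X := Real.sq_sqrt hX.le
  have hpow : (γ * √X) ^ (2 * m + 3) = γ ^ 3 * (X * √X) * (4 * a * b) ^ m := by
    rw [← h, pow_add, pow_mul, mul_pow γ, hsq, mul_pow γ, pow_succ (√X), hsq]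
    ring
  have htwo : (2 : ℝ) ^ (2 * m + 3) = 8 * 4 ^ m := by
    rw [pow_add, pow_mul]
    norm_num
    ring
  rw [hpow, Gamma_add_five_halves, Real.rpow_add ha, Real.rpow_natCast, Nat.factorial_succ m, htwo,
    mul_pow, mul_pow]
  nth_rewrite 1 [← hpi]
  push_cast
  field_simp
  ring

theorem kernelIntegral_eq_deriv_sinh {γ X : ℝ} (hc : 0 < c) (ha : 0 < a) (hb : 0 ≤ b)
    (hγ : 0 < γ) (hX : 0 < X) (h : γ ^ 2 * X = 4 * a * b) :
    kernelIntegral c a b = ((16 * √π * a ^ (3 / 2 : ℝ) / γ ^ 3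
      * deriv (fun X => Real.sinh (γ * √X) / √X) X : ℝ) : ℂ) := by
  have hseries := ((hasSum_mul_cosh_sub_sinh (γ * √X)).div_const (X * √X)).mul_left
    (16 * √π * a ^ (3 / 2 : ℝ) / γ ^ 3)
  rw [(hasDerivAt_sinh_sqrt_div_sqrt γ hX).deriv]
  exact (hasSum_kernelIntegral hc ha hb).unique ((Complex.hasSum_ofReal.2 hseries).congr_fun
    fun m => congrArg _ (bessel_term_eq ha hγ hX h m))

theorem deriv_sinh_sqrt_affine {A d x : ℝ} (κ : ℝ) (hA : 0 ≤ A) (hx : 0 < 24 * x + d) :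
    deriv (fun y : ℝ => Real.sinh (π * √((24 * y + d) * A) / (6 * κ)) / √(24 * y + d)) x
      = deriv (fun X => Real.sinh (π * √A / (6 * κ) * √X) / √X) (24 * x + d) * 24 := by
  have hlin : HasDerivAt (fun y : ℝ => 24 * y + d) 24 x := by
    simpa using ((hasDerivAt_id x).const_mul (24 : ℝ)).add_const d
  have hsinh := (hasDerivAt_sinh_sqrt_div_sqrt (π * √A / (6 * κ)) hx).differentiableAt.hasDerivAt
  rw [← (hsinh.comp x hlin).deriv]
  congr 1 with y
  rw [Function.comp_apply, Real.sqrt_mul' _ hA]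
  congr 2
  ring

theorem bessel_const_eq {γ : ℝ} (ha : 0 < a) (hγ : 0 < γ) (h : 3 * γ ^ 2 = π * a) :
    16 * √π * a ^ (3 / 2 : ℝ) / γ ^ 3 = 48 * √3 / π := by
  have hsqrt : √3 * γ = √π * √a := by
    rw [← Real.sqrt_mul Real.pi_pos.le, ← h, Real.sqrt_mul zero_le_three, Real.sqrt_sq hγ.le]
  have hcube : 3 * γ ^ 3 = π * a * γ := by linear_combination γ * h
  rw [← mul_sqrt_eq_rpow ha.le, div_eq_div_iff (by positivity) Real.pi_ne_zero]
  linear_combination (-16 * π * a) * hsqrt - 16 * √3 * hcube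

theorem kernelIntegral_eq_deriv {A κ d x : ℝ} (hc : 0 < c) (hA : 0 < A) (hκ : 0 < κ)
    (hx : 0 < 24 * x + d) :
    kernelIntegral c (π * A / 12 / κ ^ 2) (π * (24 * x + d) / 12)
      = ((2 * √3 / π * deriv (fun y : ℝ => Real.sinh (π * √((24 * y + d) * A) / (6 * κ))
          / √(24 * y + d)) x : ℝ) : ℂ) := by
  have hγ : 0 < π * √A / (6 * κ) := by positivity
  have hγsq : (π * √A / (6 * κ)) ^ 2 = π ^ 2 * A / (36 * κ ^ 2) := by
    rw [div_pow, mul_pow, Real.sq_sqrt hA.le]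
    ring
  rw [kernelIntegral_eq_deriv_sinh hc (by positivity) (by positivity) hγ hx
      (by rw [hγsq]; field_simp; ring),
    bessel_const_eq (by positivity) hγ (by rw [hγsq]; field_simp; ring),
    deriv_sinh_sqrt_affine κ hA.le hx]
  congr 1
  ring

end Bessel

section CircleMethodSeries

open Complex Real Filter Topology

variable {B : ℂ → ℂ} {A : ℕ → ℕ → ℂ} {α : ℕ → ℝ} {β K : ℝ}

theorem IsFordApprox.norm_kernelIntegral_le (hB : IsFordApprox B A α β K) {k : ℕ} (hk : 0 < k) :
    ‖kernelIntegral (k ^ 2) (α k / k ^ 2) β‖ ≤ 11 * rexp (K + β) * (k : ℝ) ^ (-3 : ℝ) := by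
  have hc : (0 : ℝ) < (k : ℝ) ^ 2 := by positivity
  have hbound := norm_kernelIntegral_sub_intervalIntegral_le (a := α k / k ^ 2) hc hB.nonneg hc
    le_rfl (add_zero _).ge le_rfl (add_zero _).ge
  have hpow : ((k : ℝ) ^ 2) ^ (-(3 / 2) : ℝ) = (k : ℝ) ^ (-3 : ℝ) := by
    rw [← Real.rpow_natCast, ← Real.rpow_mul k.cast_nonneg]
    norm_num
  rw [neg_zero, intervalIntegral.integral_same, sub_zero, hpow] at hbound
  have hexp := hB.exp_le hk
  exact hbound.trans (by gcongr)

theorem IsFordApprox.norm_sum_mul_kernelIntegral_le (hB : IsFordApprox B A α β K) {k : ℕ}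
    (hk : 0 < k) :
    ‖(∑ h ∈ reduced k, A h k) * kernelIntegral (k ^ 2) (α k / k ^ 2) β‖
      ≤ K * (11 * rexp (K + β)) * (k : ℝ) ^ (-(3 / 2) : ℝ) := by
  have hkpos : (0 : ℝ) < k := by exact_mod_cast hk
  have hK := hB.const_nonneg
  have hpow : (k : ℝ) ^ (-(3 / 2) : ℝ) = k * √k * (k : ℝ) ^ (-3 : ℝ) := by
    rw [mul_sqrt_eq_rpow hkpos.le, ← Real.rpow_add hkpos]
    norm_num
  calc ‖(∑ h ∈ reduced k, A h k) * kernelIntegral (k ^ 2) (α k / k ^ 2) β‖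
      ≤ k * (K * √k) * (11 * rexp (K + β) * (k : ℝ) ^ (-3 : ℝ)) :=
        norm_mul_le_of_le (norm_sum_reduced_le (by positivity) fun h _ => hB.norm_le h k)
          (hB.norm_kernelIntegral_le hk)
    _ = K * (11 * rexp (K + β)) * (k : ℝ) ^ (-(3 / 2) : ℝ) := by
        rw [hpow]
        ring

theorem IsFordApprox.summable (hB : IsFordApprox B A α β K) :
    Summable fun k : ℕ => (∑ h ∈ reduced k, A h k) * kernelIntegral (k ^ 2) (α k / k ^ 2) β :=
  Summable.of_norm_bounded_eventually_nat
    ((Real.summable_nat_rpow.2 (by norm_num : (-(3 / 2) : ℝ) < -1)).mul_left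
      (K * (11 * rexp (K + β))))
    ((eventually_gt_atTop 0).mono fun _ hk => hB.norm_sum_mul_kernelIntegral_le hk)

theorem IsFordApprox.hasSum_coeff {a : PowerSeries ℂ} {g : ℂ → ℂ} (ha : IsSumOnDisc a g) {n : ℕ}
    (hB : IsFordApprox (fun τ => g (cexp (2 * π * I * τ)) * cexp (-(2 * π * I * n * τ))) A α β K) :
    HasSum (fun k : ℕ => (∑ h ∈ reduced k, A h k) * kernelIntegral (k ^ 2) (α k / k ^ 2) β)
      (PowerSeries.coeff n a) := by
  have hsum := hB.summable
  have hpartial := hsum.hasSum.tendsto_sum_nat.comp (tendsto_add_atTop_nat 1)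
  rw [tendsto_nhds_unique (tendsto_sum_kernelIntegral ha hB) (hpartial.congr fun N => ?_)]
  · exact hsum.hasSum
  · rw [Function.comp_apply, Finset.range_eq_Ico, Finset.sum_eq_sum_Ico_succ_bot N.succ_pos,
      reduced, Finset.range_zero, Finset.filter_empty, Finset.sum_empty, zero_mul, zero_add]
    rfl

end CircleMethodSeries

section SeriesTerm

open Complex Real

/-- The derivative occurring in the term with denominator `k` of the series for `p_r(n)`. -/
def derivFactor (r : ℕ) (A : ℝ) (k n : ℕ) : ℝ :=
  deriv (fun x : ℝ => Real.sinh (π * √((24 * x - 2 ^ r + 1) * A) / (6 * k))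
    / √(24 * x - 2 ^ r + 1)) (n : ℝ)

open Classical in
/-- The term with denominator `k` of the series for `p_r(n)`, written uniformly in `k`: both series
of the exact formula are sums of `seriesTerm` over a class of denominators. -/
def seriesTerm (r n k : ℕ) : ℂ :=
  if 0 < polarCoeff r k then
    ((2 * √3 / π * scaleFactor r k : ℝ) : ℂ) * ((√k : ℝ)
      * (∑ h ∈ reduced k, phase n h k * multiplier r h k) * derivFactor r (polarCoeff r k) k n)
  else 0

open Classical in
/-- The coefficient at `h/k` in the Ford circle approximation of `f_r (q) q⁻ⁿ`, `q = exp (2πiτ)`. -/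
def leadingCoeff (r n h k : ℕ) : ℂ :=
  if 0 < polarCoeff r k then multiplier r h k * scaleFactor r k * √k * phase n h k else 0

theorem seriesTerm_zero (r n : ℕ) : seriesTerm r n 0 = 0 := by
  simp [seriesTerm]

theorem norm_phase (n h k : ℕ) : ‖phase n h k‖ = 1 := by
  rw [phase, show (-2 * π * I * n * h / k : ℂ) = ((-2 * π * n * h / k : ℝ) : ℂ) * I by
    push_cast; ring, Complex.norm_exp_ofReal_mul_I]

theorem norm_leadingCoeff_le {r : ℕ} (hr : r ≤ 4) (n h k : ℕ) :
    ‖leadingCoeff r n h k‖ ≤ 4 * √k := by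
  rw [leadingCoeff]
  split_ifs
  · rw [norm_mul, norm_mul, norm_mul, norm_multiplier, norm_phase, Complex.norm_real,
      Complex.norm_real, Real.norm_of_nonneg (scaleFactor_nonneg r k),
      Real.norm_of_nonneg (Real.sqrt_nonneg _), one_mul, mul_one]
    exact mul_le_mul_of_nonneg_right (scaleFactor_le hr k) (Real.sqrt_nonneg _)
  · rw [norm_zero]
    positivity

theorem leadingCoeff_mul_segmentFn (r n h k : ℕ) (w : ℂ) :
    leadingCoeff r n h k * segmentFn (π * polarCoeff r k / 12 / k ^ 2)
        (π * (24 * n + (1 - 2 ^ r)) / 12) w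
      = leadingTerm r h k w * cexp (-(2 * π * I * n * (h / k + I * w))) := by
  rw [leadingCoeff, leadingTerm]
  split_ifs
  · have hexp : cexp (((π * polarCoeff r k / 12 / k ^ 2 : ℝ) : ℂ) * w⁻¹
          + (π * (24 * n + (1 - 2 ^ r)) / 12 : ℝ) * w) * phase n h k
        = cexp (π * polarCoeff r k / 12 / k ^ 2 * w⁻¹ - π * (2 ^ r - 1) / 12 * w)
          * cexp (-(2 * π * I * n * (h / k + I * w))) := by
      rw [phase, ← Complex.exp_add, ← Complex.exp_add]
      congr 1
      push_cast
      linear_combination (2 * π * n * w : ℂ) * I_sq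
    rw [segmentFn, principalFactor]
    linear_combination (multiplier r h k * scaleFactor r k * √k * Complex.sqrt w) * hexp
  · rw [zero_mul, zero_mul]

theorem norm_cexp_neg_two_pi_mul_le (n : ℕ) (x : ℝ) {w : ℂ} (hw : w.re ≤ 1) :
    ‖cexp (-(2 * π * I * n * (x + I * w)))‖ ≤ rexp (2 * π * n) := by
  have hsplit : (-(2 * π * I * n * (x + I * w)) : ℂ)
      = ((2 * π * n : ℝ) : ℂ) * w + ((-(2 * π * n * x) : ℝ) : ℂ) * I := by
    push_cast
    linear_combination (-2 * π * n * w : ℂ) * I_sq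
  rw [Complex.norm_exp, Real.exp_le_exp, hsplit, add_re, re_ofReal_mul, re_ofReal_mul, I_re,
    mul_zero, add_zero]
  exact mul_le_of_le_one_right (by positivity) hw

theorem re_le_one_of_mem_horodisc {c : ℝ} (hc : 1 ≤ c) {w : ℂ} (hw : w ∈ horodisc c) :
    w.re ≤ 1 := by
  have hle := (hc.trans hw.2).trans (inv_re_le_inv hw.1)
  rwa [one_le_div hw.1] at hle

theorem exists_isFordApprox_frFn {r : ℕ} (hr : r ≤ 4) {n : ℕ}
    (hn : 0 ≤ 24 * (n : ℝ) + (1 - 2 ^ r)) :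
    ∃ K, IsFordApprox (fun τ => frFn r (cexp (2 * π * I * τ)) * cexp (-(2 * π * I * n * τ)))
      (leadingCoeff r n) (fun k => π * polarCoeff r k / 12) (π * (24 * n + (1 - 2 ^ r)) / 12)
      K := by
  obtain ⟨K, hK, happrox⟩ := exists_frFn_approx hr
  refine ⟨K * rexp (2 * π * n) + 4 + 2 * π, by positivity, fun k => ?_, fun h k => ?_,
    fun h k hk hc w hw => ?_⟩
  · have hpolar := mul_le_mul_of_nonneg_left (polarCoeff_le hr k) Real.pi_pos.le
    have hpos : 0 ≤ K * rexp (2 * π * n) := by positivity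
    linarith
  · refine (norm_leadingCoeff_le hr n h k).trans ?_
    gcongr
    have hpos : 0 ≤ K * rexp (2 * π * n) + 2 * π := by positivity
    linarith
  · have hone : (1 : ℝ) ≤ k := by exact_mod_cast hk
    have hphase := norm_cexp_neg_two_pi_mul_le n (h / k)
      (re_le_one_of_mem_horodisc (one_le_pow₀ hone) hw)
    push_cast at hphase
    rw [leadingCoeff_mul_segmentFn, ← sub_mul]
    calc _ ≤ K * (√k * √‖w‖) * rexp (2 * π * n) :=
          norm_mul_le_of_le (happrox k h w hk hc hw.1 hw.2) hphase
      _ = K * rexp (2 * π * n) * (√k * √‖w‖) := by ring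
      _ ≤ (K * rexp (2 * π * n) + 4 + 2 * π) * (√k * √‖w‖) := by
          gcongr
          linarith [Real.pi_pos]

theorem sum_leadingCoeff_mul_kernelIntegral {r n : ℕ} (hn : 0 < 24 * (n : ℝ) + (1 - 2 ^ r)) {k : ℕ}
    (hk : 0 < k) :
    (∑ h ∈ reduced k, leadingCoeff r n h k)
        * kernelIntegral (k ^ 2) (π * polarCoeff r k / 12 / k ^ 2) (π * (24 * n + (1 - 2 ^ r)) / 12)
      = seriesTerm r n k := by
  have hkpos : (0 : ℝ) < k := by exact_mod_cast hk
  simp only [seriesTerm, leadingCoeff]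
  split_ifs with hpolar
  · have hshift (x : ℝ) : 24 * x + (1 - 2 ^ r) = 24 * x - 2 ^ r + 1 := by ring
    rw [kernelIntegral_eq_deriv (by positivity) hpolar hkpos hn]
    simp only [hshift]
    rw [derivFactor, Finset.mul_sum, Finset.sum_mul, Finset.sum_mul, Finset.mul_sum]
    refine Finset.sum_congr rfl fun h _ => ?_
    push_cast
    ring
  · rw [Finset.sum_const_zero, zero_mul]

theorem hasSum_seriesTerm {r : ℕ} (hr : r ≤ 4) {n : ℕ} (hn : ((2 : ℝ) ^ r - 1) / 24 < n) :
    HasSum (seriesTerm r n) (pr r n) := by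
  have hpos : 0 < 24 * (n : ℝ) + (1 - 2 ^ r) := by linarith
  obtain ⟨K, hK⟩ := exists_isFordApprox_frFn hr hpos.le
  refine (hK.hasSum_coeff (isSumOnDisc_fr r)).congr_fun fun k => ?_
  rcases k.eq_zero_or_pos with rfl | hk
  · simp [seriesTerm_zero, reduced]
  · exact (sum_leadingCoeff_mul_kernelIntegral hpos hk).symm

end SeriesTerm

section ExactFormula

open Complex Real

variable {r j k : ℕ}

theorem gcd_two_pow_eq_one (hk : Nat.gcd 2 k = 1) (r : ℕ) : Nat.gcd (2 ^ r) k = 1 :=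
  Nat.Coprime.pow_left r hk

theorem gcd_two_eq_one_or_two (k : ℕ) : Nat.gcd 2 k = 1 ∨ Nat.gcd 2 k = 2 :=
  (Nat.dvd_prime Nat.prime_two).1 (Nat.gcd_dvd_left 2 k)

theorem gcd_two_pow_max_one_eq_one_iff : Nat.gcd k (2 ^ max r 1) = 1 ↔ Nat.gcd 2 k = 1 := by
  rw [Nat.gcd_comm]
  exact Nat.coprime_pow_left_iff (Nat.lt_of_lt_of_le one_pos (le_max_right r 1)) 2 k

theorem gcd_two_eq_two_of_gcd_two_pow (hj : j ≠ 0) (h : Nat.gcd (2 ^ r) k = 2 ^ j) :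
    Nat.gcd 2 k = 2 :=
  Nat.gcd_eq_left ((dvd_pow_self 2 hj).trans (h ▸ Nat.gcd_dvd_right (2 ^ r) k))

theorem sqrt_two_pow (r : ℕ) : √((2 : ℝ) ^ r) = (2 : ℝ) ^ ((r : ℝ) / 2) := by
  rw [Real.sqrt_eq_rpow, ← Real.rpow_natCast, ← Real.rpow_mul zero_le_two, mul_one_div]

theorem multiplier_of_odd (hk : Nat.gcd 2 k = 1) (r h : ℕ) :
    multiplier r h k = omega h k * omega (2 ^ r * h) k / omega (2 * h) k := by
  rw [multiplier, hk, gcd_two_pow_eq_one hk]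
  simp only [Nat.div_one]

theorem polarCoeff_of_odd (hk : Nat.gcd 2 k = 1) (r : ℕ) :
    polarCoeff r k = (1 + (2 : ℝ) ^ ((r : ℤ) - 1)) / 2 ^ r := by
  rw [polarCoeff, decayRate, decayRate, hk, gcd_two_pow_eq_one hk, zpow_sub₀ two_ne_zero,
    zpow_natCast, zpow_one]
  push_cast
  field_simp
  ring

theorem two_div_pi_mul_scaleFactor_of_odd (hk : Nat.gcd 2 k = 1) (r : ℕ) :
    2 * √3 / π * scaleFactor r k = (2 : ℝ) ^ (((r : ℝ) + 1) / 2) * √3 / π := by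
  have hpow : (2 : ℝ) ^ (((r : ℝ) + 1) / 2) = (2 : ℝ) ^ ((r : ℝ) / 2) * √2 := by
    rw [Real.sqrt_eq_rpow, ← Real.rpow_add two_pos, ← add_div]
  rw [scaleFactor, gcd_two_pow_eq_one hk, hk, Nat.cast_one, div_one, div_one, sqrt_two_pow, hpow,
    div_mul_div_comm, div_eq_div_iff (by positivity) Real.pi_ne_zero]
  linear_combination
    (-(2 : ℝ) ^ ((r : ℝ) / 2) * √3 * π) * Real.mul_self_sqrt (zero_le_two (α := ℝ))

theorem derivFactor_of_odd (hk : Nat.gcd 2 k = 1) (r n : ℕ) :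
    derivFactor r (polarCoeff r k) k n = deriv (fun x : ℝ =>
      Real.sinh (π * √((24 * x - 2 ^ r + 1) * (1 + (2 : ℝ) ^ ((r : ℤ) - 1)))
        / ((2 : ℝ) ^ ((r : ℝ) / 2) * (6 * k))) / √(24 * x - 2 ^ r + 1)) (n : ℝ) := by
  rw [derivFactor, polarCoeff_of_odd hk]
  congr 1 with x
  rw [← mul_div_assoc, Real.sqrt_div' _ (by positivity), sqrt_two_pow, ← mul_div_assoc, div_div]

theorem seriesTerm_of_odd (hk : Nat.gcd 2 k = 1) (r n : ℕ) :
    seriesTerm r n k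
      = (((2 : ℝ) ^ (((r : ℝ) + 1) / 2) * √3 / π : ℝ) : ℂ) * mainTerm r n k := by
  have hpos : 0 < polarCoeff r k := by
    rw [polarCoeff_of_odd hk]
    positivity
  rw [seriesTerm, if_pos hpos, two_div_pi_mul_scaleFactor_of_odd hk, derivFactor_of_odd hk]
  simp only [mainTerm, multiplier_of_odd hk]

theorem multiplier_of_even (hk : Nat.gcd 2 k = 2) (hj : Nat.gcd (2 ^ r) k = 2 ^ j) (hjr : j ≤ r)
    (h : ℕ) :
    multiplier r h k = omega h k * omega (2 ^ (r - j) * h) (k / 2 ^ j) / omega h (k / 2) := by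
  rw [multiplier, hj, hk, Nat.pow_div hjr two_pos, Nat.div_self two_pos, one_mul]

theorem polarCoeff_of_even (hk : Nat.gcd 2 k = 2) (hj : Nat.gcd (2 ^ r) k = 2 ^ j) :
    polarCoeff r k = -1 + (2 : ℝ) ^ (2 * (j : ℤ) - r) := by
  rw [polarCoeff, decayRate, decayRate, hk, hj, zpow_sub₀ two_ne_zero, zpow_natCast,
    mul_comm 2 (j : ℤ), zpow_mul, zpow_natCast, zpow_ofNat]
  push_cast
  ring

theorem two_div_pi_mul_scaleFactor_of_even (hk : Nat.gcd 2 k = 2)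
    (hj : Nat.gcd (2 ^ r) k = 2 ^ j) :
    2 * √3 / π * scaleFactor r k = √3 / π * (2 : ℝ) ^ ((2 - (j : ℝ) + (r : ℝ)) / 2) := by
  have hpow : (2 : ℝ) ^ ((2 - (j : ℝ) + (r : ℝ)) / 2) = 2 * √((2 : ℝ) ^ r / 2 ^ j) := by
    rw [show (2 - (j : ℝ) + r) / 2 = 1 + (r / 2 - j / 2) by ring, Real.rpow_add two_pos,
      Real.rpow_one, Real.rpow_sub two_pos, Real.sqrt_div (by positivity), sqrt_two_pow,
      sqrt_two_pow]
  rw [scaleFactor, hj, hk, hpow, Nat.cast_ofNat, div_self two_ne_zero, Real.sqrt_one]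
  push_cast
  ring

theorem seriesTerm_of_even (hk : Nat.gcd 2 k = 2) (hj : Nat.gcd (2 ^ r) k = 2 ^ j) (hjr : j ≤ r)
    (hrj : 1 + r / 2 ≤ j) (n : ℕ) :
    seriesTerm r n k = ((√3 / π : ℝ) : ℂ)
      * ((((2 : ℝ) ^ ((2 - (j : ℝ) + (r : ℝ)) / 2) : ℝ) : ℂ) * extraTerm r j n k) := by
  have hpos : 0 < polarCoeff r k := by
    have hone := one_lt_zpow₀ (one_lt_two (α := ℝ)) (by lia : 0 < 2 * (j : ℤ) - r)
    rw [polarCoeff_of_even hk hj]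
    linarith
  rw [seriesTerm, if_pos hpos, two_div_pi_mul_scaleFactor_of_even hk hj, derivFactor,
    polarCoeff_of_even hk hj, ofReal_mul, mul_assoc]
  simp only [extraTerm, multiplier_of_even hk hj hjr]

theorem seriesTerm_eq_zero (hk : Nat.gcd 2 k = 2) (hj : Nat.gcd (2 ^ r) k = 2 ^ j)
    (hrj : j < 1 + r / 2) (n : ℕ) : seriesTerm r n k = 0 := by
  have hle := zpow_le_one_of_nonpos₀ (one_le_two (α := ℝ)) (by lia : 2 * (j : ℤ) - r ≤ 0)
  rw [seriesTerm, if_neg]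
  rw [polarCoeff_of_even hk hj]
  linarith

/-- The denominators `k` in the first series of the exact formula: the odd ones. -/
def mainSet (r : ℕ) : Set ℕ := {k | 1 ≤ k ∧ Nat.gcd k (2 ^ max r 1) = 1}

/-- The denominators `k` in the `j`-th of the remaining series of the exact formula. -/
def extraSet (r j : ℕ) : Set ℕ := {k | 1 ≤ k ∧ Nat.gcd k (2 ^ r) = 2 ^ j}

theorem gcd_two_eq_two_of_mem_extraSet (hj : j ≠ 0) (hk : k ∈ extraSet r j) : Nat.gcd 2 k = 2 :=
  gcd_two_eq_two_of_gcd_two_pow hj ((Nat.gcd_comm _ _).trans hk.2)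

theorem disjoint_mainSet_extraSet (hj : j ≠ 0) : Disjoint (mainSet r) (extraSet r j) :=
  Set.disjoint_left.2 fun k hmain hextra => by
    have hodd := gcd_two_pow_max_one_eq_one_iff.1 hmain.2
    have heven := gcd_two_eq_two_of_mem_extraSet hj hextra
    lia

theorem pairwise_disjoint_extraSet (r : ℕ) : Pairwise (Function.onFun Disjoint (extraSet r)) :=
  fun _ _ hij => Set.disjoint_left.2 fun _ hi hj =>
    hij (Nat.pow_right_injective le_rfl (hi.2.symm.trans hj.2))

theorem support_seriesTerm_subset (r n : ℕ) :
    Function.support (seriesTerm r n)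
      ⊆ mainSet r ∪ ⋃ j ∈ Finset.Icc (1 + r / 2) r, extraSet r j := by
  intro k hk
  have hpos : 1 ≤ k := Nat.one_le_iff_ne_zero.2 fun h => hk (h ▸ seriesTerm_zero r n)
  rcases gcd_two_eq_one_or_two k with hodd | heven
  · exact Or.inl ⟨hpos, gcd_two_pow_max_one_eq_one_iff.2 hodd⟩
  · obtain ⟨j, hjr, hj⟩ := (Nat.dvd_prime_pow Nat.prime_two).1 (Nat.gcd_dvd_left (2 ^ r) k)
    have hrj : 1 + r / 2 ≤ j := not_lt.1 fun hlt => hk (seriesTerm_eq_zero heven hj hlt n)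
    exact Or.inr (Set.mem_biUnion (Finset.mem_Icc.2 ⟨hrj, hjr⟩) ⟨hpos, by rwa [Nat.gcd_comm]⟩)

theorem seriesTerm_eq_indicator (r n : ℕ) :
    seriesTerm r n = (mainSet r).indicator (seriesTerm r n)
      + ∑ j ∈ Finset.Icc (1 + r / 2) r, (extraSet r j).indicator (seriesTerm r n) := by
  have hne {j : ℕ} (hj : j ∈ Finset.Icc (1 + r / 2) r) : j ≠ 0 := by
    have := (Finset.mem_Icc.1 hj).1
    lia
  have hdisj : Disjoint (mainSet r) (⋃ j ∈ Finset.Icc (1 + r / 2) r, extraSet r j) :=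
    Set.disjoint_iUnion₂_right.2 fun j hj => disjoint_mainSet_extraSet (hne hj)
  conv_lhs => rw [← Set.indicator_eq_self.2 (support_seriesTerm_subset r n)]
  rw [Set.indicator_union_of_disjoint hdisj,
    Finset.indicator_biUnion _ _ ((pairwise_disjoint_extraSet r).set_pairwise _)]
  ext k
  simp only [Pi.add_apply, Finset.sum_apply]

theorem seriesTerm_of_mem_mainSet (hk : k ∈ mainSet r) (n : ℕ) :
    seriesTerm r n k
      = (((2 : ℝ) ^ (((r : ℝ) + 1) / 2) * √3 / π : ℝ) : ℂ) * mainTerm r n k :=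
  seriesTerm_of_odd (gcd_two_pow_max_one_eq_one_iff.1 hk.2) r n

theorem seriesTerm_of_mem_extraSet (hj : j ∈ Finset.Icc (1 + r / 2) r) (hk : k ∈ extraSet r j)
    (n : ℕ) :
    seriesTerm r n k = ((√3 / π : ℝ) : ℂ)
      * ((((2 : ℝ) ^ ((2 - (j : ℝ) + (r : ℝ)) / 2) : ℝ) : ℂ) * extraTerm r j n k) := by
  obtain ⟨hrj, hjr⟩ := Finset.mem_Icc.1 hj
  exact seriesTerm_of_even (gcd_two_eq_two_of_mem_extraSet (by lia) hk)
    ((Nat.gcd_comm _ _).trans hk.2) hjr hrj n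

theorem tsum_seriesTerm {n : ℕ} (hs : Summable (seriesTerm r n)) :
    ∑' k, seriesTerm r n k = ∑' k : mainSet r, seriesTerm r n k
      + ∑ j ∈ Finset.Icc (1 + r / 2) r, ∑' k : extraSet r j, seriesTerm r n k := by
  simp only [tsum_subtype]
  conv_lhs => rw [seriesTerm_eq_indicator]
  simp only [Pi.add_apply, Finset.sum_apply]
  rw [(hs.indicator _).tsum_add (summable_sum fun j _ => hs.indicator _),
    Summable.tsum_finsetSum fun j _ => hs.indicator _]

theorem exact_formula (hr : r ≤ 4) {n : ℕ} (hn : ((2 : ℝ) ^ r - 1) / 24 < n) :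
    Summable (fun k : mainSet r => mainTerm r n k) ∧
    (∀ j ∈ Finset.Icc (1 + r / 2) r, Summable (fun k : extraSet r j => extraTerm r j n k)) ∧
    pr r n = (((2 : ℝ) ^ (((r : ℝ) + 1) / 2) * √3 / π : ℝ) : ℂ) * ∑' k : mainSet r, mainTerm r n k
      + ((√3 / π : ℝ) : ℂ) * ∑ j ∈ Finset.Icc (1 + r / 2) r,
          (((2 : ℝ) ^ ((2 - (j : ℝ) + (r : ℝ)) / 2) : ℝ) : ℂ)
            * ∑' k : extraSet r j, extraTerm r j n k := by
  have hs := hasSum_seriesTerm hr hn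
  have hpow (x : ℝ) : (((2 : ℝ) ^ x : ℝ) : ℂ) ≠ 0 :=
    ofReal_ne_zero.2 (Real.rpow_pos_of_pos two_pos x).ne'
  have hmain (k : mainSet r) := seriesTerm_of_mem_mainSet k.2 n
  have hextra {j : ℕ} (hj : j ∈ Finset.Icc (1 + r / 2) r) (k : extraSet r j) :=
    seriesTerm_of_mem_extraSet hj k.2 n
  refine ⟨?_, fun j hj => ?_, ?_⟩
  · have hsum := (hs.summable.subtype (mainSet r)).congr hmain
    exact (summable_mul_left_iff (ofReal_ne_zero.2 (by positivity))).1 hsum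
  · have hsum := (hs.summable.subtype (extraSet r j)).congr (hextra hj)
    exact (summable_mul_left_iff (hpow _)).1
      ((summable_mul_left_iff (ofReal_ne_zero.2 (by positivity))).1 hsum)
  · rw [← hs.tsum_eq, tsum_seriesTerm hs.summable, tsum_congr hmain, tsum_mul_left, Finset.mul_sum]
    congr 1
    refine Finset.sum_congr rfl fun j hj => ?_
    rw [tsum_congr (hextra hj), tsum_mul_left, tsum_mul_left]

end ExactFormula

section SpecialCases

open Complex Real

theorem derivFactor_eq {r k n : ℕ} {A B c d : ℝ} {ℓ : ℝ → ℝ} (hc : 0 ≤ c) (hd : 0 < d)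
    (hℓ : ∀ x, 24 * x - 2 ^ r + 1 = c * ℓ x) (hB : c * A * d ^ 2 = 36 * B) :
    derivFactor r A k n
      = 1 / √c * deriv (fun x => Real.sinh (π * √(B * ℓ x) / (d * k)) / √(ℓ x)) n := by
  have hsqrt (x : ℝ) : √((24 * x - 2 ^ r + 1) * A) = 6 / d * √(B * ℓ x) := by
    rw [← Real.sqrt_sq (show 0 ≤ 6 / d by positivity), ← Real.sqrt_mul (sq_nonneg _), hℓ]
    congr 1
    field_simp
    linear_combination ℓ x * hB
  have harg (x : ℝ) : π * (6 / d * √(B * ℓ x)) / (6 * k) = π * √(B * ℓ x) / (d * k) := by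
    rw [show π * (6 / d * √(B * ℓ x)) = 6 * (π * √(B * ℓ x) / d) by ring,
      mul_div_mul_left _ _ (by norm_num), div_div]
  rw [derivFactor, ← deriv_const_mul_field]
  congr 1 with x
  rw [hsqrt, harg, hℓ, Real.sqrt_mul hc, div_mul_div_comm, one_mul]

theorem sqrt_twenty_four : √(24 : ℝ) = 2 * (√2 * √3) := by
  rw [← Real.sqrt_mul zero_le_two, show (24 : ℝ) = 2 ^ 2 * (2 * 3) by norm_num,
    Real.sqrt_mul (sq_nonneg 2), Real.sqrt_sq zero_le_two]

theorem seriesTerm_zero_left_of_odd {k : ℕ} (hk : Nat.gcd 2 k = 1) (n : ℕ) :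
    seriesTerm 0 n k = ((1 / (2 * π) : ℝ) : ℂ) * overTerm n k := by
  have hpolar : polarCoeff 0 k = 3 / 2 := by
    rw [polarCoeff_of_odd hk]
    norm_num
  have hscale : scaleFactor 0 k = 1 / √2 := by simp [scaleFactor, hk]
  have hmultiplier (h : ℕ) : multiplier 0 h k = omega h k ^ 2 / omega (2 * h) k := by
    rw [multiplier_of_odd hk, pow_zero, one_mul, sq]
  have hderiv : derivFactor 0 (3 / 2) k n = 1 / √24
      * deriv (fun x : ℝ => Real.sinh (π * √x / k) / √x) n := by
    simpa only [one_mul] using derivFactor_eq (B := 1) (c := 24) (d := 1) (ℓ := fun x => x)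
      (by norm_num) one_pos (fun x => by ring) (by norm_num)
  have hconst : 2 * √3 / π * (1 / √2) * (1 / √24) = 1 / (2 * π) := by
    rw [sqrt_twenty_four]
    field_simp
    rw [Real.sq_sqrt zero_le_two]
  rw [seriesTerm, if_pos (by rw [hpolar]; norm_num), hpolar, hderiv, hscale, ← hconst, overTerm]
  simp only [hmultiplier, mul_comm (phase _ _ _)]
  push_cast
  ring

theorem seriesTerm_one_left (n k : ℕ) :
    seriesTerm 1 n k = ((1 / (π * √2) : ℝ) : ℂ) * partTerm n k := by
  have hpolar : polarCoeff 1 k = 1 := by rw [polarCoeff, pow_one, add_sub_cancel_right]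
  have hscale : scaleFactor 1 k = 1 := by
    have hpos : (0 : ℝ) < 2 / Nat.gcd 2 k :=
      div_pos two_pos (Nat.cast_pos.2 (Nat.gcd_pos_of_pos_left k two_pos))
    rw [scaleFactor, pow_one, pow_one, div_self (Real.sqrt_ne_zero'.2 hpos)]
  have hmultiplier (h : ℕ) : multiplier 1 h k = omega h k := by
    have hne : omega (2 / Nat.gcd 2 k * h) (k / Nat.gcd 2 k) ≠ 0 :=
      norm_ne_zero_iff.1 ((norm_omega _ _).trans_ne one_ne_zero)
    rw [multiplier, pow_one, mul_div_assoc, div_self hne, mul_one]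
  have hderiv : derivFactor 1 1 k n = 1 / √24
      * deriv (fun x : ℝ => Real.sinh (π / k * √(2 / 3 * (x - 1 / 24))) / √(x - 1 / 24)) n := by
    simpa only [one_mul, div_mul_eq_mul_div] using derivFactor_eq (B := 2 / 3) (c := 24) (d := 1)
      (ℓ := fun x => x - 1 / 24) (by norm_num) one_pos (fun x => by ring) (by norm_num)
  have hconst : 2 * √3 / π * 1 * (1 / √24) = 1 / (π * √2) := by
    rw [sqrt_twenty_four]
    field_simp
  rw [seriesTerm, if_pos (hpolar.symm ▸ one_pos), hpolar, hderiv, hscale, ← hconst, partTerm]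
  simp only [hmultiplier, mul_comm (phase _ _ _)]
  push_cast
  ring

theorem multiplier_two_left (h k : ℕ) :
    multiplier 2 h k = omega h k * omega (4 * h / Nat.gcd k 4) (k / Nat.gcd k 4)
      / omega (2 * h / Nat.gcd k 2) (k / Nat.gcd k 2) := by
  rw [multiplier, show 2 ^ 2 = 4 from rfl, Nat.div_mul_right_comm (Nat.gcd_dvd_left 4 k),
    Nat.div_mul_right_comm (Nat.gcd_dvd_left 2 k), Nat.gcd_comm 4, Nat.gcd_comm 2]

theorem seriesTerm_two_left_of_polarCoeff {k : ℕ} (hpolar : polarCoeff 2 k = 3 / 4 * Nat.gcd k 4)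
    (hscale : scaleFactor 2 k * √k = √(k * (1 - (-1) ^ k + ((Nat.gcd k 4 / 4 : ℕ) : ℝ)))) (n : ℕ) :
    seriesTerm 2 n k = ((2 / π : ℝ) : ℂ) * podTerm n k := by
  have hpos : 0 < polarCoeff 2 k := by
    rw [hpolar]
    exact mul_pos (by norm_num) (Nat.cast_pos.2 (Nat.gcd_pos_of_pos_right k four_pos))
  have hderiv := derivFactor_eq (r := 2) (k := k) (n := n) (A := 3 / 4 * Nat.gcd k 4)
    (B := Nat.gcd k 4) (c := 3) (d := 4) (ℓ := fun x => 8 * x - 1) (by norm_num) four_pos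
    (fun x => by ring) (by ring)
  have hconst : 2 * √3 / π * (1 / √3) = 2 / π := by field_simp
  rw [seriesTerm, if_pos hpos, hpolar, hderiv, podTerm, ← hscale, ← hconst]
  simp only [← multiplier_two_left, mul_comm (phase _ _ _)]
  push_cast
  ring

theorem seriesTerm_two_left_of_odd {k : ℕ} (hk : Nat.gcd 2 k = 1) (n : ℕ) :
    seriesTerm 2 n k = ((2 / π : ℝ) : ℂ) * podTerm n k := by
  have hodd : Odd k := Nat.coprime_two_left.1 hk
  have hgcd : Nat.gcd k 4 = 1 := (Nat.gcd_comm k 4).trans (gcd_two_pow_eq_one hk 2)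
  have hscale : scaleFactor 2 k = √2 := by
    rw [scaleFactor, hk, gcd_two_pow_eq_one hk, Nat.cast_one, div_one, div_one,
      Real.sqrt_sq zero_le_two, Real.div_sqrt]
  refine seriesTerm_two_left_of_polarCoeff ?_ ?_ n
  · rw [polarCoeff_of_odd hk, hgcd]
    norm_num
  · rw [hscale, hgcd, hodd.neg_one_pow, ← Real.sqrt_mul zero_le_two]
    congr 1
    norm_num
    ring

theorem seriesTerm_two_left_of_four_dvd {k : ℕ} (hk : 4 ∣ k) (n : ℕ) :
    seriesTerm 2 n k = ((2 / π : ℝ) : ℂ) * podTerm n k := by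
  have htwo : 2 ∣ k := dvd_trans (by norm_num) hk
  have hgcd_two : Nat.gcd 2 k = 2 := Nat.gcd_eq_left htwo
  have hgcd_four : Nat.gcd (2 ^ 2) k = 2 ^ 2 := Nat.gcd_eq_left hk
  have hscale : scaleFactor 2 k = 1 := by
    rw [scaleFactor, hgcd_two, hgcd_four]
    norm_num
  refine seriesTerm_two_left_of_polarCoeff ?_ ?_ n
  · rw [polarCoeff_of_even hgcd_two hgcd_four, Nat.gcd_eq_right hk]
    norm_num
  · rw [hscale, Nat.gcd_eq_right hk, (even_iff_two_dvd.2 htwo).neg_one_pow]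
    norm_num

theorem seriesTerm_two_left (n k : ℕ) :
    seriesTerm 2 n k = ((2 / π : ℝ) : ℂ) * podTerm n k := by
  rcases gcd_two_eq_one_or_two k with hodd | heven
  · exact seriesTerm_two_left_of_odd hodd n
  by_cases hfour : 4 ∣ k
  · exact seriesTerm_two_left_of_four_dvd hfour n
  obtain ⟨j, hj, hgcd⟩ := (Nat.dvd_prime_pow Nat.prime_two).1 (Nat.gcd_dvd_left (2 ^ 2) k)
  have hj_lt : j < 2 := hj.lt_of_ne fun h => by
    rw [h] at hgcd
    exact hfour (Nat.gcd_eq_left_iff_dvd.1 hgcd)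
  have hfloor : Nat.gcd k 4 / 4 = 0 := by
    rw [Nat.gcd_comm, show 4 = 2 ^ 2 from rfl, hgcd]
    exact Nat.div_eq_of_lt (Nat.pow_lt_pow_right one_lt_two hj_lt)
  have hk : Even k := even_iff_two_dvd.2 (Nat.gcd_eq_left_iff_dvd.1 heven)
  rw [seriesTerm_eq_zero heven hgcd hj_lt, podTerm, hfloor, hk.neg_one_pow]
  simp

theorem hasSum_overTerm {n : ℕ} (hn : 1 ≤ n) :
    HasSum (fun k : {k : ℕ | 1 ≤ k ∧ ¬ 2 ∣ k} => ((1 / (2 * π) : ℝ) : ℂ) * overTerm n k)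
      (numOverpartitions n : ℂ) := by
  have hsum := hasSum_seriesTerm zero_le_four (n := n) (by simpa using Nat.lt_of_succ_le hn)
  have hsupport : Function.support (seriesTerm 0 n) ⊆ {k : ℕ | 1 ≤ k ∧ ¬ 2 ∣ k} := fun k hk =>
    ⟨Nat.one_le_iff_ne_zero.2 fun h => hk (h ▸ seriesTerm_zero 0 n), fun h =>
      hk (seriesTerm_eq_zero (j := 0) (Nat.gcd_eq_left h) (Nat.gcd_one_left k) one_pos n)⟩
  rw [pr_zero, ← hasSum_subtype_iff_of_support_subset hsupport] at hsum
  exact hsum.congr_fun fun k => (seriesTerm_zero_left_of_odd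
    ((Nat.Prime.coprime_iff_not_dvd Nat.prime_two).2 k.2.2) n).symm

theorem hasSum_seriesTerm_pos {r n : ℕ} (hr : r ≤ 4) (hn : ((2 : ℝ) ^ r - 1) / 24 < n) :
    HasSum (fun k : {k : ℕ | 1 ≤ k} => seriesTerm r n k) (pr r n) :=
  (hasSum_subtype_iff_of_support_subset fun _ hk => Nat.one_le_iff_ne_zero.2 fun h =>
    hk (h ▸ seriesTerm_zero r n)).2 (hasSum_seriesTerm hr hn)

theorem hasSum_partTerm {n : ℕ} (hn : 1 ≤ n) :
    HasSum (fun k : {k : ℕ | 1 ≤ k} => ((1 / (π * √2) : ℝ) : ℂ) * partTerm n k)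
      (numPartitions n : ℂ) := by
  have hone : (1 : ℝ) ≤ n := by exact_mod_cast hn
  have hsum := hasSum_seriesTerm_pos (r := 1) (n := n) (by norm_num) (by linarith)
  rw [pr_one] at hsum
  exact hsum.congr_fun fun k => (seriesTerm_one_left n k).symm

theorem hasSum_podTerm {n : ℕ} (hn : 1 ≤ n) :
    HasSum (fun k : {k : ℕ | 1 ≤ k} => ((2 / π : ℝ) : ℂ) * podTerm n k) (pod n : ℂ) := by
  have hone : (1 : ℝ) ≤ n := by exact_mod_cast hn
  have hsum := hasSum_seriesTerm_pos (r := 2) (n := n) (by norm_num) (by linarith)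
  rw [pr_two] at hsum
  exact hsum.congr_fun fun k => (seriesTerm_two_left n k).symm

end SpecialCases

end Rademacher

end

open Rademacher in
theorem theorem1 :
    (∀ r : ℕ, r ≤ 4 → ∀ n : ℕ, ((2 : ℝ) ^ r - 1) / 24 < n →
      Summable (fun k : {k : ℕ // 1 ≤ k ∧ Nat.gcd k (2 ^ max r 1) = 1} => mainTerm r n k) ∧
      (∀ j ∈ Finset.Icc (1 + r / 2) r,
        Summable (fun k : {k : ℕ // 1 ≤ k ∧ Nat.gcd k (2 ^ r) = 2 ^ j} => extraTerm r j n k)) ∧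
      pr r n =
        (((2 : ℝ) ^ (((r : ℝ) + 1) / 2) * Real.sqrt 3 / Real.pi : ℝ) : ℂ)
            * ∑' k : {k : ℕ // 1 ≤ k ∧ Nat.gcd k (2 ^ max r 1) = 1}, mainTerm r n k
          + ((Real.sqrt 3 / Real.pi : ℝ) : ℂ)
            * ∑ j ∈ Finset.Icc (1 + r / 2) r,
                (((2 : ℝ) ^ ((2 - (j : ℝ) + (r : ℝ)) / 2) : ℝ) : ℂ)
                  * ∑' k : {k : ℕ // 1 ≤ k ∧ Nat.gcd k (2 ^ r) = 2 ^ j}, extraTerm r j n k) ∧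
    (∀ n : ℕ, pr 0 n = numOverpartitions n ∧ pr 1 n = numPartitions n ∧ pr 2 n = pod n) ∧
    (∀ n : ℕ, 1 ≤ n →
      HasSum (fun k : {k : ℕ // 1 ≤ k ∧ ¬ 2 ∣ k} =>
        ((1 / (2 * Real.pi) : ℝ) : ℂ) * overTerm n k) (numOverpartitions n : ℂ) ∧
      HasSum (fun k : {k : ℕ // 1 ≤ k} =>
        ((1 / (Real.pi * Real.sqrt 2) : ℝ) : ℂ) * partTerm n k) (numPartitions n : ℂ) ∧
      HasSum (fun k : {k : ℕ // 1 ≤ k} =>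
        ((2 / Real.pi : ℝ) : ℂ) * podTerm n k) (pod n : ℂ)) := by
  exact ⟨fun r hr n hn => exact_formula hr hn, fun n => ⟨pr_zero n, pr_one n, pr_two n⟩,
    fun n hn => ⟨hasSum_overTerm hn, hasSum_partTerm hn, hasSum_podTerm hn⟩⟩
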